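/- Let $\mathcal F$ and $\mathcal G$ be $C^\infty$ foliations on $C^\infty$ manifolds $M$ and $N$ (finite-dimensional, Hausdorff, second countable, without boundary, not necessarily compact). A leafwise $k$-form of $\mathcal F$ is a $C^\infty$ section of $\mathrm{Hom}(\bigwedge^k T\mathcal F;\mathbb R)$, where $T\mathcal F\subset TM$ is the tangent bundle of $\mathcal F$; these form a space $\Omega^k(\mathcal F)$. The leafwise exterior derivative $d_{\mathcal F}:\Omega^k(\mathcal F)\to\Omega^{k+1}(\mathcal F)$ is given, on smooth vector fields $X_0,\dots,X_k$ tangent to $\mathcal F$, by $$(d_{\mathcal F}\omega)(X_0,\dots,X_k)=\sum_i(-1)^iX_i\big(\omega(\dots,\widehat{X_i},\dots)\big)+\sum_{i<j}(-1)^{i+j}\omega([X_i,X_j],\dots,\widehat{X_i},\dots,\widehat{X_j},\dots),$$ and the leafwise cohomology is $H^k(\mathcal F)=\ker\big(d_{\mathcal F}|_{\Omega^k(\mathcal F)}\big)/d_{\mathcal F}\big(\Omega^{k-1}(\mathcal F)\big)$, with $\Omega^{-1}(\mathcal F)=0$. The product foliation $\mathcal F\times\mathcal G$ on $M\times N$ is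 the foliation whose leaves are the products of leaves of $\mathcal F$ and $\mathcal G$, so that $T(\mathcal F\times\mathcal G)=T\mathcal F\times T\mathcal G$. Theorem (Künneth formula). Let $k\ge 0$ and assume that $\dim_{\mathbb R} H^j(\mathcal G)<\infty$ for $0\le j\le k$. Then there is an isomorphism of real vector spaces $$\bigoplus_{i+j=k}H^i(\mathcal F)\otimes_{\mathbb R} H^j(\mathcal G)\;\cong\;H^k(\mathcal F\times\mathcal G),$$ given by the cross product: it sends $[\alpha]\otimes[\beta]$ to $[\mathrm{pr}_1^*\alpha\wedge\mathrm{pr}_2^*\beta]$ for all $d_{\mathcal F}$-closed $\alpha\in\Omega^i(\mathcal F)$ and $d_{\mathcal G}$-closed $\beta\in\Omega^j(\mathcal G)$ with $i+j=k$. -/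

import Mathlib

open scoped Manifold ContDiff TensorProduct DirectSum

noncomputable section

/-- A smooth foliation of a manifold `M` (without boundary), given by its tangent bundle `TF`:
a field of tangent subspaces such that around every point there is a smooth chart
`φ : U → E` and a `dim`-dimensional subspace `W ⊆ E` with `T_yF = (dφ_y)⁻¹(W)` for all `y ∈ U`.
The plaques in `U` are the preimages under `φ` of the translates of `W`, and the leaves are
obtained by gluing plaques. -/
structure Foliation {E H : Type*} [NormedAddCommGroup E] [NormedSpace ℝ E] [TopologicalSpace H]
    (I : ModelWithCorners ℝ E H) (M : Type*) [TopologicalSpace M] [ChartedSpace H M] where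
  /-- the dimension of the leaves -/
  dim : ℕ
  /-- the tangent bundle of the foliation -/
  tangent : ∀ x : M, Submodule ℝ (TangentSpace I x)
  exists_foliatedChart : ∀ x : M, ∃ φ ∈ IsManifold.maximalAtlas I ∞ M, x ∈ φ.source ∧
    ∃ W : Submodule ℝ E, Module.finrank ℝ W = dim ∧ ∀ y ∈ φ.source,
      tangent y = W.comap (mfderiv I 𝓘(ℝ, E) (φ.extend I) y).toLinearMap

namespace Foliation

section Basic

variable {E H : Type*} [NormedAddCommGroup E] [NormedSpace ℝ E] [FiniteDimensional ℝ E]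
  [TopologicalSpace H] {I : ModelWithCorners ℝ E H} [I.Boundaryless]
  {M : Type*} [TopologicalSpace M] [ChartedSpace H M] [IsManifold I ∞ M]

/-- Smooth vector fields on `M` tangent to the foliation, i.e. smooth sections of `TF`. -/
def fields (F : Foliation I M) :
    Submodule ℝ (Cₛ^∞⟮I; E, (TangentSpace I : M → Type _)⟯) where
  carrier := {X | ∀ x, X x ∈ F.tangent x}
  add_mem' hX hY x := (F.tangent x).add_mem (hX x) (hY x)
  zero_mem' x := (F.tangent x).zero_mem
  smul_mem' c _ hX x := (F.tangent x).smul_mem c (hX x)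

/-- The value at `x` of a vector field tangent to the foliation. -/
def fieldAt (F : Foliation I M) (X : F.fields) (x : M) : F.tangent x := ⟨X.1 x, X.2 x⟩

/-- The function `α(X₁, …, X_k)`. -/
def eval (F : Foliation I M) {k : ℕ} (α : ∀ x, (F.tangent x) [⋀^Fin k]→ₗ[ℝ] ℝ)
    (X : Fin k → F.fields) (x : M) : ℝ :=
  α x fun i => F.fieldAt (X i) x

/-- The leafwise `k`-forms, as a subspace of all families of alternating `k`-forms on the tangent
spaces of the leaves: those families which are smooth, that is, they give smooth functions on
all tuples of smooth vector fields tangent to the foliation. -/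
def formSubmodule (F : Foliation I M) (k : ℕ) :
    Submodule ℝ (∀ x : M, (F.tangent x) [⋀^Fin k]→ₗ[ℝ] ℝ) where
  carrier := {α | ∀ X : Fin k → F.fields, ContMDiff I 𝓘(ℝ, ℝ) ∞ (F.eval α X)}
  add_mem' hα hβ X := (hα X).add (hβ X)
  zero_mem' X := by
    have : F.eval (0 : ∀ x : M, (F.tangent x) [⋀^Fin k]→ₗ[ℝ] ℝ) X = fun _ => 0 := rfl
    rw [this]
    exact contMDiff_const
  smul_mem' c _ hα X := contMDiff_const.mul (hα X)

/-- The space `Ω^k(F)` of leafwise `k`-forms. -/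
def Form (F : Foliation I M) (k : ℕ) : Type _ := F.formSubmodule k

instance (F : Foliation I M) (k : ℕ) : AddCommGroup (F.Form k) :=
  inferInstanceAs (AddCommGroup (F.formSubmodule k))

instance (F : Foliation I M) (k : ℕ) : Module ℝ (F.Form k) :=
  inferInstanceAs (Module ℝ (F.formSubmodule k))

/-- The inverse of a smooth chart has invertible derivative, with inverse the derivative of the
chart. -/
theorem mfderiv_extend_symm_inverse {φ : OpenPartialHomeomorph M H}
    (hφ : φ ∈ IsManifold.maximalAtlas I ∞ M) {e : E} (he : e ∈ (φ.extend I).target) :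
    (mfderiv 𝓘(ℝ, E) I (φ.extend I).symm e).inverse =
      mfderiv I 𝓘(ℝ, E) (φ.extend I) ((φ.extend I).symm e) := by
  have hs : (φ.extend I).symm e ∈ φ.source := by
    simpa using (φ.extend I).map_target he
  have hop : IsOpen (φ.extend I).target := φ.isOpen_extend_target
  have hr : (φ.extend I) ((φ.extend I).symm e) = e := (φ.extend I).right_inv he
  have d1 : MDifferentiableAt I 𝓘(ℝ, E) (φ.extend I) ((φ.extend I).symm e) :=
    ((φ.contMDiffOn_extend hφ).contMDiffAt (φ.open_source.mem_nhds hs)).mdifferentiableAt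
      (by simp)
  have d2 : MDifferentiableAt 𝓘(ℝ, E) I (φ.extend I).symm e := by
    have h := contMDiffOn_extend_symm (I := I) hφ
    rw [← φ.extend_target'] at h
    exact (h.contMDiffAt (hop.mem_nhds he)).mdifferentiableAt (by simp)
  apply ContinuousLinearMap.inverse_eq
  · have := d2.hasMFDerivAt
    rw [← hr] at this
    have h := (this.comp _ d1.hasMFDerivAt)
    have h2 := (hasMFDerivAt_id (I := I) ((φ.extend I).symm e)).congr_of_eventuallyEq
      (f₁ := (φ.extend I).symm ∘ (φ.extend I))
      (Filter.eventually_of_mem (φ.open_source.mem_nhds hs) fun y hy =>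
        (φ.extend I).left_inv (by simpa using hy))
    have h3 := hasMFDerivAt_unique h h2
    rw [hr] at h3
    exact h3
  · have h := d1.hasMFDerivAt.comp e d2.hasMFDerivAt
    have h2 := (hasMFDerivAt_id (I := 𝓘(ℝ, E)) e).congr_of_eventuallyEq
      (f₁ := (φ.extend I) ∘ (φ.extend I).symm)
      (Filter.eventually_of_mem (hop.mem_nhds he) fun y hy => (φ.extend I).right_inv hy)
    exact hasMFDerivAt_unique h h2

/-- The derivative of a map with values in a subspace takes values in that subspace. -/
theorem fderiv_mem_of_eventually_mem {f : E → E} {W : Submodule ℝ E} {e : E}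
    (hf : ∀ᶠ y in nhds e, f y ∈ W) (v : E) : fderiv ℝ f e v ∈ W := by
  by_cases hd : DifferentiableAt ℝ f e
  · by_contra hv
    obtain ⟨l, hl, hW⟩ := Submodule.exists_le_ker_of_notMem hv
    have h0 : (fun y => (LinearMap.toContinuousLinearMap l) (f y)) =ᶠ[nhds e] fun _ => (0 : ℝ) :=
      hf.mono fun y hy => hW hy
    have h1 := ((LinearMap.toContinuousLinearMap l).hasFDerivAt.comp e hd.hasFDerivAt).fderiv
    have h2 := h0.fderiv_eq (𝕜 := ℝ)
    have h3 := congrArg (fun T : E →L[ℝ] ℝ => T v) (h1.symm.trans h2)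
    simp at h3
    exact hl h3
  · rw [fderiv_zero_of_not_differentiableAt hd]
    exact W.zero_mem

/-- The tangent bundle of a foliation is closed under the Lie bracket. -/
theorem mlieBracket_mem (F : Foliation I M) (X Y : F.fields) (x : M) :
    VectorField.mlieBracket I X.1 Y.1 x ∈ F.tangent x := by
  obtain ⟨φ, hφ, hx, W, -, hW⟩ := F.exists_foliatedChart x
  have hop : IsOpen (φ.extend I).target := φ.isOpen_extend_target
  have hx' : x ∈ (φ.extend I).source := by simpa using hx
  set e : E := φ.extend I x with he_def
  have he : e ∈ (φ.extend I).target := (φ.extend I).map_source hx'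
  have hl : (φ.extend I).symm e = x := (φ.extend I).left_inv hx'
  have key : ∀ Z : F.fields, ∀ e' ∈ (φ.extend I).target,
      (VectorField.mpullback 𝓘(ℝ, E) I (φ.extend I).symm Z.1 e' : E) ∈ W := by
    intro Z e' he'
    have hs : (φ.extend I).symm e' ∈ φ.source := by
      simpa using (φ.extend I).map_target he'
    have h := Z.2 ((φ.extend I).symm e')
    rw [hW _ hs] at h
    rw [VectorField.mpullback_apply, mfderiv_extend_symm_inverse hφ he']
    exact h
  have : IsManifold I (minSmoothness ℝ 3) M := by
    rw [minSmoothness_of_isRCLikeNormedField]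
    infer_instance
  have d2 : ContMDiffAt 𝓘(ℝ, E) I ∞ (φ.extend I).symm e := by
    have h := contMDiffOn_extend_symm (I := I) hφ
    rw [← φ.extend_target'] at h
    exact h.contMDiffAt (hop.mem_nhds he)
  have hb := VectorField.mpullback_mlieBracket (n := ∞) (V := X.1) (W := Y.1)
    (X.1.contMDiff.contMDiffAt.mdifferentiableAt (by simp))
    (Y.1.contMDiff.contMDiffAt.mdifferentiableAt (by simp)) d2
    (by rw [minSmoothness_of_isRCLikeNormedField]; exact WithTop.coe_le_coe.2 le_top)
  have hmem : ∀ V V' : E → E, (∀ e' ∈ (φ.extend I).target, V e' ∈ W) →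
      (∀ e' ∈ (φ.extend I).target, V' e' ∈ W) →
      (VectorField.mlieBracket 𝓘(ℝ, E) V V' e : E) ∈ W := by
    intro V V' hV hV'
    have h : (VectorField.mlieBracket 𝓘(ℝ, E) V V' e : E) = VectorField.lieBracket ℝ V V' e :=
      (congrFun VectorField.mlieBracketWithin_univ e).symm.trans
        ((congrFun VectorField.mlieBracketWithin_eq_lieBracketWithin e).trans
          (congrFun VectorField.lieBracketWithin_univ e))
    rw [h, VectorField.lieBracket]
    exact W.sub_mem
      (fderiv_mem_of_eventually_mem (Filter.eventually_of_mem (hop.mem_nhds he) hV') _)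
      (fderiv_mem_of_eventually_mem (Filter.eventually_of_mem (hop.mem_nhds he) hV) _)
  replace hmem := hmem _ _ (key X) (key Y)
  rw [← hb, VectorField.mpullback_apply, mfderiv_extend_symm_inverse hφ he, hl] at hmem
  rw [hW x hx]
  exact hmem

theorem contMDiff_mlieBracket (X Y : Cₛ^∞⟮I; E, (TangentSpace I : M → Type _)⟯) :
    ContMDiff I I.tangent ∞ (fun x => (⟨x, VectorField.mlieBracket I X Y x⟩ : TangentBundle I M)) := by
  have : IsManifold I (minSmoothness ℝ 3) M := by
    rw [minSmoothness_of_isRCLikeNormedField]; infer_instance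
  have : IsManifold I ((⊤ : ℕ∞) + 1) M := by
    have h : (((⊤ : ℕ∞) : WithTop ℕ∞) + 1) = ∞ := by rfl
    rw [h]; infer_instance
  exact ContDiff.mlieBracket_vectorField (m := ⊤) (n := ⊤) X.contMDiff Y.contMDiff
    (by rw [minSmoothness_of_isRCLikeNormedField]; exact le_rfl)

/-- The Lie bracket of two vector fields tangent to the foliation. -/
def bracket (F : Foliation I M) (X Y : F.fields) : F.fields :=
  ⟨⟨VectorField.mlieBracket I X.1 Y.1, contMDiff_mlieBracket X.1 Y.1⟩, F.mlieBracket_mem X Y⟩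

/-- The derivative `X(f)` of a function along a vector field tangent to the foliation. -/
def dirDeriv (F : Foliation I M) (X : F.fields) (f : M → ℝ) (x : M) : ℝ :=
  mfderiv I 𝓘(ℝ, ℝ) f x (X.1 x)

/-- The second sum
`∑_{0 ≤ i < j ≤ k} (-1)^(i+j) α([X_i, X_j], X_0, …, X̂_i, …, X̂_j, …, X_k)`
in the formula for the exterior derivative of a `k`-form. As in `extDeriv_apply_vectorField`, the
pair `i < j` is written as `(i.castSucc, j.succ)` with `i ≤ j`, which flips the sign. -/
def bracketSum (F : Foliation I M) : {k : ℕ} → (∀ x, (F.tangent x) [⋀^Fin k]→ₗ[ℝ] ℝ) →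
    (Fin (k + 1) → F.fields) → M → ℝ
  | 0, _, _, _ => 0
  | k + 1, α, X, x => -∑ i : Fin (k + 1), ∑ j ∈ Finset.Ici i, (-1) ^ (i + j : ℕ) *
      F.eval α (Matrix.vecCons (F.bracket (X i.castSucc) (X j.succ))
        (j.removeNth (i.castSucc.removeNth X))) x

/-- The right-hand side of the formula for the exterior derivative,
`∑_i (-1)^i X_i(α(X_0, …, X̂_i, …, X_k)) +
  ∑_{i < j} (-1)^(i+j) α([X_i, X_j], X_0, …, X̂_i, …, X̂_j, …, X_k)`. -/
def koszul (F : Foliation I M) {k : ℕ} (α : ∀ x, (F.tangent x) [⋀^Fin k]→ₗ[ℝ] ℝ)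
    (X : Fin (k + 1) → F.fields) (x : M) : ℝ :=
  (∑ i : Fin (k + 1), (-1) ^ (i : ℕ) *
    F.dirDeriv (X i) (F.eval α (i.removeNth X)) x) +
    F.bracketSum α X x

/-- `β = d_F α`: the leafwise `(k+1)`-form `β` is the leafwise exterior derivative of the
leafwise `k`-form `α`. As every tangent vector of a leaf extends to a field tangent to the
foliation, `β` is determined by `α`. -/
def IsDeriv (F : Foliation I M) {k : ℕ} (α : F.Form k) (β : F.Form (k + 1)) : Prop :=
  ∀ (X : Fin (k + 1) → F.fields) (x : M), F.eval β.1 X x = F.koszul α.1 X x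

theorem dirDeriv_add (F : Foliation I M) (X : F.fields) {f g : M → ℝ}
    (hf : ContMDiff I 𝓘(ℝ, ℝ) ∞ f) (hg : ContMDiff I 𝓘(ℝ, ℝ) ∞ g) (x : M) :
    F.dirDeriv X (f + g) x = F.dirDeriv X f x + F.dirDeriv X g x := by
  have h := mfderiv_add (hf.mdifferentiable (by simp) x) (hg.mdifferentiable (by simp) x)
  exact congrArg (fun T : E →L[ℝ] ℝ => T (X.1 x)) h

theorem dirDeriv_smul (F : Foliation I M) (X : F.fields) {f : M → ℝ}
    (hf : ContMDiff I 𝓘(ℝ, ℝ) ∞ f) (c : ℝ) (x : M) :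
    F.dirDeriv X (c • f) x = c * F.dirDeriv X f x := by
  have h := const_smul_mfderiv (hf.mdifferentiable (by simp) x) c
  exact congrArg (fun T : E →L[ℝ] ℝ => T (X.1 x)) h

theorem IsDeriv.add {F : Foliation I M} {k : ℕ} {α α' : F.Form k} {β β' : F.Form (k + 1)}
    (h : F.IsDeriv α β) (h' : F.IsDeriv α' β') : F.IsDeriv (α + α') (β + β') := by
  intro X x
  have e1 : F.eval (β + β').1 X x = F.eval β.1 X x + F.eval β'.1 X x := rfl
  have e2 : ∀ i : Fin (k + 1), F.dirDeriv (X i) (F.eval (α + α').1 (i.removeNth X)) x =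
      F.dirDeriv (X i) (F.eval α.1 (i.removeNth X)) x +
      F.dirDeriv (X i) (F.eval α'.1 (i.removeNth X)) x := fun i =>
    F.dirDeriv_add (X i) (α.2 _) (α'.2 _) x
  have e3 : F.bracketSum (α + α').1 X x = F.bracketSum α.1 X x + F.bracketSum α'.1 X x := by
    cases k with
    | zero => simp [bracketSum]
    | succ k =>
      have e4 : ∀ Y, F.eval (α + α').1 Y x = F.eval α.1 Y x + F.eval α'.1 Y x := fun _ => rfl
      simp only [bracketSum, e4, mul_add, Finset.sum_add_distrib, neg_add]
  rw [e1, h X x, h' X x]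
  simp only [koszul, e2, e3, mul_add, Finset.sum_add_distrib]
  ring

theorem IsDeriv.smul {F : Foliation I M} {k : ℕ} {α : F.Form k} {β : F.Form (k + 1)}
    (h : F.IsDeriv α β) (c : ℝ) : F.IsDeriv (c • α) (c • β) := by
  intro X x
  have e1 : F.eval (c • β).1 X x = c * F.eval β.1 X x := rfl
  have e2 : ∀ i : Fin (k + 1), F.dirDeriv (X i) (F.eval (c • α).1 (i.removeNth X)) x =
      c * F.dirDeriv (X i) (F.eval α.1 (i.removeNth X)) x := fun i =>
    F.dirDeriv_smul (X i) (α.2 _) c x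
  have e3 : F.bracketSum (c • α).1 X x = c * F.bracketSum α.1 X x := by
    cases k with
    | zero => simp [bracketSum]
    | succ k =>
      have e4 : ∀ Y, F.eval (c • α).1 Y x = c * F.eval α.1 Y x := fun _ => rfl
      simp only [bracketSum, e4, mul_left_comm _ c, ← Finset.mul_sum, mul_neg]
  rw [e1, h X x]
  simp only [koszul, e2, e3, mul_left_comm _ c, ← Finset.mul_sum, mul_add]

theorem isDeriv_zero (F : Foliation I M) (k : ℕ) :
    F.IsDeriv (0 : F.Form k) (0 : F.Form (k + 1)) := by
  intro X x
  have e1 : F.eval (0 : F.Form (k + 1)).1 X x = 0 := rfl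
  have e2 : ∀ i : Fin (k + 1),
      F.dirDeriv (X i) (F.eval (0 : F.Form k).1 (i.removeNth X)) x = 0 := by
    intro i
    have h : F.eval (0 : F.Form k).1 (i.removeNth X) = fun _ => (0 : ℝ) := rfl
    rw [h, dirDeriv, mfderiv_const]
    rfl
  have e3 : F.bracketSum (0 : F.Form k).1 X x = 0 := by
    cases k with
    | zero => simp [bracketSum]
    | succ k =>
      have e4 : ∀ Y, F.eval (0 : F.Form (k + 1)).1 Y x = 0 := fun _ => rfl
      simp only [bracketSum, e4, mul_zero, Finset.sum_const_zero, neg_zero]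
  rw [e1]
  simp only [koszul, e2, e3, mul_zero, Finset.sum_const_zero, add_zero]

/-- The kernel of `d_F` on `Ω^k(F)`. -/
def cocycles (F : Foliation I M) (k : ℕ) : Submodule ℝ (F.Form k) where
  carrier := {α | F.IsDeriv α 0}
  add_mem' h h' := by simpa using IsDeriv.add h h'
  zero_mem' := F.isDeriv_zero k
  smul_mem' c _ h := by simpa using IsDeriv.smul h c

/-- The image of `d_F` in `Ω^k(F)`; it is zero for `k = 0`. -/
def coboundaries (F : Foliation I M) : (k : ℕ) → Submodule ℝ (F.Form k)
  | 0 => ⊥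
  | k + 1 =>
    { carrier := {β | ∃ α : F.Form k, F.IsDeriv α β}
      add_mem' := fun ⟨α, h⟩ ⟨α', h'⟩ => ⟨α + α', h.add h'⟩
      zero_mem' := ⟨0, F.isDeriv_zero k⟩
      smul_mem' := fun c _ ⟨α, h⟩ => ⟨c • α, h.smul c⟩ }

/-- The leafwise cohomology `H^k(F)`. -/
abbrev Cohomology (F : Foliation I M) (k : ℕ) : Type _ :=
  F.cocycles k ⧸ (F.coboundaries k).comap (F.cocycles k).subtype

/-- The class of a leafwise cocycle. -/
def toCohomology (F : Foliation I M) (k : ℕ) : F.cocycles k →ₗ[ℝ] F.Cohomology k :=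
  Submodule.mkQ _

end Basic

section Product

variable {E H : Type*} [NormedAddCommGroup E] [NormedSpace ℝ E] [FiniteDimensional ℝ E]
  [TopologicalSpace H] {I : ModelWithCorners ℝ E H}
  {M : Type*} [TopologicalSpace M] [ChartedSpace H M] [IsManifold I ∞ M]
  {E' H' : Type*} [NormedAddCommGroup E'] [NormedSpace ℝ E'] [FiniteDimensional ℝ E']
  [TopologicalSpace H'] {J : ModelWithCorners ℝ E' H'}
  {N : Type*} [TopologicalSpace N] [ChartedSpace H' N] [IsManifold J ∞ N]

/-- Products of smooth charts are smooth charts. -/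
theorem prod_mem_maximalAtlas {φ : OpenPartialHomeomorph M H} {ψ : OpenPartialHomeomorph N H'}
    (hφ : φ ∈ IsManifold.maximalAtlas I ∞ M) (hψ : ψ ∈ IsManifold.maximalAtlas J ∞ N) :
    φ.prod ψ ∈ IsManifold.maximalAtlas (I.prod J) ∞ (M × N) := by
  rw [IsManifold.mem_maximalAtlas_iff]
  rintro _ ⟨e, he, e', he', rfl⟩
  constructor
  · rw [OpenPartialHomeomorph.prod_symm, OpenPartialHomeomorph.prod_trans]
    exact contDiffGroupoid_prod (hφ e he).1 (hψ e' he').1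
  · rw [OpenPartialHomeomorph.prod_symm, OpenPartialHomeomorph.prod_trans]
    exact contDiffGroupoid_prod (hφ e he).2 (hψ e' he').2

/-- The derivative of a product of charts. -/
theorem mfderiv_prod_extend {φ : OpenPartialHomeomorph M H} {ψ : OpenPartialHomeomorph N H'}
    (hφ : φ ∈ IsManifold.maximalAtlas I ∞ M) (hψ : ψ ∈ IsManifold.maximalAtlas J ∞ N)
    {a : M} {b : N} (ha : a ∈ φ.source) (hb : b ∈ ψ.source) (v : E) (w : E') :
    (mfderiv (I.prod J) 𝓘(ℝ, E × E') ((φ.prod ψ).extend (I.prod J)) (a, b) (v, w) : E × E') =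
      (mfderiv I 𝓘(ℝ, E) (φ.extend I) a v, mfderiv J 𝓘(ℝ, E') (ψ.extend J) b w) := by
  have d1 : MDifferentiableAt I 𝓘(ℝ, E) (φ.extend I) a :=
    ((φ.contMDiffOn_extend hφ).contMDiffAt (φ.open_source.mem_nhds ha)).mdifferentiableAt
      (by simp)
  have d2 : MDifferentiableAt J 𝓘(ℝ, E') (ψ.extend J) b :=
    ((ψ.contMDiffOn_extend hψ).contMDiffAt (ψ.open_source.mem_nhds hb)).mdifferentiableAt
      (by simp)
  have h := d1.hasMFDerivAt.prodMap (p := (a, b)) d2.hasMFDerivAt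
  have h' : HasMFDerivAt (I.prod J) 𝓘(ℝ, E × E') ((φ.prod ψ).extend (I.prod J)) (a, b) _ :=
    ⟨h.1, h.2⟩
  rw [h'.mfderiv]
  rfl

/-- The product foliation on `M × N`, with tangent bundle `TF × TG`. Products of foliated charts
are foliated charts, so its plaques are products of plaques and its leaves are products of
leaves. -/
def prod (F : Foliation I M) (G : Foliation J N) : Foliation (I.prod J) (M × N) where
  dim := F.dim + G.dim
  tangent p := (F.tangent p.1).prod (G.tangent p.2)
  exists_foliatedChart := by
    rintro ⟨x, y⟩
    obtain ⟨φ, hφ, hx, W, hWd, hW⟩ := F.exists_foliatedChart x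
    obtain ⟨ψ, hψ, hy, V, hVd, hV⟩ := G.exists_foliatedChart y
    refine ⟨φ.prod ψ, prod_mem_maximalAtlas hφ hψ, ⟨hx, hy⟩, W.prod V, ?_, ?_⟩
    · rw [← hWd, ← hVd, ← Module.finrank_prod]
      exact LinearEquiv.finrank_eq
        { toFun := fun p => (⟨p.1.1, p.2.1⟩, ⟨p.1.2, p.2.2⟩)
          invFun := fun p => ⟨(p.1.1, p.2.1), p.1.2, p.2.2⟩
          map_add' := fun _ _ => rfl
          map_smul' := fun _ _ => rfl }
    · rintro ⟨a, b⟩ ⟨ha, hb⟩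
      ext ⟨v, w⟩
      have h := mfderiv_prod_extend hφ hψ ha hb v w
      rw [hW a ha, hV b hb]
      change _ ↔ (mfderiv (I.prod J) 𝓘(ℝ, E × E') ((φ.prod ψ).extend (I.prod J)) (a, b) (v, w) :
        E × E') ∈ W.prod V
      rw [h]
      rfl

/-- The cross product `pr₁^*α ∧ pr₂^*β` at a point, of an alternating `i`-form `α` on `P` and an
alternating `j`-form `β` on `Q`, as an alternating `k`-form on `P × Q`, where `i + j = k`.
The wedge product is the sum over shuffles. -/
def crossAt {V V' : Type*} [AddCommGroup V] [Module ℝ V] [AddCommGroup V'] [Module ℝ V']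
    (P : Submodule ℝ V) (Q : Submodule ℝ V') {i j k : ℕ} (h : i + j = k)
    (α : P [⋀^Fin i]→ₗ[ℝ] ℝ) (β : Q [⋀^Fin j]→ₗ[ℝ] ℝ) : (P.prod Q) [⋀^Fin k]→ₗ[ℝ] ℝ :=
  let pr₁ : P.prod Q →ₗ[ℝ] P :=
    (LinearMap.fst ℝ V V').restrict fun v hv => by simpa using (Submodule.mem_prod.1 hv).1
  let pr₂ : P.prod Q →ₗ[ℝ] Q :=
    (LinearMap.snd ℝ V V').restrict fun v hv => by simpa using (Submodule.mem_prod.1 hv).2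
  ((LinearMap.mul' ℝ ℝ).compAlternatingMap
    ((α.compLinearMap pr₁).domCoprod (β.compLinearMap pr₂))).domDomCongr
    (finSumFinEquiv.trans (finCongr h))

end Product

end Foliation

end

/-! Filter the forms on `M × N` by the number `p` of entries taken from the first factor. If `τ`
vanishes on tuples with fewer than `p` such entries, then the leading part of `dτ` is, up to sign,
`d_G` applied to the slices `τ(u₁, …, u_p, ·)`, which are forms on `N` (`d_mixed_leading`). If `τ`
is closed, its slices are therefore closed. Fix closed forms `h_s` representing a basis of `H^q(G)`,
and linear functionals on `Ω^q(G)` which kill exact forms and read off coefficients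
(`Representatives`). The coefficients of the slices are forms `b_s` on `M`, and `τ - ∑ b_s × h_s`
has exact slices. Primitives of these assemble to a form `ζ` with `τ - ∑ b_s × h_s ∓ dζ` one step
deeper in the filtration (`exists_reduction`).

Induction on the filtration shows that a form whose derivative is a combination of cross products
with representatives is itself such a combination modulo exact forms
(`mem_coboundaries_sup_crossSpan`). For closed forms this gives surjectivity. For a primitive of a
combination of cross products it gives injectivity, because the functionals recover the coefficients
and show them to be exact. A form of degree at most `k` has slices of degree at most `k`, so only
`H^j(G)` with `j ≤ k` enters.

The analytic content is that the `b_s` and the primitives can be chosen smooth in the point of `M`.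
As `H^q(G)` is finite-dimensional, `(a, η) ↦ ∑ a_s h_s + d_G η` is a continuous linear surjection of
Fréchet spaces onto the closed `q`-forms, so it is open. An open surjection lifts rapidly decreasing
families to rapidly decreasing families (`ContinuousLinearMap.exists_rapid_lift`). A smooth family
of closed forms over a small cube is a Fourier series whose coefficients are closed forms decreasing
rapidly in all jets. Lifting the coefficients and summing again gives smooth coefficients and smooth
primitives (`exists_smooth_primitive`). Since `d_G` commutes with multiplication by functions on
`M`, the local primitives are glued by a partition of unity on `M` (`exists_slice_primitive`). -/

noncomputable section

set_option linter.unusedSectionVars false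

open Set Filter Topology

/-! ### Alternating forms on finite-dimensional spaces; frames in foliated charts -/

section

namespace Foliation

theorem continuous_multilinearMap {V : Type*} [NormedAddCommGroup V] [NormedSpace ℝ V]
    [FiniteDimensional ℝ V] {k : ℕ} (α : MultilinearMap ℝ (fun _ : Fin k => V) ℝ) :
    Continuous α := by
  let b := Module.finBasis ℝ V
  have h : ∀ v : Fin k → V, α v = ∑ f : Fin k → Fin (Module.finrank ℝ V),
      (∏ i, b.repr (v i) (f i)) • α (fun i => b (f i)) := by
    intro v
    conv_lhs => rw [show v = fun i => ∑ j, b.repr (v i) j • b j from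
      funext fun i => (b.sum_repr (v i)).symm]
    rw [MultilinearMap.map_sum]
    exact Finset.sum_congr rfl fun f _ => α.map_smul_univ _ _
  have hc : ∀ j, Continuous fun w : V => b.repr w j := fun j =>
    (LinearMap.toContinuousLinearMap (b.coord j)).continuous
  rw [show (α : (Fin k → V) → ℝ) = _ from funext h]
  refine continuous_finsetSum _ fun f _ => Continuous.fun_smul ?_ continuous_const
  exact continuous_finsetProd _ fun i _ => (hc (f i)).comp (continuous_apply i)

/-- An alternating map on a finite-dimensional space is continuous. -/
def toContinuousAlternating {V : Type*} [NormedAddCommGroup V] [NormedSpace ℝ V]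
    [FiniteDimensional ℝ V] {k : ℕ} (α : V [⋀^Fin k]→ₗ[ℝ] ℝ) : V [⋀^Fin k]→L[ℝ] ℝ :=
  { α with cont := continuous_multilinearMap α.toMultilinearMap }

@[simp]
theorem toContinuousAlternating_apply {V : Type*} [NormedAddCommGroup V] [NormedSpace ℝ V]
    [FiniteDimensional ℝ V] {k : ℕ} (α : V [⋀^Fin k]→ₗ[ℝ] ℝ) (v : Fin k → V) :
    toContinuousAlternating α v = α v := rfl

/-- On a finite-dimensional space, the alternating maps are a finite-dimensional space. -/
instance finiteDimensional_continuousAlternatingMap {V : Type*} [NormedAddCommGroup V]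
    [NormedSpace ℝ V] [FiniteDimensional ℝ V] {k : ℕ} :
    FiniteDimensional ℝ (V [⋀^Fin k]→L[ℝ] ℝ) := by
  let L : (V [⋀^Fin k]→L[ℝ] ℝ) →ₗ[ℝ] MultilinearMap ℝ (fun _ : Fin k => V) ℝ :=
    { toFun := fun α => α.toMultilinearMap
      map_add' := fun _ _ => rfl
      map_smul' := fun _ _ => rfl }
  refine FiniteDimensional.of_injective L fun α β h => ?_
  ext v
  exact congrArg (fun T : MultilinearMap ℝ (fun _ : Fin k => V) ℝ => T v) h

/-- A finite set of points `t` and a dual family of forms `θ` reproducing every alternating form. -/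
theorem exists_alternating_reproducing (V : Type*) [NormedAddCommGroup V]
    [NormedSpace ℝ V] [FiniteDimensional ℝ V] (k : ℕ) :
    ∃ (n : ℕ) (t : Fin n → Fin k → V) (θ : Fin n → V [⋀^Fin k]→L[ℝ] ℝ),
      ∀ α : V [⋀^Fin k]→L[ℝ] ℝ, α = ∑ i, α (t i) • θ i := by
  let A := V [⋀^Fin k]→L[ℝ] ℝ
  let ev : (Fin k → V) → Module.Dual ℝ A := fun t =>
    { toFun := fun α => α t, map_add' := fun _ _ => rfl, map_smul' := fun _ _ => rfl }
  -- A form killed by all evaluations is zero, so by biduality the evaluations span the dual of `A`.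
  -- A basis chosen among them gives the points `t`, and its dual basis gives `θ`.
  have hspan : Submodule.span ℝ (range ev) = ⊤ := by
    refine Subspace.dualAnnihilator_inj.1 ?_
    rw [Submodule.dualAnnihilator_top, eq_bot_iff]
    intro Λ hΛ
    rw [Submodule.mem_dualAnnihilator] at hΛ
    obtain ⟨α, rfl⟩ := (Module.evalEquiv ℝ A).surjective Λ
    have h0 : α = 0 := by
      ext t
      exact hΛ (ev t) (Submodule.subset_span ⟨t, rfl⟩)
    simp [h0]
  obtain ⟨b, hb, hbs, hli⟩ := exists_linearIndependent ℝ (range ev)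
  rw [hspan] at hbs
  let B : Module.Basis b ℝ (Module.Dual ℝ A) := Module.Basis.mk hli (by simp [hbs])
  have : Finite b := Module.Finite.finite_basis B
  cases nonempty_fintype b
  let e := Fintype.equivFin b
  let B' := B.reindex e
  choose t ht using fun i => hb (e.symm i).2
  let θ : Fin (Fintype.card b) → A := fun i => (Module.evalEquiv ℝ A).symm (B'.dualBasis i)
  refine ⟨Fintype.card b, t, θ, fun α => ?_⟩
  have key : ∀ Λ : Module.Dual ℝ A, Λ α = Λ (∑ i, α (t i) • θ i) := by
    intro Λ
    have hB : ∀ i, B' i = ev (t i) := fun i => by simp [B', B, ht]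
    have hθ : ∀ i (Λ : Module.Dual ℝ A), Λ (θ i) = B'.repr Λ i := by
      intro i Λ
      simp [θ]
    conv_lhs => rw [← B'.sum_repr Λ]
    simp only [map_sum, map_smul, hθ, smul_eq_mul, LinearMap.sum_apply, LinearMap.smul_apply, hB]
    refine Finset.sum_congr rfl fun i _ => ?_
    rw [mul_comm]
    rfl
  have := sub_eq_zero.2 (show (α : A) = α from rfl)
  exact (Module.forall_dual_apply_eq_zero_iff ℝ (α - ∑ i, α (t i) • θ i)).1
    (fun Λ => by rw [map_sub, key Λ, sub_self]) |> sub_eq_zero.1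

/-- A map into the alternating forms is smooth if all its evaluations are. -/
theorem contDiffAt_alternating {V X : Type*} [NormedAddCommGroup V]
    [NormedSpace ℝ V] [FiniteDimensional ℝ V] [NormedAddCommGroup X] [NormedSpace ℝ X] {k : ℕ}
    {n : WithTop ℕ∞}
    {f : X → V [⋀^Fin k]→L[ℝ] ℝ} {x : X} (h : ∀ v, ContDiffAt ℝ n (fun y => f y v) x) :
    ContDiffAt ℝ n f x := by
  obtain ⟨m, t, θ, hθ⟩ := exists_alternating_reproducing V k
  have : f = fun y => ∑ i, f y (t i) • θ i := funext fun y => hθ (f y)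
  rw [this]
  exact ContDiffAt.sum fun i _ => (h (t i)).smul contDiffAt_const

theorem contDiffAt_alternating_apply {V X : Type*} [NormedAddCommGroup V]
    [NormedSpace ℝ V] [FiniteDimensional ℝ V] [NormedAddCommGroup X] [NormedSpace ℝ X] {k : ℕ}
    {n : WithTop ℕ∞} {f : X → V [⋀^Fin k]→L[ℝ] ℝ} {g : Fin k → X → V} {x : X}
    (hf : ContDiffAt ℝ n f x) (hg : ∀ i, ContDiffAt ℝ n (g i) x) :
    ContDiffAt ℝ n (fun y => f y (fun i => g i y)) x := by
  obtain ⟨m, t, θ, hθ⟩ := exists_alternating_reproducing V k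
  have : (fun y => f y (fun i => g i y)) =
      fun y => ∑ j, f y (t j) * θ j (fun i => g i y) := by
    funext y
    conv_lhs => rw [hθ (f y)]
    simp
  rw [this]
  refine ContDiffAt.sum fun j _ => ContDiffAt.mul ?_ ?_
  · exact (ContinuousAlternatingMap.apply ℝ V ℝ (t j)).contDiff.contDiffAt.comp x hf
  · exact (θ j).toContinuousMultilinearMap.contDiff.contDiffAt.comp x (contDiffAt_pi.2 hg)

variable {E H : Type*} [NormedAddCommGroup E] [NormedSpace ℝ E] [FiniteDimensional ℝ E]
  [TopologicalSpace H] {I : ModelWithCorners ℝ E H} [I.Boundaryless]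
  {M : Type*} [TopologicalSpace M] [ChartedSpace H M] [IsManifold I ∞ M]

/-- A foliated chart: a smooth chart in which the tangent spaces of the foliation are the range
of a fixed projection of the model space. -/
structure FoliatedChart (F : Foliation I M) where
  chart : OpenPartialHomeomorph M H
  mem : chart ∈ IsManifold.maximalAtlas I ∞ M
  proj : E →L[ℝ] E
  proj_proj : ∀ v, proj (proj v) = proj v
  mem_tangent_iff : ∀ y ∈ chart.source, ∀ v : TangentSpace I y, v ∈ F.tangent y ↔
    proj (mfderiv I 𝓘(ℝ, E) (chart.extend I) y v : E) =
      (mfderiv I 𝓘(ℝ, E) (chart.extend I) y v : E)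

/-- A projection onto `W` turns tangency into an equation and lets a form on the tangent spaces of
the leaves be represented by a form on all of `E`, without any choice of basis of `W`. -/
theorem exists_foliatedChart_at (F : Foliation I M) (x : M) :
    ∃ c : F.FoliatedChart, x ∈ c.chart.source := by
  obtain ⟨φ, hφ, hx, W, -, hW⟩ := F.exists_foliatedChart x
  obtain ⟨W', hW'⟩ := Submodule.exists_isCompl W
  let p : E →ₗ[ℝ] E := W.subtype ∘ₗ W.projectionOnto W' hW'
  refine ⟨⟨φ, hφ, LinearMap.toContinuousLinearMap p, fun v => ?_, fun y hy v => ?_⟩, hx⟩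
  · simp [p]
  · rw [hW y hy]
    have h1 : ∀ w : E, p w = w ↔ w ∈ W := fun w =>
      ⟨fun h => h ▸ (W.projectionOnto W' hW' w).2, fun h => by
        have := Submodule.projectionOnto_apply_left hW' ⟨w, h⟩
        simp [p, this]⟩
    exact (h1 _).symm

namespace FoliatedChart

variable {F : Foliation I M} (c : F.FoliatedChart)

/-- The chart as a map to the model vector space. -/
abbrev ext : PartialEquiv M E := c.chart.extend I

theorem isOpen_target : IsOpen c.ext.target := c.chart.isOpen_extend_target

theorem isOpen_source : IsOpen c.chart.source := c.chart.open_source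

theorem symm_mem {e : E} (he : e ∈ c.ext.target) : c.ext.symm e ∈ c.chart.source := by
  simpa using c.ext.map_target he

theorem ext_mem {x : M} (hx : x ∈ c.chart.source) : c.ext x ∈ c.ext.target :=
  c.ext.map_source (by simpa using hx)

theorem symm_ext {x : M} (hx : x ∈ c.chart.source) : c.ext.symm (c.ext x) = x :=
  c.ext.left_inv (by simpa using hx)

theorem ext_symm {e : E} (he : e ∈ c.ext.target) : c.ext (c.ext.symm e) = e :=
  c.ext.right_inv he

theorem contMDiffAt_ext {x : M} (hx : x ∈ c.chart.source) :
    ContMDiffAt I 𝓘(ℝ, E) ∞ c.ext x :=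
  (c.chart.contMDiffOn_extend c.mem).contMDiffAt (c.isOpen_source.mem_nhds hx)

theorem contMDiffAt_symm {e : E} (he : e ∈ c.ext.target) :
    ContMDiffAt 𝓘(ℝ, E) I ∞ c.ext.symm e := by
  have h := contMDiffOn_extend_symm (I := I) c.mem
  rw [← c.chart.extend_target'] at h
  exact h.contMDiffAt (c.isOpen_target.mem_nhds he)

/-- The derivative of the chart. -/
def deriv (x : M) : TangentSpace I x →L[ℝ] E := mfderiv I 𝓘(ℝ, E) c.ext x

theorem mfderiv_symm_comp_deriv {x : M} (hx : x ∈ c.chart.source) (v : TangentSpace I x) :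
    (mfderiv 𝓘(ℝ, E) I c.ext.symm (c.ext x) (c.deriv x v) : E) = v := by
  have d1 := (c.contMDiffAt_ext hx).mdifferentiableAt (by simp)
  have d2 := (c.contMDiffAt_symm (c.ext_mem hx)).mdifferentiableAt (by simp)
  have h := d2.hasMFDerivAt.comp x d1.hasMFDerivAt
  have h2 := (hasMFDerivAt_id (I := I) x).congr_of_eventuallyEq
    (f₁ := c.ext.symm ∘ c.ext)
    (Filter.eventually_of_mem (c.isOpen_source.mem_nhds hx) fun y hy => c.symm_ext hy)
  exact congrArg (fun T : E →L[ℝ] E => T v) (hasMFDerivAt_unique h h2)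

theorem deriv_mfderiv_symm {x : M} (hx : x ∈ c.chart.source) (v : E) :
    c.deriv x (mfderiv 𝓘(ℝ, E) I c.ext.symm (c.ext x) v : E) = v := by
  have d1 := (c.contMDiffAt_ext hx).mdifferentiableAt (by simp)
  have d2 := (c.contMDiffAt_symm (c.ext_mem hx)).mdifferentiableAt (by simp)
  have d1' : HasMFDerivAt I 𝓘(ℝ, E) c.ext (c.ext.symm (c.ext x)) (c.deriv x) := by
    -- `c.ext.symm (c.ext x)` equals `x` only propositionally. Stating the claim at a free point `y`
    -- allows substitution in the dependent types; the same device recurs below.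
    have key : ∀ y, y = x → HasMFDerivAt I 𝓘(ℝ, E) c.ext y (c.deriv x : E →L[ℝ] E) := by
      rintro y rfl
      exact d1.hasMFDerivAt
    exact key _ (c.symm_ext hx)
  have h := d1'.comp (c.ext x) d2.hasMFDerivAt
  have h2 := (hasMFDerivAt_id (I := 𝓘(ℝ, E)) (c.ext x)).congr_of_eventuallyEq
    (f₁ := c.ext ∘ c.ext.symm)
    (Filter.eventually_of_mem (c.isOpen_target.mem_nhds (c.ext_mem hx)) fun y hy => c.ext_symm hy)
  exact congrArg (fun T : E →L[ℝ] E => T v) (hasMFDerivAt_unique h h2)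

/-- The derivative of the inverse chart, at the image of `x`. -/
def derivInv (x : M) : E →L[ℝ] TangentSpace I x := mfderiv 𝓘(ℝ, E) I c.ext.symm (c.ext x)

theorem derivInv_deriv {x : M} (hx : x ∈ c.chart.source) (v : TangentSpace I x) :
    c.derivInv x (c.deriv x v) = v := c.mfderiv_symm_comp_deriv hx v

theorem deriv_derivInv {x : M} (hx : x ∈ c.chart.source) (v : E) :
    c.deriv x (c.derivInv x v) = v := c.deriv_mfderiv_symm hx v

theorem mem_tangent {x : M} (hx : x ∈ c.chart.source) (v : TangentSpace I x) :
    v ∈ F.tangent x ↔ c.proj (c.deriv x v) = c.deriv x v := c.mem_tangent_iff x hx v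

open Classical in
/-- The frame of the tangent bundle of the foliation given by a foliated chart. -/
def frame (x : M) : E →ₗ[ℝ] F.tangent x :=
  if hx : x ∈ c.chart.source then
    ((c.derivInv x).toLinearMap ∘ₗ c.proj.toLinearMap).codRestrict (F.tangent x) fun v => by
      rw [c.mem_tangent hx]
      simp [c.deriv_derivInv hx, c.proj_proj]
  else 0

/-- Tangent vectors of the foliation in coordinates. -/
def coframe (x : M) : F.tangent x →ₗ[ℝ] E := (c.deriv x).toLinearMap ∘ₗ (F.tangent x).subtype

theorem coframe_apply (x : M) (v : F.tangent x) : c.coframe x v = c.deriv x v := rfl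

theorem coe_frame {x : M} (hx : x ∈ c.chart.source) (v : E) :
    (c.frame x v : TangentSpace I x) = c.derivInv x (c.proj v) := by
  simp [frame, hx]

theorem proj_coframe {x : M} (hx : x ∈ c.chart.source) (v : F.tangent x) :
    c.proj (c.coframe x v) = c.coframe x v := (c.mem_tangent hx _).1 v.2

theorem coframe_frame {x : M} (hx : x ∈ c.chart.source) (v : E) :
    c.coframe x (c.frame x v) = c.proj v := by
  rw [coframe_apply, c.coe_frame hx, c.deriv_derivInv hx]

theorem frame_coframe {x : M} (hx : x ∈ c.chart.source) (v : F.tangent x) :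
    c.frame x (c.coframe x v) = v := by
  apply Subtype.ext
  rw [c.coe_frame hx, c.proj_coframe hx, coframe_apply, c.derivInv_deriv hx]

theorem frame_proj (x : M) (v : E) : c.frame x (c.proj v) = c.frame x v := by
  by_cases hx : x ∈ c.chart.source
  · apply Subtype.ext
    rw [c.coe_frame hx, c.coe_frame hx, c.proj_proj]
  · simp [frame, hx]

theorem mfderiv_symm_isInvertible {e : E} (he : e ∈ c.ext.target) :
    (mfderiv 𝓘(ℝ, E) I c.ext.symm e).IsInvertible := by
  have hx := c.symm_mem he
  have h := c.ext_symm he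
  refine ⟨ContinuousLinearEquiv.equivOfInverse (mfderiv 𝓘(ℝ, E) I c.ext.symm e)
    (c.deriv (c.ext.symm e)) (fun v => ?_) (fun v => ?_), rfl⟩
  · have := c.deriv_mfderiv_symm hx v
    rwa [h] at this
  · have := c.mfderiv_symm_comp_deriv hx v
    rwa [h] at this

theorem mfderiv_ext_isInvertible {x : M} (hx : x ∈ c.chart.source) :
    (mfderiv I 𝓘(ℝ, E) c.ext x).IsInvertible :=
  ⟨ContinuousLinearEquiv.equivOfInverse (c.deriv x) (c.derivInv x) (c.derivInv_deriv hx)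
    (c.deriv_derivInv hx), rfl⟩

/-- A vector field tangent to the foliation in coordinates. -/
def coord (X : F.fields) (e : E) : E := c.coframe (c.ext.symm e) (F.fieldAt X (c.ext.symm e))

theorem mpullback_symm (V : ∀ x : M, TangentSpace I x) {e : E} (he : e ∈ c.ext.target) :
    VectorField.mpullback 𝓘(ℝ, E) I c.ext.symm V e = c.deriv (c.ext.symm e) (V (c.ext.symm e)) := by
  rw [VectorField.mpullback_apply, mfderiv_extend_symm_inverse c.mem he]
  rfl

theorem contDiffAt_coord (X : F.fields) {e : E} (he : e ∈ c.ext.target) :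
    ContDiffAt ℝ ∞ (c.coord X) e := by
  have : IsManifold I ((∞ : WithTop ℕ∞) + 1) M := by
    rw [show (∞ : WithTop ℕ∞) + 1 = ∞ from rfl]; infer_instance
  have h := ContMDiffAt.mpullback_vectorField_preimage (m := ∞) (n := ∞) (f := c.ext.symm)
    (X.1.contMDiff (c.ext.symm e)) (c.contMDiffAt_symm he) (c.mfderiv_symm_isInvertible he) le_rfl
  refine (contMDiffAt_vectorSpace_iff_contDiffAt.1 h).congr_of_eventuallyEq ?_
  filter_upwards [c.isOpen_target.mem_nhds he] with e' he'
  exact (c.mpullback_symm _ he').symm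

/-- The field is the pullback along the chart of the constant field `v` on `E`. -/
theorem contMDiffAt_derivInv (v : E) {x : M} (hx : x ∈ c.chart.source) :
    ContMDiffAt I I.tangent ∞ (fun y => (⟨y, c.derivInv y v⟩ : TangentBundle I M)) x := by
  have : IsManifold I ((∞ : WithTop ℕ∞) + 1) M := by
    rw [show (∞ : WithTop ℕ∞) + 1 = ∞ from rfl]; infer_instance
  have hv : ContMDiffAt 𝓘(ℝ, E) 𝓘(ℝ, E).tangent ∞
      (fun e : E => (⟨e, v⟩ : TangentBundle 𝓘(ℝ, E) E)) (c.ext x) := by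
    exact (contMDiffAt_vectorSpace_iff_contDiffAt (V := fun _ : E => v)).2 contDiffAt_const
  have h := ContMDiffAt.mpullback_vectorField_preimage (m := ∞) (n := ∞) (f := c.ext)
    hv (c.contMDiffAt_ext hx) (c.mfderiv_ext_isInvertible hx) le_rfl
  refine h.congr_of_eventuallyEq ?_
  filter_upwards [c.isOpen_source.mem_nhds hx] with y hy
  have : (mfderiv I 𝓘(ℝ, E) c.ext y).inverse = c.derivInv y :=
    ContinuousLinearMap.inverse_eq (by ext v; exact c.deriv_derivInv hy v)
      (by ext v; exact c.derivInv_deriv hy v)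
  exact congrArg (fun w : TangentSpace I y => (⟨y, w⟩ : TangentBundle I M))
    (congrArg (fun T : E →L[ℝ] E => T v) this.symm)

/-- Every frame vector field extends, near any given point, to a global field. -/
theorem exists_field [T2Space M] (v : E) {x : M} (hx : x ∈ c.chart.source) :
    ∃ X : F.fields, ∀ᶠ y in 𝓝 x, F.fieldAt X y = c.frame y v := by
  obtain ⟨f, -, hf⟩ := (SmoothBumpFunction.nhds_basis_tsupport (I := I) x).mem_iff.1
    (c.isOpen_source.mem_nhds hx)
  let V : ∀ y : M, TangentSpace I y := fun y => f y • c.derivInv y (c.proj v)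
  have hV : ContMDiff I I.tangent ∞ (fun y => (⟨y, V y⟩ : TangentBundle I M)) := by
    intro y
    by_cases hy : y ∈ tsupport f
    · exact ContMDiffAt.smul_section (f.contMDiff y) (c.contMDiffAt_derivInv _ (hf hy))
    · have h0 : ContMDiffAt I I.tangent ∞
          (fun y => (⟨y, 0⟩ : TangentBundle I M)) y :=
        Bundle.contMDiff_zeroSection ℝ (TangentSpace I : M → Type _) y
      refine h0.congr_of_eventuallyEq ?_
      filter_upwards [(isClosed_tsupport f).isOpen_compl.mem_nhds hy] with z hz
      have : f z = 0 := image_eq_zero_of_notMem_tsupport hz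
      simp [V, this]
  refine ⟨⟨⟨V, hV⟩, fun y => ?_⟩, ?_⟩
  · change f y • c.derivInv y (c.proj v) ∈ F.tangent y
    by_cases hy : y ∈ c.chart.source
    · rw [← c.coe_frame hy]
      exact (F.tangent y).smul_mem _ (c.frame y v).2
    · have : f y = 0 := image_eq_zero_of_notMem_tsupport fun h => hy (hf h)
      rw [this, zero_smul]
      exact (F.tangent y).zero_mem
  · filter_upwards [f.eventuallyEq_one, c.isOpen_source.mem_nhds hx] with y hy hys
    apply Subtype.ext
    rw [c.coe_frame hys]
    change f y • c.derivInv y (c.proj v) = _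
    rw [hy]
    exact one_smul _ _

end FoliatedChart

end Foliation

end

/-! ### Leafwise forms in coordinates and the Koszul formula -/

section

namespace Foliation

variable {E H : Type*} [NormedAddCommGroup E] [NormedSpace ℝ E] [FiniteDimensional ℝ E]
  [TopologicalSpace H] {I : ModelWithCorners ℝ E H} [I.Boundaryless]
  {M : Type*} [TopologicalSpace M] [ChartedSpace H M] [IsManifold I ∞ M]

namespace FoliatedChart

variable {F : Foliation I M} (c : F.FoliatedChart)

/-- A leafwise form in the coordinates of a foliated chart. -/
def rep {k : ℕ} (α : ∀ x, (F.tangent x) [⋀^Fin k]→ₗ[ℝ] ℝ) (e : E) : E [⋀^Fin k]→L[ℝ] ℝ :=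
  toContinuousAlternating ((α (c.ext.symm e)).compLinearMap (c.frame (c.ext.symm e)))

theorem rep_apply {k : ℕ} (α : ∀ x, (F.tangent x) [⋀^Fin k]→ₗ[ℝ] ℝ) (e : E) (v : Fin k → E) :
    c.rep α e v = α (c.ext.symm e) (fun i => c.frame (c.ext.symm e) (v i)) := rfl

theorem rep_coframe {k : ℕ} (α : ∀ x, (F.tangent x) [⋀^Fin k]→ₗ[ℝ] ℝ) {x : M}
    (hx : x ∈ c.chart.source) (v : Fin k → F.tangent x) :
    c.rep α (c.ext x) (fun i => c.coframe x (v i)) = α x v := by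
  have key : ∀ y, y = x → α y (fun i => c.frame y (c.coframe x (v i))) = α x v := by
    rintro y rfl
    simp only [c.frame_coframe hx]
  exact key _ (c.symm_ext hx)

theorem rep_coord {k : ℕ} (α : ∀ x, (F.tangent x) [⋀^Fin k]→ₗ[ℝ] ℝ) {e : E}
    (he : e ∈ c.ext.target) (X : Fin k → F.fields) :
    c.rep α e (fun i => c.coord (X i) e) = F.eval α X (c.ext.symm e) := by
  have := c.rep_coframe α (c.symm_mem he) (fun i => F.fieldAt (X i) (c.ext.symm e))
  rwa [c.ext_symm he] at this

/-- Smooth leafwise forms are smooth in coordinates. -/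
theorem contDiffAt_rep [T2Space M] {k : ℕ} {α : ∀ x, (F.tangent x) [⋀^Fin k]→ₗ[ℝ] ℝ}
    (hα : α ∈ F.formSubmodule k) {e : E} (he : e ∈ c.ext.target) :
    ContDiffAt ℝ ∞ (c.rep α) e := by
  refine contDiffAt_alternating fun v => ?_
  choose X hX using fun i => c.exists_field (v i) (c.symm_mem he)
  have h1 : ContMDiffAt 𝓘(ℝ, E) 𝓘(ℝ, ℝ) ∞ (F.eval α X ∘ c.ext.symm) e :=
    ContMDiffAt.comp e (hα X (c.ext.symm e)) (c.contMDiffAt_symm he)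
  refine h1.contDiffAt.congr_of_eventuallyEq ?_
  have h2 := (c.contMDiffAt_symm he).continuousAt.eventually (eventually_all.2 hX)
  filter_upwards [h2] with e' h'
  simp only [Function.comp, eval, rep_apply, h']

theorem contMDiffAt_eval {k : ℕ} {α : ∀ x, (F.tangent x) [⋀^Fin k]→ₗ[ℝ] ℝ} {x : M}
    (hx : x ∈ c.chart.source) (h : ContDiffAt ℝ ∞ (c.rep α) (c.ext x)) (X : Fin k → F.fields) :
    ContMDiffAt I 𝓘(ℝ, ℝ) ∞ (F.eval α X) x := by
  have h1 : ContDiffAt ℝ ∞ (fun e => c.rep α e (fun i => c.coord (X i) e)) (c.ext x) :=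
    contDiffAt_alternating_apply h fun i => c.contDiffAt_coord (X i) (c.ext_mem hx)
  have h2 : ContMDiffAt I 𝓘(ℝ, ℝ) ∞ ((fun e => c.rep α e (fun i => c.coord (X i) e)) ∘ c.ext) x :=
    ContMDiffAt.comp x h1.contMDiffAt (c.contMDiffAt_ext hx)
  refine h2.congr_of_eventuallyEq ?_
  filter_upwards [c.isOpen_source.mem_nhds hx] with y hy
  rw [Function.comp, c.rep_coord α (c.ext_mem hy), c.symm_ext hy]

theorem mem_formSubmodule {F : Foliation I M} {k : ℕ}
    {α : ∀ x, (F.tangent x) [⋀^Fin k]→ₗ[ℝ] ℝ}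
    (h : ∀ x, ∃ c : F.FoliatedChart, x ∈ c.chart.source ∧ ContDiffAt ℝ ∞ (c.rep α) (c.ext x)) :
    α ∈ F.formSubmodule k := by
  intro X x
  obtain ⟨c, hx, hc⟩ := h x
  exact c.contMDiffAt_eval hx hc X

theorem fderiv_comp_symm {f : M → ℝ} (hf : ContMDiff I 𝓘(ℝ, ℝ) ∞ f) (X : F.fields) {x : M}
    (hx : x ∈ c.chart.source) :
    fderiv ℝ (f ∘ c.ext.symm) (c.ext x) (c.coord X (c.ext x)) = F.dirDeriv X f x := by
  have h1 : HasMFDerivAt I 𝓘(ℝ, ℝ) f (c.ext.symm (c.ext x)) (mfderiv I 𝓘(ℝ, ℝ) f x : E →L[ℝ] ℝ) := by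
    have key : ∀ y, y = x → HasMFDerivAt I 𝓘(ℝ, ℝ) f y (mfderiv I 𝓘(ℝ, ℝ) f x : E →L[ℝ] ℝ) := by
      rintro y rfl
      exact ((hf y).mdifferentiableAt (by simp)).hasMFDerivAt
    exact key _ (c.symm_ext hx)
  have h2 := (c.contMDiffAt_symm (c.ext_mem hx)).mdifferentiableAt (by simp)
  have h3 : fderiv ℝ (f ∘ c.ext.symm) (c.ext x) = (mfderiv I 𝓘(ℝ, ℝ) f x : E →L[ℝ] ℝ).comp
      (mfderiv 𝓘(ℝ, E) I c.ext.symm (c.ext x) : E →L[ℝ] E) :=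
    HasFDerivAt.fderiv (E := E) (F := ℝ)
      (hasMFDerivAt_iff_hasFDerivAt.1 (h1.comp (c.ext x) h2.hasMFDerivAt))
  have h4 : (mfderiv 𝓘(ℝ, E) I c.ext.symm (c.ext x) (c.coord X (c.ext x)) : E) = X.1 x := by
    have h5 : c.coord X (c.ext x) = c.deriv x (X.1 x) := by
      have key : ∀ y, y = x → c.coframe y (F.fieldAt X y) = c.deriv x (X.1 x) := by
        rintro y rfl
        rfl
      exact key _ (c.symm_ext hx)
    rw [h5]
    exact c.mfderiv_symm_comp_deriv hx _
  rw [h3]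
  exact congrArg (fun v : E => (mfderiv I 𝓘(ℝ, ℝ) f x : E →L[ℝ] ℝ) v) h4

/-- This is naturality of the Lie bracket under pullback along the inverse chart. -/
theorem coord_bracket (X Y : F.fields) {e : E} (he : e ∈ c.ext.target) :
    c.coord (F.bracket X Y) e = VectorField.lieBracket ℝ (c.coord X) (c.coord Y) e := by
  have : IsManifold I (minSmoothness ℝ 3) M := by
    rw [minSmoothness_of_isRCLikeNormedField]
    infer_instance
  have hb := VectorField.mpullback_mlieBracket (n := ∞) (V := X.1) (W := Y.1) (x₀ := e)
    (X.1.contMDiff.contMDiffAt.mdifferentiableAt (by simp))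
    (Y.1.contMDiff.contMDiffAt.mdifferentiableAt (by simp)) (c.contMDiffAt_symm he)
    (by rw [minSmoothness_of_isRCLikeNormedField]; exact WithTop.coe_le_coe.2 le_top)
  have h : ∀ V V' : E → E, (VectorField.mlieBracket 𝓘(ℝ, E) V V' e : E) =
      VectorField.lieBracket ℝ V V' e := fun V V' =>
    (congrFun VectorField.mlieBracketWithin_univ e).symm.trans
      ((congrFun VectorField.mlieBracketWithin_eq_lieBracketWithin e).trans
        (congrFun VectorField.lieBracketWithin_univ e))
  have h1 : ∀ Z : F.fields,
      (VectorField.mpullback 𝓘(ℝ, E) I c.ext.symm Z.1 : E → E) =ᶠ[𝓝 e] c.coord Z := by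
    intro Z
    filter_upwards [c.isOpen_target.mem_nhds he] with e' he'
    exact c.mpullback_symm _ he'
  have h2 : (VectorField.mpullback 𝓘(ℝ, E) I c.ext.symm (VectorField.mlieBracket I X.1 Y.1) e : E)
      = c.coord (F.bracket X Y) e := c.mpullback_symm _ he
  rw [← h2]
  refine hb.trans ((h _ _).trans ?_)
  exact Filter.EventuallyEq.lieBracket_vectorField_eq (E := E) (h1 X) (h1 Y)

/-- The Koszul formula computes the exterior derivative in a foliated chart. -/
theorem koszul_eq [T2Space M] {k : ℕ} {α : ∀ x, (F.tangent x) [⋀^Fin k]→ₗ[ℝ] ℝ}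
    (hα : α ∈ F.formSubmodule k) (X : Fin (k + 1) → F.fields) {x : M}
    (hx : x ∈ c.chart.source) :
    F.koszul α X x = extDeriv (c.rep α) (c.ext x) (fun i => c.coord (X i) (c.ext x)) := by
  have he := c.ext_mem hx
  have hd : DifferentiableAt ℝ (c.rep α) (c.ext x) :=
    (c.contDiffAt_rep hα he).differentiableAt (by simp)
  have hV : ∀ i, DifferentiableAt ℝ (c.coord (X i)) (c.ext x) := fun i =>
    (c.contDiffAt_coord (X i) he).differentiableAt (by simp)
  have h1 : ∀ i : Fin (k + 1),
      fderiv ℝ (fun e => c.rep α e (i.removeNth (fun j => c.coord (X j) e))) (c.ext x)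
        (c.coord (X i) (c.ext x)) = F.dirDeriv (X i) (F.eval α (i.removeNth X)) x := by
    intro i
    rw [← c.fderiv_comp_symm (hα _) (X i) hx]
    congr 1
    apply Filter.EventuallyEq.fderiv_eq
    filter_upwards [c.isOpen_target.mem_nhds he] with e he'
    exact c.rep_coord α he' (i.removeNth X)
  rw [koszul]
  cases k with
  | zero =>
    -- With a single field there are no brackets, and the commutation hypothesis is vacuous.
    rw [extDeriv_apply_vectorField_of_pairwise_commute (V := fun i => c.coord (X i)) hd hV]
    · simp only [bracketSum, add_zero, h1, zsmul_eq_mul, Int.cast_pow, Int.cast_neg, Int.cast_one]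
    · intro i j hij
      exact absurd (Subsingleton.elim (α := Fin 1) i j) hij
  | succ k =>
    rw [extDeriv_apply_vectorField (V := fun i => c.coord (X i)) hd hV]
    simp only [bracketSum, h1, sub_eq_add_neg, zsmul_eq_mul, Int.cast_pow, Int.cast_neg,
      Int.cast_one]
    congr 2
    refine Finset.sum_congr rfl fun i _ => Finset.sum_congr rfl fun j _ => ?_
    congr 1
    have h2 := c.rep_coord α he (Matrix.vecCons (F.bracket (X i.castSucc) (X j.succ))
        (j.removeNth (i.castSucc.removeNth X)))
    rw [c.symm_ext hx] at h2
    rw [← h2]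
    congr 1
    funext l
    refine Fin.cases ?_ (fun l => ?_) l
    · exact (c.coord_bracket _ _ he)
    · simp [Fin.removeNth]

end FoliatedChart

end Foliation

end

/-! ### The leafwise exterior derivative as a linear map -/

section

namespace Foliation

variable {E H : Type*} [NormedAddCommGroup E] [NormedSpace ℝ E] [FiniteDimensional ℝ E]
  [TopologicalSpace H] {I : ModelWithCorners ℝ E H} [I.Boundaryless]
  {M : Type*} [TopologicalSpace M] [ChartedSpace H M] [IsManifold I ∞ M]

theorem form_ext {F : Foliation I M} {k : ℕ} {α β : F.Form k} (h : ∀ x, α.1 x = β.1 x) : α = β :=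
  Subtype.ext (funext h)

theorem FoliatedChart.coord_ext {F : Foliation I M} (c : F.FoliatedChart) (X : F.fields) {x : M}
    (hx : x ∈ c.chart.source) : c.coord X (c.ext x) = c.coframe x (F.fieldAt X x) := by
  have key : ∀ y, y = x → c.coframe y (F.fieldAt X y) = c.coframe x (F.fieldAt X x) := by
    rintro y rfl
    rfl
  exact key _ (c.symm_ext hx)

/-- The exterior derivative preserves smoothness. -/
theorem contDiffAt_extDeriv {V : Type*} [NormedAddCommGroup V] [NormedSpace ℝ V] {k : ℕ}
    {τ : V → V [⋀^Fin k]→L[ℝ] ℝ} {e : V} (h : ContDiffAt ℝ ∞ τ e) :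
    ContDiffAt ℝ ∞ (extDeriv τ) e := by
  have h1 : ContDiffAt ℝ ∞ (fderiv ℝ τ) e := h.fderiv_right (m := ∞) le_rfl
  let L := ContinuousAlternatingMap.alternatizeUncurryFinCLM ℝ V ℝ (n := k)
  exact (L.contDiff.contDiffAt (x := fderiv ℝ τ e)).comp e h1

/-- Each term of the derivative on `v` differentiates a form evaluated on the remaining entries of
`v`, so only these values matter. This permits comparing forms which agree only on vectors tangent
to the leaves. -/
theorem extDeriv_congr_of_apply {V : Type*} [NormedAddCommGroup V] [NormedSpace ℝ V] {k : ℕ}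
    {τ τ' : V → V [⋀^Fin k]→L[ℝ] ℝ} {e : V} (hτ : DifferentiableAt ℝ τ e)
    (hτ' : DifferentiableAt ℝ τ' e) (v : Fin (k + 1) → V)
    (h : ∀ i : Fin (k + 1), ∀ᶠ y in 𝓝 e, τ y (i.removeNth v) = τ' y (i.removeNth v)) :
    extDeriv τ e v = extDeriv τ' e v := by
  rw [extDeriv_apply hτ, extDeriv_apply hτ']
  refine Finset.sum_congr rfl fun i _ => ?_
  rw [Filter.EventuallyEq.fderiv_eq (h i)]

variable [T2Space M]

theorem exists_field_eq (F : Foliation I M) {x : M} (u : F.tangent x) :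
    ∃ X : F.fields, F.fieldAt X x = u := by
  obtain ⟨c, hx⟩ := F.exists_foliatedChart_at x
  obtain ⟨X, hX⟩ := c.exists_field (c.coframe x u) hx
  exact ⟨X, by rw [hX.self_of_nhds, c.frame_coframe hx]⟩

/-- Both sides equal the Koszul expression, which involves no chart. Hence the chart chosen in
`dFun` is immaterial. -/
theorem extDeriv_rep_eq {F : Foliation I M} {k : ℕ} (α : F.Form k) (c c' : F.FoliatedChart) {x : M}
    (hx : x ∈ c.chart.source) (hx' : x ∈ c'.chart.source) (u : Fin (k + 1) → F.tangent x) :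
    extDeriv (c.rep α.1) (c.ext x) (fun i => c.coframe x (u i)) =
      extDeriv (c'.rep α.1) (c'.ext x) (fun i => c'.coframe x (u i)) := by
  choose X hX using fun i => F.exists_field_eq (u i)
  have h := (c.koszul_eq α.2 X hx).symm.trans (c'.koszul_eq α.2 X hx')
  simpa only [c.coord_ext _ hx, c'.coord_ext _ hx', hX] using h

/-- The leafwise exterior derivative, as a family of alternating maps. -/
def dFun (F : Foliation I M) {k : ℕ} (α : F.Form k) (x : M) :
    (F.tangent x) [⋀^Fin (k + 1)]→ₗ[ℝ] ℝ :=
  (extDeriv ((F.exists_foliatedChart_at x).choose.rep α.1)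
    ((F.exists_foliatedChart_at x).choose.ext x)).toAlternatingMap.compLinearMap
      ((F.exists_foliatedChart_at x).choose.coframe x)

theorem dFun_apply {F : Foliation I M} {k : ℕ} (α : F.Form k) (c : F.FoliatedChart) {x : M}
    (hx : x ∈ c.chart.source) (u : Fin (k + 1) → F.tangent x) :
    F.dFun α x u = extDeriv (c.rep α.1) (c.ext x) (fun i => c.coframe x (u i)) :=
  extDeriv_rep_eq α _ c (F.exists_foliatedChart_at x).choose_spec hx u

/-- The flat derivative may be nonzero on vectors transverse to the leaves, whereas the
representative of a leafwise form always factors through `c.proj`. -/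
theorem rep_dFun {F : Foliation I M} {k : ℕ} (α : F.Form k) (c : F.FoliatedChart) {e : E}
    (he : e ∈ c.ext.target) :
    c.rep (F.dFun α) e = (extDeriv (c.rep α.1) e).compContinuousLinearMap c.proj := by
  ext v
  rw [c.rep_apply, dFun_apply α c (c.symm_mem he), c.ext_symm he]
  simp only [c.coframe_frame (c.symm_mem he)]
  rfl

theorem dFun_mem {F : Foliation I M} {k : ℕ} (α : F.Form k) :
    F.dFun α ∈ F.formSubmodule (k + 1) := by
  refine FoliatedChart.mem_formSubmodule fun x => ?_
  obtain ⟨c, hx⟩ := F.exists_foliatedChart_at x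
  refine ⟨c, hx, ?_⟩
  have h : ContDiffAt ℝ ∞ (fun e => (extDeriv (c.rep α.1) e).compContinuousLinearMap c.proj)
      (c.ext x) := by
    refine contDiffAt_alternating fun v => ?_
    exact contDiffAt_alternating_apply (g := fun i _ => c.proj (v i))
      (contDiffAt_extDeriv (c.contDiffAt_rep α.2 (c.ext_mem hx))) fun i => contDiffAt_const
  refine h.congr_of_eventuallyEq ?_
  filter_upwards [c.isOpen_target.mem_nhds (c.ext_mem hx)] with e he
  exact rep_dFun α c he

theorem isDeriv_unique {F : Foliation I M} {k : ℕ} {α : F.Form k} {β β' : F.Form (k + 1)}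
    (h : F.IsDeriv α β) (h' : F.IsDeriv α β') : β = β' := by
  refine form_ext fun x => ?_
  ext u
  choose X hX using fun i => F.exists_field_eq (u i)
  have := (h X x).trans (h' X x).symm
  simpa only [eval, hX] using this

theorem isDeriv_dFun {F : Foliation I M} {k : ℕ} (α : F.Form k) :
    F.IsDeriv α ⟨F.dFun α, dFun_mem α⟩ := by
  intro X x
  obtain ⟨c, hx⟩ := F.exists_foliatedChart_at x
  rw [c.koszul_eq α.2 X hx]
  simp only [c.coord_ext _ hx]
  exact dFun_apply α c hx _

/-- The leafwise exterior derivative. -/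
def d (F : Foliation I M) (k : ℕ) : F.Form k →ₗ[ℝ] F.Form (k + 1) where
  toFun α := ⟨F.dFun α, dFun_mem α⟩
  map_add' α β := isDeriv_unique (isDeriv_dFun (α + β)) ((isDeriv_dFun α).add (isDeriv_dFun β))
  map_smul' r α := isDeriv_unique (isDeriv_dFun (r • α)) ((isDeriv_dFun α).smul r)

theorem isDeriv_iff {F : Foliation I M} {k : ℕ} {α : F.Form k} {β : F.Form (k + 1)} :
    F.IsDeriv α β ↔ β = F.d k α :=
  ⟨fun h => isDeriv_unique h (isDeriv_dFun α), fun h => h ▸ isDeriv_dFun α⟩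

theorem d_apply {F : Foliation I M} {k : ℕ} (α : F.Form k) (c : F.FoliatedChart) {x : M}
    (hx : x ∈ c.chart.source) (u : Fin (k + 1) → F.tangent x) :
    (F.d k α).1 x u = extDeriv (c.rep α.1) (c.ext x) (fun i => c.coframe x (u i)) :=
  dFun_apply α c hx u

theorem rep_d {F : Foliation I M} {k : ℕ} (α : F.Form k) (c : F.FoliatedChart) {e : E}
    (he : e ∈ c.ext.target) :
    c.rep (F.d k α).1 e = (extDeriv (c.rep α.1) e).compContinuousLinearMap c.proj :=
  rep_dFun α c he

theorem mem_cocycles_iff {F : Foliation I M} {k : ℕ} {α : F.Form k} :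
    α ∈ F.cocycles k ↔ F.d k α = 0 :=
  isDeriv_iff.trans eq_comm

theorem mem_coboundaries_succ_iff {F : Foliation I M} {k : ℕ} {β : F.Form (k + 1)} :
    β ∈ F.coboundaries (k + 1) ↔ ∃ α, F.d k α = β := by
  constructor
  · rintro ⟨α, h⟩
    exact ⟨α, (isDeriv_iff.1 h).symm⟩
  · rintro ⟨α, h⟩
    exact ⟨α, isDeriv_iff.2 h.symm⟩

theorem d_d {F : Foliation I M} {k : ℕ} (α : F.Form k) : F.d (k + 1) (F.d k α) = 0 := by
  refine form_ext fun x => ?_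
  ext u
  obtain ⟨c, hx⟩ := F.exists_foliatedChart_at x
  have he := c.ext_mem hx
  have hα := c.contDiffAt_rep α.2 he
  rw [d_apply _ c hx]
  -- The two inner forms differ by precomposition with `c.proj`, which fixes the vectors `c.coframe
  -- x (u i)`. So the flat identity `d ∘ d = 0` applies.
  rw [extDeriv_congr_of_apply (τ' := extDeriv (c.rep α.1))
    ((c.contDiffAt_rep (F.d k α).2 he).differentiableAt (by simp))
    ((contDiffAt_extDeriv hα).differentiableAt (by simp)),
    extDeriv_extDeriv_apply hα (by
      rw [minSmoothness_of_isRCLikeNormedField]; exact WithTop.coe_le_coe.2 le_top)]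
  · rfl
  · intro i
    filter_upwards [c.isOpen_target.mem_nhds he] with e he'
    rw [rep_d α c he']
    simp only [ContinuousAlternatingMap.compContinuousLinearMap_apply]
    congr 1
    funext j
    exact c.proj_coframe hx _

end Foliation

end

/-! ### Alternating maps on a product: mixed tuples and shuffles -/

section

namespace Foliation

/-- The concatenation of two tuples. -/
def mix {X : Type*} {a b k : ℕ} (h : a + b = k) (u : Fin a → X) (v : Fin b → X) (i : Fin k) : X :=
  if hi : i.1 < a then u ⟨i, hi⟩ else v ⟨i - a, by omega⟩

theorem mix_comp {X Y : Type*} (g : X → Y) {a b k : ℕ} (h : a + b = k) (u : Fin a → X)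
    (v : Fin b → X) (i : Fin k) :
    g (mix h u v i) = mix h (fun i => g (u i)) (fun i => g (v i)) i := by
  unfold mix
  split_ifs <;> rfl

theorem mix_left {X : Type*} {a b k : ℕ} (h : a + b = k) (u : Fin a → X) (v : Fin b → X)
    (i : Fin a) : mix h u v (Fin.cast h (Fin.castAdd b i)) = u i := by
  simp [mix]

theorem mix_right {X : Type*} {a b k : ℕ} (h : a + b = k) (u : Fin a → X) (v : Fin b → X)
    (i : Fin b) : mix h u v (Fin.cast h (Fin.natAdd a i)) = v i := by
  simp [mix]

theorem sum_mix {A : Type*} [AddCommMonoid A] {a b k : ℕ} (h : a + b = k) (f : Fin k → A) :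
    ∑ i, f i = ∑ i, f (Fin.cast h (Fin.castAdd b i)) + ∑ j, f (Fin.cast h (Fin.natAdd a j)) := by
  subst h
  exact Fin.sum_univ_add f

theorem mix_of_lt {X : Type*} {a b k : ℕ} (h : a + b = k) (u : Fin a → X) (v : Fin b → X)
    {i : Fin k} (j : Fin a) (hi : i.1 = j.1) : mix h u v i = u j := by
  rw [mix, dif_pos (by omega)]
  congr 1
  exact Fin.ext hi

theorem mix_of_ge {X : Type*} {a b k : ℕ} (h : a + b = k) (u : Fin a → X) (v : Fin b → X)
    {i : Fin k} (j : Fin b) (hi : i.1 = a + j.1) : mix h u v i = v j := by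
  rw [mix, dif_neg (by omega)]
  congr 1
  exact Fin.ext (by simp [hi])

theorem val_succAbove {n : ℕ} (p : Fin (n + 1)) (l : Fin n) :
    (p.succAbove l).1 = if l.1 < p.1 then l.1 else l.1 + 1 := by
  simp only [Fin.succAbove, Fin.lt_def, Fin.val_castSucc]
  split_ifs <;> simp

theorem removeNth_mix_left {X : Type*} {a b k : ℕ} (h : a + 1 + b = k + 1) (h' : a + b = k)
    (u : Fin (a + 1) → X) (v : Fin b → X) (i : Fin (a + 1)) :
    (Fin.cast h (Fin.castAdd b i)).removeNth (mix h u v) = mix h' (i.removeNth u) v := by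
  funext l
  have hi := i.2
  rcases Nat.lt_or_ge l.1 a with hl | hl
  · rw [mix_of_lt h' _ _ ⟨l.1, hl⟩ rfl, Fin.removeNth, Fin.removeNth]
    exact mix_of_lt h _ _ _ (by simp [val_succAbove])
  · rw [mix_of_ge h' _ _ ⟨l.1 - a, by omega⟩ (by simp; omega), Fin.removeNth]
    exact mix_of_ge h _ _ _ (by simp [val_succAbove]; split_ifs <;> omega)

theorem removeNth_mix_right {X : Type*} {a b k : ℕ} (h : a + (b + 1) = k + 1) (h' : a + b = k)
    (u : Fin a → X) (v : Fin (b + 1) → X) (j : Fin (b + 1)) :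
    (Fin.cast h (Fin.natAdd a j)).removeNth (mix h u v) = mix h' u (j.removeNth v) := by
  funext l
  have hj := j.2
  rcases Nat.lt_or_ge l.1 a with hl | hl
  · rw [mix_of_lt h' _ _ ⟨l.1, hl⟩ rfl, Fin.removeNth]
    exact mix_of_lt h _ _ _ (by simp [val_succAbove]; omega)
  · rw [mix_of_ge h' _ _ ⟨l.1 - a, by omega⟩ (by simp; omega), Fin.removeNth, Fin.removeNth]
    exact mix_of_ge h _ _ _ (by simp [val_succAbove]; split_ifs <;> omega)

variable {V V' : Type*} [AddCommGroup V] [Module ℝ V] [AddCommGroup V'] [Module ℝ V']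
    {Q : Submodule ℝ V'} {P : Submodule ℝ V}

/-- The inclusion of the first factor. -/
def inP (P : Submodule ℝ V) (Q : Submodule ℝ V') : P →ₗ[ℝ] P.prod Q where
  toFun u := ⟨(u.1, 0), u.2, Q.zero_mem⟩
  map_add' _ _ := by ext <;> simp
  map_smul' _ _ := by ext <;> simp

/-- The inclusion of the second factor. -/
def inQ (P : Submodule ℝ V) (Q : Submodule ℝ V') : Q →ₗ[ℝ] P.prod Q where
  toFun u := ⟨(0, u.1), P.zero_mem, u.2⟩
  map_add' _ _ := by ext <;> simp
  map_smul' _ _ := by ext <;> simp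

/-- The first component of a vector. -/
def prP (P : Submodule ℝ V) (Q : Submodule ℝ V') : P.prod Q →ₗ[ℝ] P where
  toFun z := ⟨z.1.1, z.2.1⟩
  map_add' _ _ := rfl
  map_smul' _ _ := rfl

/-- The second component of a vector. -/
def prQ (P : Submodule ℝ V) (Q : Submodule ℝ V') : P.prod Q →ₗ[ℝ] Q where
  toFun z := ⟨z.1.2, z.2.2⟩
  map_add' _ _ := rfl
  map_smul' _ _ := rfl

@[simp] theorem prP_inP (u : P) : prP P Q (inP P Q u) = u := rfl
@[simp] theorem prP_inQ (u : Q) : prP P Q (inQ P Q u) = 0 := rfl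
@[simp] theorem prQ_inP (u : P) : prQ P Q (inP P Q u) = 0 := rfl
@[simp] theorem prQ_inQ (u : Q) : prQ P Q (inQ P Q u) = u := rfl

theorem inP_prP_add_inQ_prQ (z : P.prod Q) : inP P Q (prP P Q z) + inQ P Q (prQ P Q z) = z := by
  ext <;> simp [inP, inQ, prP, prQ]

theorem prP_add (u : P) (w : Q) : prP P Q (inP P Q u + inQ P Q w) = u := by simp

theorem prQ_add (u : P) (w : Q) : prQ P Q (inP P Q u + inQ P Q w) = w := by simp

theorem inP_add_of_eq_zero (u : P) {w : Q} (hw : w = 0) : inP P Q u + inQ P Q w = inP P Q u := by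
  simp [hw]

theorem inQ_add_of_eq_zero {u : P} (w : Q) (hu : u = 0) : inP P Q u + inQ P Q w = inQ P Q w := by
  simp [hu]

/-- The tuple consisting of the vectors `u` of `P`, followed by the vectors `v` of `Q`. -/
def mixed {a b k : ℕ} (h : a + b = k) (u : Fin a → P) (v : Fin b → Q) : Fin k → P.prod Q :=
  mix h (fun i => inP P Q (u i)) (fun j => inQ P Q (v j))

-- Shuffles are cosets of the permutations preserving the two blocks. Leaving the section `s` free
-- allows the identity to represent the trivial coset in the next computation.
open Equiv in
theorem crossAt_apply {i j k : ℕ} (h : i + j = k) (α : P [⋀^Fin i]→ₗ[ℝ] ℝ)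
    (β : Q [⋀^Fin j]→ₗ[ℝ] ℝ) (z : Fin k → P.prod Q)
    (s : Perm.ModSumCongr (Fin i) (Fin j) → Perm (Fin i ⊕ Fin j))
    (hs : ∀ σ, Quotient.mk'' (s σ) = σ) :
    crossAt P Q h α β z = ∑ σ, ((Perm.sign (s σ) : ℤ) : ℝ) *
      (α (fun a => prP P Q (z (finSumFinEquiv.trans (finCongr h) (s σ (Sum.inl a))))) *
      β (fun b => prQ P Q (z (finSumFinEquiv.trans (finCongr h) (s σ (Sum.inr b)))))) := by
  rw [crossAt]
  simp only [AlternatingMap.domDomCongr_apply, LinearMap.compAlternatingMap_apply,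
    AlternatingMap.domCoprod_apply, sum_apply, map_sum]
  refine Finset.sum_congr rfl fun σ _ => ?_
  conv_lhs => rw [← hs σ, AlternatingMap.domCoprod.summand_mk'']
  rw [smul_apply, MultilinearMap.domDomCongr_apply, MultilinearMap.domCoprod_apply]
  rw [Units.smul_def, ← Int.cast_smul_eq_zsmul ℝ, map_smul, LinearMap.mul'_apply, smul_eq_mul]
  rfl

-- Only the trivial shuffle contributes. A representative of any other coset moves some index of the
-- first block into the second, and there `α` receives the first component of a vector of `Q`, which
-- is zero.
open Equiv in
theorem crossAt_mixed {i j k : ℕ} (h : i + j = k) (α : P [⋀^Fin i]→ₗ[ℝ] ℝ)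
    (β : Q [⋀^Fin j]→ₗ[ℝ] ℝ) (u : Fin i → P) (v : Fin j → Q) :
    crossAt P Q h α β (mixed h u v) = α u * β v := by
  classical
  let s : Perm.ModSumCongr (Fin i) (Fin j) → Perm (Fin i ⊕ Fin j) :=
    fun σ => if σ = Quotient.mk'' 1 then 1 else σ.out
  have hs : ∀ σ, Quotient.mk'' (s σ) = σ := by
    intro σ
    by_cases h1 : σ = Quotient.mk'' 1
    · simp [s, h1]
    · simp only [s, h1, if_false]
      exact Quotient.out_eq' σ
  rw [crossAt_apply h α β _ s hs]
  refine (Finset.sum_eq_single (Quotient.mk'' 1 : Perm.ModSumCongr (Fin i) (Fin j)) ?_ ?_).trans ?_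
  rotate_left 2
  · simp only [s, if_true, Perm.sign_one, Units.val_one, Int.cast_one, one_mul, Perm.one_apply,
      Equiv.trans_apply, finSumFinEquiv_apply_left, finSumFinEquiv_apply_right, finCongr_apply,
      mixed, mix_left, mix_right, prP_inP, prQ_inQ]
  · intro σ _ hσ
    have h1 : s σ ∉ (Perm.sumCongrHom (Fin i) (Fin j)).range := by
      intro hmem
      apply hσ
      rw [← hs σ]
      apply Quotient.sound'
      rw [QuotientGroup.leftRel_apply]
      simpa using hmem
    have h2 : ¬ Set.MapsTo (s σ) (Set.range Sum.inl) (Set.range Sum.inl) :=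
      mt Perm.mem_sumCongrHom_range_of_perm_mapsTo_inl h1
    obtain ⟨x, ⟨a, rfl⟩, hx⟩ : ∃ x ∈ Set.range Sum.inl, s σ x ∉ Set.range Sum.inl := by
      simpa [Set.MapsTo] using h2
    rcases hx' : s σ (Sum.inl a) with a' | b
    · exact absurd ⟨a', hx'.symm⟩ hx
    · rw [α.map_coord_zero a, zero_mul, mul_zero]
      rw [hx']
      simp [mixed, mix_right]
  · simp

-- A nonzero term would need a permutation sending the first block into the first `a` positions and
-- the second block into the last `b`. Injectivity then gives `i ≤ a` and `j ≤ b`, and the equal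
-- sums force `a = i`.
open Equiv in
theorem crossAt_mixed_of_ne {i j a b k : ℕ} (h : i + j = k) (h' : a + b = k) (hne : a ≠ i)
    (α : P [⋀^Fin i]→ₗ[ℝ] ℝ) (β : Q [⋀^Fin j]→ₗ[ℝ] ℝ) (u : Fin a → P) (v : Fin b → Q) :
    crossAt P Q h α β (mixed h' u v) = 0 := by
  classical
  rw [crossAt_apply h α β _ Quotient.out (fun σ => Quotient.out_eq' σ)]
  refine Finset.sum_eq_zero fun σ _ => ?_
  set τ := Quotient.out σ
  set e : Fin i ⊕ Fin j ≃ Fin k := finSumFinEquiv.trans (finCongr h)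
  have hP : ∀ x, a ≤ (e (τ x)).1 → prP P Q (mixed h' u v (e (τ x))) = 0 := by
    intro x hx
    simp [mixed, mix, not_lt.2 hx]
  have hQ : ∀ x, (e (τ x)).1 < a → prQ P Q (mixed h' u v (e (τ x))) = 0 := by
    intro x hx
    simp [mixed, mix, hx]
  by_cases h1 : ∃ x, a ≤ (e (τ (Sum.inl x))).1
  · obtain ⟨x, hx⟩ := h1
    rw [α.map_coord_zero x (hP _ hx), zero_mul, mul_zero]
  by_cases h2 : ∃ x, (e (τ (Sum.inr x))).1 < a
  · obtain ⟨x, hx⟩ := h2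
    rw [β.map_coord_zero x (hQ _ hx), mul_zero, mul_zero]
  push Not at h1 h2
  exfalso
  have c1 : i ≤ a := by
    have := Fintype.card_le_of_injective (fun x : Fin i => (⟨_, h1 x⟩ : Fin a)) (by
      intro x y hxy
      have : e (τ (Sum.inl x)) = e (τ (Sum.inl y)) := Fin.ext (by simpa using hxy)
      simpa using this)
    simpa using this
  have c2 : j ≤ b := by
    have := Fintype.card_le_of_injective
      (fun x : Fin j => (⟨(e (τ (Sum.inr x))).1 - a, by
        have := h2 x; have := (e (τ (Sum.inr x))).2; omega⟩ : Fin b)) (by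
      intro x y hxy
      have : e (τ (Sum.inr x)) = e (τ (Sum.inr y)) := Fin.ext (by
        have := h2 x; have := h2 y
        simp only [Fin.mk.injEq] at hxy
        omega)
      simpa using this)
    simpa using this
  omega

/-- An alternating map on a product is determined by its values on tuples of vectors of the first
factor followed by vectors of the second factor. -/
theorem alternating_ext_mixed {k : ℕ} {δ δ' : (P.prod Q) [⋀^Fin k]→ₗ[ℝ] ℝ}
    (h : ∀ (a b : ℕ) (hab : a + b = k) (u : Fin a → P) (v : Fin b → Q),
      δ (mixed hab u v) = δ' (mixed hab u v)) : δ = δ' := by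
  classical
  suffices H : ∀ ε : (P.prod Q) [⋀^Fin k]→ₗ[ℝ] ℝ, (∀ (a b : ℕ) (hab : a + b = k) (u : Fin a → P)
      (v : Fin b → Q), ε (mixed hab u v) = 0) → ε = 0 by
    exact sub_eq_zero.1 (H (δ - δ') fun a b hab u v => by simp [h a b hab u v])
  intro ε hε
  ext z
  have hz : z = (fun i => inP P Q (prP P Q (z i))) + (fun i => inQ P Q (prQ P Q (z i))) := by
    funext i
    exact (inP_prP_add_inQ_prQ (z i)).symm
  -- Expand over the set `s` of positions at which the component in `P` is taken. The permutation
  -- `σ` below brings these positions to the front, which costs at most a sign.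
  have hsum := ε.toMultilinearMap.map_add_univ (fun i => inP P Q (prP P Q (z i)))
    (fun i => inQ P Q (prQ P Q (z i)))
  rw [← hz] at hsum
  refine hsum.trans (Finset.sum_eq_zero fun s _ => ?_)
  have hcard : s.card + sᶜ.card = k := by simp [s.card_add_card_compl]
  let e : Fin s.card ⊕ Fin sᶜ.card ≃ Fin k := finSumEquivOfFinset rfl rfl
  let σ : Equiv.Perm (Fin k) := (finSumFinEquiv.trans (finCongr hcard)).symm.trans e
  have key := hε _ _ hcard (fun i => prP P Q (z (e (Sum.inl i))))
    (fun j => prQ P Q (z (e (Sum.inr j))))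
  have hperm := ε.map_perm (s.piecewise (fun i => inP P Q (prP P Q (z i)))
    (fun i => inQ P Q (prQ P Q (z i)))) σ
  have hmix : (s.piecewise (fun i => inP P Q (prP P Q (z i)))
      (fun i => inQ P Q (prQ P Q (z i)))) ∘ σ =
      mixed hcard (fun i => prP P Q (z (e (Sum.inl i)))) (fun j => prQ P Q (z (e (Sum.inr j)))) := by
    funext l
    obtain ⟨x, rfl⟩ := (finSumFinEquiv.trans (finCongr hcard)).surjective l
    have hσ : σ ((finSumFinEquiv.trans (finCongr hcard)) x) = e x := by simp [σ]
    rw [Function.comp, hσ]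
    rcases x with x | x
    · have hm : e (Sum.inl x) ∈ s := by simp [e, finSumEquivOfFinset_inl]
      rw [Finset.piecewise_eq_of_mem _ _ _ hm]
      exact (mix_left hcard (fun i => inP P Q (prP P Q (z (e (Sum.inl i)))))
        (fun j => inQ P Q (prQ P Q (z (e (Sum.inr j))))) x).symm
    · have hm : e (Sum.inr x) ∉ s := by
        have := Finset.orderEmbOfFin_mem sᶜ rfl x
        rw [show e (Sum.inr x) = sᶜ.orderEmbOfFin rfl x from finSumEquivOfFinset_inr rfl rfl x]
        exact Finset.mem_compl.1 this
      rw [Finset.piecewise_eq_of_notMem _ _ _ hm]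
      exact (mix_right hcard (fun i => inP P Q (prP P Q (z (e (Sum.inl i)))))
        (fun j => inQ P Q (prQ P Q (z (e (Sum.inr j))))) x).symm
  rw [hmix, key] at hperm
  have : ε (s.piecewise (fun i => inP P Q (prP P Q (z i)))
    (fun i => inQ P Q (prQ P Q (z i)))) = 0 := by
    have h2 := hperm.symm
    rwa [Units.smul_def, ← Int.cast_smul_eq_zsmul ℝ, smul_eq_zero_iff_right (by simp)] at h2
  exact this

end Foliation

end

/-! ### Product charts and smoothness of cross products -/

section

namespace Foliation

variable {E H : Type*} [NormedAddCommGroup E] [NormedSpace ℝ E] [FiniteDimensional ℝ E]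
  [TopologicalSpace H] {I : ModelWithCorners ℝ E H} [I.Boundaryless]
  {M : Type*} [TopologicalSpace M] [ChartedSpace H M] [IsManifold I ∞ M]
  {E' H' : Type*} [NormedAddCommGroup E'] [NormedSpace ℝ E'] [FiniteDimensional ℝ E']
  [TopologicalSpace H'] {J : ModelWithCorners ℝ E' H'} [J.Boundaryless]
  {N : Type*} [TopologicalSpace N] [ChartedSpace H' N] [IsManifold J ∞ N]
  {F : Foliation I M} {G : Foliation J N}

namespace FoliatedChart

/-- The product of two foliated charts. -/
def prod (c : F.FoliatedChart) (c' : G.FoliatedChart) : (F.prod G).FoliatedChart where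
  chart := c.chart.prod c'.chart
  mem := prod_mem_maximalAtlas c.mem c'.mem
  proj := c.proj.prodMap c'.proj
  proj_proj v := by
    ext
    · exact c.proj_proj v.1
    · exact c'.proj_proj v.2
  mem_tangent_iff := by
    rintro ⟨x, y⟩ ⟨hx, hy⟩ ⟨v, w⟩
    rw [mfderiv_prod_extend c.mem c'.mem hx hy v w]
    refine Iff.trans ?_ Prod.ext_iff.symm
    exact and_congr (c.mem_tangent hx v) (c'.mem_tangent hy w)

variable (c : F.FoliatedChart) (c' : G.FoliatedChart)

theorem mem_prod_source {x : M} {y : N} (hx : x ∈ c.chart.source) (hy : y ∈ c'.chart.source) :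
    (x, y) ∈ (c.prod c').chart.source := ⟨hx, hy⟩

theorem prod_ext_apply (x : M) (y : N) : (c.prod c').ext (x, y) = (c.ext x, c'.ext y) := rfl

theorem prod_coframe {x : M} {y : N} (hx : x ∈ c.chart.source) (hy : y ∈ c'.chart.source)
    (z : (F.tangent x).prod (G.tangent y)) :
    (c.prod c').coframe (x, y) z =
      (c.coframe x (prP _ _ z), c'.coframe y (prQ _ _ z)) :=
  mfderiv_prod_extend c.mem c'.mem hx hy z.1.1 z.1.2

theorem prod_frame {x : M} {y : N} (hx : x ∈ c.chart.source) (hy : y ∈ c'.chart.source)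
    (v : E × E') :
    ((c.prod c').frame (x, y) v : (F.tangent x).prod (G.tangent y)) =
      inP _ _ (c.frame x v.1) + inQ _ _ (c'.frame y v.2) := by
  set z : (F.tangent x).prod (G.tangent y) := inP _ _ (c.frame x v.1) + inQ _ _ (c'.frame y v.2)
  have h1 := (c.prod c').frame_coframe (c.mem_prod_source c' hx hy) z
  have h2 : (c.prod c').coframe (x, y) z = (c.prod c').proj v := by
    rw [prod_coframe c c' hx hy]
    have e1 : prP _ _ z = c.frame x v.1 := by simp [z]
    have e2 : prQ _ _ z = c'.frame y v.2 := by simp [z]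
    rw [e1, e2, c.coframe_frame hx, c'.coframe_frame hy]
    rfl
  rw [h2, frame_proj] at h1
  exact h1

/-- The values of a form on the product, in coordinates, on vectors of the two factors. -/
theorem prod_rep_mix {k a b : ℕ} (h : a + b = k)
    (τ : ∀ p, ((F.prod G).tangent p) [⋀^Fin k]→ₗ[ℝ] ℝ) {e : E} {e' : E'}
    (he : e ∈ c.ext.target) (he' : e' ∈ c'.ext.target) (v : Fin a → E) (w : Fin b → E') :
    (c.prod c').rep τ (e, e') (mix h (fun i => (v i, 0)) (fun j => (0, w j))) =
      τ (c.ext.symm e, c'.ext.symm e')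
        (mixed h (fun i => c.frame _ (v i)) (fun j => c'.frame _ (w j))) := by
  rw [rep_apply]
  change τ (c.ext.symm e, c'.ext.symm e') _ = _
  congr 1
  funext l
  refine (mix_comp (X := E × E') (Y := (F.tangent (c.ext.symm e)).prod (G.tangent (c'.ext.symm e')))
    ((c.prod c').frame (c.ext.symm e, c'.ext.symm e')) h _ _ l).trans ?_
  refine congrFun (congrArg₂ (mix h) ?_ ?_) l
  · funext i
    refine (c.prod_frame c' (c.symm_mem he) (c'.symm_mem he') (v i, 0)).trans ?_
    exact inP_add_of_eq_zero _ (map_zero _)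
  · funext i
    refine (c.prod_frame c' (c.symm_mem he) (c'.symm_mem he') (0, w i)).trans ?_
    exact inQ_add_of_eq_zero _ (map_zero _)

theorem prod_coframe_mixed {k a b : ℕ} (h : a + b = k) {x : M} {y : N} (hx : x ∈ c.chart.source)
    (hy : y ∈ c'.chart.source) (u : Fin a → F.tangent x) (v : Fin b → G.tangent y) (i : Fin k) :
    (c.prod c').coframe (x, y) (mixed h u v i) =
      mix h (fun i => (c.coframe x (u i), (0 : E'))) (fun j => ((0 : E), c'.coframe y (v j))) i := by
  refine (mix_comp (X := (F.tangent x).prod (G.tangent y)) (Y := E × E')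
    ((c.prod c').coframe (x, y)) h _ _ i).trans ?_
  refine congrFun (congrArg₂ (mix h) ?_ ?_) i
  · funext i
    refine (prod_coframe c c' hx hy _).trans ?_
    exact congrArg (Prod.mk _) (map_zero _)
  · funext i
    refine (prod_coframe c c' hx hy _).trans ?_
    exact congrArg (fun e : E => (e, c'.coframe y (v i))) (map_zero _)

theorem mem_prod_target {e : E} {e' : E'} (he : e ∈ c.ext.target) (he' : e' ∈ c'.ext.target) :
    (e, e') ∈ (c.prod c').ext.target := by
  have := (c.prod c').ext_mem (c.mem_prod_source c' (c.symm_mem he) (c'.symm_mem he'))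
  rwa [prod_ext_apply, c.ext_symm he, c'.ext_symm he'] at this

end FoliatedChart

/-- The cross product of a leafwise form with a family of leafwise forms. -/
def crossFun {i j k : ℕ} (h : i + j = k) (α : ∀ x, (F.tangent x) [⋀^Fin i]→ₗ[ℝ] ℝ)
    (η : M → ∀ y, (G.tangent y) [⋀^Fin j]→ₗ[ℝ] ℝ) :
    ∀ p, ((F.prod G).tangent p) [⋀^Fin k]→ₗ[ℝ] ℝ :=
  fun p => crossAt (F.tangent p.1) (G.tangent p.2) h (α p.1) (η p.1 p.2)

/-- The second form may vary with the point of `M`; this is needed for the families of primitives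
later on. In coordinates the cross product is a finite sum over shuffles of products of smooth
functions. -/
theorem contDiffAt_rep_crossFun {i j k : ℕ} (h : i + j = k)
    {α : ∀ x, (F.tangent x) [⋀^Fin i]→ₗ[ℝ] ℝ} {η : M → ∀ y, (G.tangent y) [⋀^Fin j]→ₗ[ℝ] ℝ}
    (c : F.FoliatedChart) (c' : G.FoliatedChart) {e : E} {e' : E'}
    (he : e ∈ c.ext.target) (he' : e' ∈ c'.ext.target) (hα : ContDiffAt ℝ ∞ (c.rep α) e)
    (hη : ContDiffAt ℝ ∞ (fun p : E × E' => c'.rep (η (c.ext.symm p.1)) p.2) (e, e')) :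
    ContDiffAt ℝ ∞ ((c.prod c').rep (crossFun h α η)) (e, e') := by
  refine contDiffAt_alternating fun z => ?_
  have hα' : ContDiffAt ℝ ∞ (fun p : E × E' => c.rep α p.1) (e, e') :=
    ContDiffAt.comp (g := c.rep α) (f := Prod.fst) (e, e') hα contDiffAt_fst
  have key : ContDiffAt ℝ ∞ (fun p : E × E' =>
      ∑ σ : Equiv.Perm.ModSumCongr (Fin i) (Fin j), ((Equiv.Perm.sign (Quotient.out σ) : ℤ) : ℝ) *
      (c.rep α p.1 (fun a => (z (finSumFinEquiv.trans (finCongr h) (Quotient.out σ (Sum.inl a)))).1) *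
      c'.rep (η (c.ext.symm p.1)) p.2
        (fun b => (z (finSumFinEquiv.trans (finCongr h) (Quotient.out σ (Sum.inr b)))).2)))
      (e, e') := by
    refine ContDiffAt.sum fun σ _ => contDiffAt_const.mul (ContDiffAt.mul ?_ ?_)
    · exact contDiffAt_alternating_apply (g := fun a _ => _) hα' fun _ => contDiffAt_const
    · exact contDiffAt_alternating_apply (g := fun a _ => _) hη fun _ => contDiffAt_const
  refine key.congr_of_eventuallyEq ?_
  filter_upwards [(c.isOpen_target.prod c'.isOpen_target).mem_nhds ⟨he, he'⟩]
  rintro ⟨e, e'⟩ ⟨he, he'⟩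
  rw [FoliatedChart.rep_apply]
  refine (crossAt_apply h (α (c.ext.symm e)) (η (c.ext.symm e) (c'.ext.symm e')) _ Quotient.out
    (fun σ => Quotient.out_eq' σ)).trans ?_
  refine Finset.sum_congr rfl fun σ _ => ?_
  have hf : ∀ l, ((c.prod c').frame ((c.prod c').ext.symm (e, e')) (z l) :
      (F.tangent (c.ext.symm e)).prod (G.tangent (c'.ext.symm e'))) = _ := fun l =>
    c.prod_frame c' (c.symm_mem he) (c'.symm_mem he') (z l)
  rw [c.rep_apply, c'.rep_apply]
  congr 2
  · congr 1
    funext a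
    rw [hf]
    exact prP_add _ _
  · congr 1
    funext a
    rw [hf]
    exact prQ_add _ _

end Foliation

end

/-! ### Slices, the filtration, and the leading term of the derivative -/

section

namespace Foliation

theorem mix_update_right {X : Type*} {a b k : ℕ} (h : a + b = k) (u : Fin a → X) (v : Fin b → X)
    (j : Fin b) (w : X) : mix h u (Function.update v j w) =
      Function.update (mix h u v) (Fin.cast h (Fin.natAdd a j)) w := by
  funext l
  rcases Nat.lt_or_ge l.1 a with hl | hl
  · rw [mix_of_lt h _ _ ⟨l.1, hl⟩ rfl, Function.update_of_ne, mix_of_lt h _ _ ⟨l.1, hl⟩ rfl]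
    intro hl'
    rw [hl'] at hl
    simp at hl
  · have hl2 : l = Fin.cast h (Fin.natAdd a ⟨l.1 - a, by omega⟩) := Fin.ext (by simp; omega)
    rw [hl2, mix_right]
    by_cases hj : (⟨l.1 - a, by omega⟩ : Fin b) = j
    · rw [hj, Function.update_self, Function.update_self]
    · rw [Function.update_of_ne hj, Function.update_of_ne, mix_right]
      intro h'
      apply hj
      have := congrArg Fin.val h'
      simp only [Fin.val_cast, Fin.val_natAdd] at this
      exact Fin.ext (by simp only; omega)

/-- The alternating map obtained by inserting vectors of the first factor. -/
def sliceAt {V V' : Type*} [AddCommGroup V] [Module ℝ V] [AddCommGroup V'] [Module ℝ V']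
    {P : Submodule ℝ V} {Q : Submodule ℝ V'} {a b k : ℕ} (h : a + b = k)
    (τ : (P.prod Q) [⋀^Fin k]→ₗ[ℝ] ℝ) (u : Fin a → P) : Q [⋀^Fin b]→ₗ[ℝ] ℝ where
  toFun v := τ (mixed h u v)
  map_update_add' {inst} v j w w' := by
    obtain rfl : inst = instDecidableEqFin b := Subsingleton.elim _ _
    have key : ∀ w : Q, mixed h u (Function.update v j w) =
        Function.update (mixed h u v) (Fin.cast h (Fin.natAdd a j)) (inQ P Q w) := fun w => by
      rw [mixed, mixed, ← mix_update_right]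
      congr 1
      funext l
      exact Function.apply_update (fun _ => inQ P Q) v j w l
    rw [key, key, key, map_add, τ.map_update_add]
  map_update_smul' {inst} v j c w := by
    obtain rfl : inst = instDecidableEqFin b := Subsingleton.elim _ _
    have key : ∀ w : Q, mixed h u (Function.update v j w) =
        Function.update (mixed h u v) (Fin.cast h (Fin.natAdd a j)) (inQ P Q w) := fun w => by
      rw [mixed, mixed, ← mix_update_right]
      congr 1
      funext l
      exact Function.apply_update (fun _ => inQ P Q) v j w l
    rw [key, key, map_smul, τ.map_update_smul]
  map_eq_zero_of_eq' v i j hv hij := by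
    refine τ.map_eq_zero_of_eq _ (i := Fin.cast h (Fin.natAdd a i))
      (j := Fin.cast h (Fin.natAdd a j)) ?_ ?_
    · rw [mixed, mix_right, mix_right, hv]
    · intro h'
      apply hij
      simpa using h'

variable {E H : Type*} [NormedAddCommGroup E] [NormedSpace ℝ E] [FiniteDimensional ℝ E]
  [TopologicalSpace H] {I : ModelWithCorners ℝ E H} [I.Boundaryless]
  {M : Type*} [TopologicalSpace M] [ChartedSpace H M] [IsManifold I ∞ M]
  {E' H' : Type*} [NormedAddCommGroup E'] [NormedSpace ℝ E'] [FiniteDimensional ℝ E']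
  [TopologicalSpace H'] {J : ModelWithCorners ℝ E' H'} [J.Boundaryless]
  {N : Type*} [TopologicalSpace N] [ChartedSpace H' N] [IsManifold J ∞ N]
  [T2Space M] [T2Space N]
  {F : Foliation I M} {G : Foliation J N}

theorem rep_sliceAt {a b k : ℕ} (h : a + b = k)
    (τ : ∀ p, ((F.prod G).tangent p) [⋀^Fin k]→ₗ[ℝ] ℝ) (c : F.FoliatedChart)
    (c' : G.FoliatedChart) {x : M} (hx : x ∈ c.chart.source) (u : Fin a → F.tangent x) {e' : E'}
    (he' : e' ∈ c'.ext.target) (w : Fin b → E') :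
    c'.rep (fun y => sliceAt h (τ (x, y)) u) e' w =
      (c.prod c').rep τ (c.ext x, e')
        (mix h (fun i => (c.coframe x (u i), 0)) (fun j => (0, w j))) := by
  refine Eq.trans ?_ (c.prod_rep_mix c' h τ (c.ext_mem hx) he' _ _).symm
  have key : ∀ x', x' = x → ∀ z : Fin b → G.tangent (c'.ext.symm e'),
      τ (x, c'.ext.symm e') (mixed h u z) =
      τ (x', c'.ext.symm e') (mixed h (fun i => c.frame x' (c.coframe x (u i))) z) := by
    rintro x' rfl z
    simp only [c.frame_coframe hx]
  exact key _ (c.symm_ext hx) _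

/-- The leafwise form on the second factor obtained by inserting vectors of the first factor. -/
def slice {a b k : ℕ} (h : a + b = k) (τ : (F.prod G).Form k) {x : M} (u : Fin a → F.tangent x) :
    G.Form b :=
  ⟨fun y => sliceAt h (τ.1 (x, y)) u, by
    refine FoliatedChart.mem_formSubmodule fun y => ?_
    obtain ⟨c', hy⟩ := G.exists_foliatedChart_at y
    obtain ⟨c, hx⟩ := F.exists_foliatedChart_at x
    refine ⟨c', hy, contDiffAt_alternating fun w => ?_⟩
    have h1 := (c.prod c').contDiffAt_rep τ.2 (c.mem_prod_target c' (c.ext_mem hx) (c'.ext_mem hy))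
    have h2 : ContDiffAt ℝ ∞ (fun e' : E' => (c.prod c').rep τ.1 (c.ext x, e')) (c'.ext y) :=
      ContDiffAt.comp (g := (c.prod c').rep τ.1) (f := fun e' : E' => (c.ext x, e')) (c'.ext y) h1
        (contDiffAt_const.prodMk contDiffAt_id)
    have h3 := contDiffAt_alternating_apply (g := fun l _ =>
      mix h (fun i => (c.coframe x (u i), 0)) (fun j => (0, w j)) l) h2 fun _ => contDiffAt_const
    refine h3.congr_of_eventuallyEq ?_
    filter_upwards [c'.isOpen_target.mem_nhds (c'.ext_mem hy)] with e' he'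
    exact rep_sliceAt h τ.1 c c' hx u he' w⟩

theorem slice_apply {a b k : ℕ} (h : a + b = k) (τ : (F.prod G).Form k) {x : M}
    (u : Fin a → F.tangent x) (y : N) (v : Fin b → G.tangent y) :
    (slice h τ u).1 y v = τ.1 (x, y) (mixed h u v) := rfl

/-- The exterior derivative of a form on a product, on vectors of the two factors. -/
theorem d_mixed {a b k : ℕ} (h : a + b = k + 1) (τ : (F.prod G).Form k) (c : F.FoliatedChart)
    (c' : G.FoliatedChart) {x : M} {y : N} (hx : x ∈ c.chart.source) (hy : y ∈ c'.chart.source)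
    (u : Fin a → F.tangent x) (v : Fin b → G.tangent y) :
    ((F.prod G).d k τ).1 (x, y) (mixed h u v) =
      ∑ i : Fin a, (-1) ^ (i : ℕ) * fderiv ℝ (fun p => (c.prod c').rep τ.1 p
        ((Fin.cast h (Fin.castAdd b i)).removeNth (mix h (fun i => (c.coframe x (u i), 0))
          (fun j => (0, c'.coframe y (v j)))))) (c.ext x, c'.ext y) (c.coframe x (u i), 0) +
      ∑ j : Fin b, (-1) ^ (a + j : ℕ) * fderiv ℝ (fun p => (c.prod c').rep τ.1 p
        ((Fin.cast h (Fin.natAdd a j)).removeNth (mix h (fun i => (c.coframe x (u i), 0))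
          (fun j => (0, c'.coframe y (v j)))))) (c.ext x, c'.ext y) (0, c'.coframe y (v j)) := by
  have h1 := (c.prod c').contDiffAt_rep τ.2 (c.mem_prod_target c' (c.ext_mem hx) (c'.ext_mem hy))
  refine (d_apply τ (c.prod c') (c.mem_prod_source c' hx hy) (mixed h u v)).trans ?_
  rw [show (fun i => (c.prod c').coframe (x, y) (mixed h u v i)) =
      mix h (fun i => (c.coframe x (u i), 0)) (fun j => (0, c'.coframe y (v j))) from
    funext fun i => c.prod_coframe_mixed c' h hx hy u v i]
  change extDeriv ((c.prod c').rep τ.1) (c.ext x, c'.ext y) _ = _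
  rw [extDeriv_apply (E := E × E') (h1.differentiableAt (by simp)), sum_mix h]
  simp only [mix_left, mix_right, zsmul_eq_mul, Int.cast_pow, Int.cast_neg, Int.cast_one,
    Fin.val_cast, Fin.val_castAdd, Fin.val_natAdd]

/-- The forms which vanish on tuples with fewer than `p` vectors of the first factor. -/
def filtration (F : Foliation I M) (G : Foliation J N) (k p : ℕ) :
    Submodule ℝ ((F.prod G).Form k) where
  carrier := {τ | ∀ (a b : ℕ) (h : a + b = k), a < p → ∀ (x : M) (y : N) (u : Fin a → F.tangent x)
    (v : Fin b → G.tangent y), τ.1 (x, y) (mixed h u v) = 0}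
  add_mem' {τ τ'} hτ hτ' a b h ha x y u v := by
    have : (τ + τ').1 (x, y) (mixed h u v) =
      τ.1 (x, y) (mixed h u v) + τ'.1 (x, y) (mixed h u v) := rfl
    rw [this, hτ a b h ha, hτ' a b h ha, add_zero]
  zero_mem' a b h ha x y u v := rfl
  smul_mem' r τ hτ a b h ha x y u v := by
    have : (r • τ).1 (x, y) (mixed h u v) = r * τ.1 (x, y) (mixed h u v) := rfl
    rw [this, hτ a b h ha, mul_zero]

/-- The leading term of the exterior derivative. -/
theorem d_mixed_leading {a b k : ℕ} (h : a + (b + 1) = k + 1) (h' : a + b = k)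
    {τ : (F.prod G).Form k} (hτ : τ ∈ filtration F G k a) {x : M} {y : N}
    (u : Fin a → F.tangent x) (v : Fin (b + 1) → G.tangent y) :
    ((F.prod G).d k τ).1 (x, y) (mixed h u v) = (-1) ^ a * (G.d b (slice h' τ u)).1 y v := by
  obtain ⟨c', hy⟩ := G.exists_foliatedChart_at y
  obtain ⟨c, hx⟩ := F.exists_foliatedChart_at x
  have he := c.ext_mem hx
  have he' := c'.ext_mem hy
  have h1 := (c.prod c').contDiffAt_rep τ.2 (c.mem_prod_target c' he he')
  rw [d_mixed h τ c c' hx hy]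
  -- Differentiating along a vector of the first factor removes it from the tuple. Then fewer than
  -- `a` such vectors remain, and `τ` vanishes there identically near the point.
  have hleft : ∀ i : Fin a, fderiv ℝ (fun p => (c.prod c').rep τ.1 p
        ((Fin.cast h (Fin.castAdd (b + 1) i)).removeNth (mix h (fun i => (c.coframe x (u i), 0))
          (fun j => (0, c'.coframe y (v j)))))) (c.ext x, c'.ext y) = 0 := by
    intro i
    obtain _ | a := a
    · exact i.elim0
    rw [removeNth_mix_left h (by omega)]
    have : (fun p : E × E' => (c.prod c').rep τ.1 p (mix (by omega) (i.removeNth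
        (fun i => (c.coframe x (u i), (0 : E')))) (fun j => ((0 : E), c'.coframe y (v j))))) =ᶠ[
        𝓝 (c.ext x, c'.ext y)] fun _ => (0 : ℝ) := by
      filter_upwards [(c.isOpen_target.prod c'.isOpen_target).mem_nhds ⟨he, he'⟩]
      rintro ⟨e, e'⟩ ⟨h1, h2⟩
      exact (c.prod_rep_mix c' (a := a) (b := b + 1) (by omega) τ.1 h1 h2 _ _).trans
        (hτ _ _ _ (Nat.lt_succ_self a) _ _ _ _)
    rw [this.fderiv_eq]
    exact fderiv_const_apply 0
  simp only [hleft, zero_apply, mul_zero, Finset.sum_const_zero, zero_add]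
  rw [d_apply _ c' hy, extDeriv_apply
    ((c'.contDiffAt_rep (slice h' τ u).2 he').differentiableAt (by simp)), Finset.mul_sum]
  refine Finset.sum_congr rfl fun j _ => ?_
  -- The `j`-th vector of the second factor stands at position `a + j`, hence the factor `(-1) ^ a`.
  rw [pow_add, mul_assoc, removeNth_mix_right h h', zsmul_eq_mul, Int.cast_pow, Int.cast_neg,
    Int.cast_one]
  congr 2
  have h2 : DifferentiableAt ℝ (fun p : E × E' => (c.prod c').rep τ.1 p
      (mix h' (fun i => (c.coframe x (u i), (0 : E')))
        (j.removeNth fun j => ((0 : E), c'.coframe y (v j))))) (c.ext x, c'.ext y) :=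
    (contDiffAt_alternating_apply (g := fun l _ => mix h' (fun i => (c.coframe x (u i), (0 : E')))
      (j.removeNth fun j => ((0 : E), c'.coframe y (v j))) l) h1 fun _ =>
      contDiffAt_const).differentiableAt (by simp)
  have h3 : HasFDerivAt (fun e' : E' => (c.ext x, e')) (ContinuousLinearMap.inr ℝ E E')
      (c'.ext y) := hasFDerivAt_prodMk_right _ _
  have h4 := (h2.hasFDerivAt.comp (c'.ext y) h3).fderiv
  have h5 : (fun e' => c'.rep (slice h' τ u).1 e' (j.removeNth fun i => c'.coframe y (v i)))
      =ᶠ[𝓝 (c'.ext y)] (fun p : E × E' => (c.prod c').rep τ.1 p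
      (mix h' (fun i => (c.coframe x (u i), (0 : E')))
        (j.removeNth fun j => ((0 : E), c'.coframe y (v j))))) ∘ fun e' : E' => (c.ext x, e') := by
    filter_upwards [c'.isOpen_target.mem_nhds he'] with e' he''
    exact rep_sliceAt h' τ.1 c c' hx u he'' _
  rw [h5.fderiv_eq, h4]
  simp

end Foliation

end

/-! ### Cross products of forms and the Leibniz rule -/

section

namespace Foliation

variable {E H : Type*} [NormedAddCommGroup E] [NormedSpace ℝ E] [FiniteDimensional ℝ E]
  [TopologicalSpace H] {I : ModelWithCorners ℝ E H} [I.Boundaryless]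
  {M : Type*} [TopologicalSpace M] [ChartedSpace H M] [IsManifold I ∞ M]
  {E' H' : Type*} [NormedAddCommGroup E'] [NormedSpace ℝ E'] [FiniteDimensional ℝ E']
  [TopologicalSpace H'] {J : ModelWithCorners ℝ E' H'} [J.Boundaryless]
  {N : Type*} [TopologicalSpace N] [ChartedSpace H' N] [IsManifold J ∞ N]
  [T2Space M] [T2Space N]
  {F : Foliation I M} {G : Foliation J N}

/-- Leafwise forms on a product agree if they agree on tuples of vectors of the first factor
followed by vectors of the second factor. -/
theorem form_ext_mixed {k : ℕ} {τ τ' : (F.prod G).Form k}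
    (h : ∀ (x : M) (y : N) (a b : ℕ) (hab : a + b = k) (u : Fin a → F.tangent x)
      (v : Fin b → G.tangent y), τ.1 (x, y) (mixed hab u v) = τ'.1 (x, y) (mixed hab u v)) :
    τ = τ' :=
  form_ext fun p => alternating_ext_mixed (P := F.tangent p.1) (Q := G.tangent p.2) (h p.1 p.2)

theorem crossFun_mem {i j k : ℕ} (h : i + j = k) (α : F.Form i) (β : G.Form j) :
    crossFun h α.1 (fun _ => β.1) ∈ (F.prod G).formSubmodule k := by
  refine FoliatedChart.mem_formSubmodule fun p => ?_
  obtain ⟨c, hx⟩ := F.exists_foliatedChart_at p.1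
  obtain ⟨c', hy⟩ := G.exists_foliatedChart_at p.2
  refine ⟨c.prod c', c.mem_prod_source c' hx hy, ?_⟩
  refine contDiffAt_rep_crossFun h c c' (c.ext_mem hx) (c'.ext_mem hy)
    (c.contDiffAt_rep α.2 (c.ext_mem hx)) ?_
  exact ContDiffAt.comp (g := c'.rep β.1) (f := Prod.snd) (c.ext p.1, c'.ext p.2)
    (c'.contDiffAt_rep β.2 (c'.ext_mem hy)) contDiffAt_snd

/-- The cross product of leafwise forms. -/
def crossForm {i j k : ℕ} (h : i + j = k) (α : F.Form i) (β : G.Form j) : (F.prod G).Form k :=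
  ⟨crossFun h α.1 (fun _ => β.1), crossFun_mem h α β⟩

theorem crossForm_mixed {i j k : ℕ} (h : i + j = k) (α : F.Form i) (β : G.Form j) (x : M) (y : N)
    (u : Fin i → F.tangent x) (v : Fin j → G.tangent y) :
    (crossForm h α β).1 (x, y) (mixed h u v) = α.1 x u * β.1 y v :=
  crossAt_mixed h _ _ u v

theorem crossForm_mixed_of_ne {i j a b k : ℕ} (h : i + j = k) (h' : a + b = k) (hne : a ≠ i)
    (α : F.Form i) (β : G.Form j) (x : M) (y : N)
    (u : Fin a → F.tangent x) (v : Fin b → G.tangent y) :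
    (crossForm h α β).1 (x, y) (mixed h' u v) = 0 :=
  crossAt_mixed_of_ne h h' hne _ _ u v

/-- The cross product as a bilinear map. -/
def cross {i j k : ℕ} (h : i + j = k) : F.Form i →ₗ[ℝ] G.Form j →ₗ[ℝ] (F.prod G).Form k := by
  -- The cross product is characterised by its values on mixed tuples, so each law of bilinearity
  -- becomes an identity between real numbers.
  have key : ∀ (τ : (F.prod G).Form k) (α : F.Form i) (β : G.Form j),
      (∀ x y (u : Fin i → F.tangent x) (v : Fin j → G.tangent y),
        τ.1 (x, y) (mixed h u v) = α.1 x u * β.1 y v) →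
      (∀ x y (a b : ℕ) (h' : a + b = k) (u : Fin a → F.tangent x) (v : Fin b → G.tangent y),
        a ≠ i → τ.1 (x, y) (mixed h' u v) = 0) → crossForm h α β = τ := by
    intro τ α β h1 h2
    refine form_ext_mixed fun x y a b hab u v => ?_
    by_cases ha : a = i
    · subst ha
      obtain rfl : b = j := by omega
      rw [crossForm_mixed, h1]
    · rw [crossForm_mixed_of_ne h hab ha, h2 x y a b hab u v ha]
  refine LinearMap.mk₂ ℝ (crossForm h) ?_ ?_ ?_ ?_
  · intro α α' β
    refine key _ _ _ (fun x y u v => ?_) fun x y a b h' u v ha => ?_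
    · exact (congrArg₂ (· + ·) (crossForm_mixed h _ _ x y u v)
        (crossForm_mixed h _ _ x y u v)).trans (add_mul _ _ _).symm
    · exact (congrArg₂ (· + ·) (crossForm_mixed_of_ne h h' ha _ _ x y u v)
        (crossForm_mixed_of_ne h h' ha _ _ x y u v)).trans (add_zero _)
  · intro r α β
    refine key _ _ _ (fun x y u v => ?_) fun x y a b h' u v ha => ?_
    · exact (congrArg (r * ·) (crossForm_mixed h _ _ x y u v)).trans (mul_assoc _ _ _).symm
    · exact (congrArg (r * ·) (crossForm_mixed_of_ne h h' ha _ _ x y u v)).trans (mul_zero _)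
  · intro α β β'
    refine key _ _ _ (fun x y u v => ?_) fun x y a b h' u v ha => ?_
    · exact (congrArg₂ (· + ·) (crossForm_mixed h _ _ x y u v)
        (crossForm_mixed h _ _ x y u v)).trans (mul_add _ _ _).symm
    · exact (congrArg₂ (· + ·) (crossForm_mixed_of_ne h h' ha _ _ x y u v)
        (crossForm_mixed_of_ne h h' ha _ _ x y u v)).trans (add_zero _)
  · intro r α β
    refine key _ _ _ (fun x y u v => ?_) fun x y a b h' u v ha => ?_
    · exact (congrArg (r * ·) (crossForm_mixed h _ _ x y u v)).trans (mul_left_comm _ _ _)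
    · exact (congrArg (r * ·) (crossForm_mixed_of_ne h h' ha _ _ x y u v)).trans (mul_zero _)

theorem cross_mixed {i j k : ℕ} (h : i + j = k) (α : F.Form i) (β : G.Form j) (x : M) (y : N)
    (u : Fin i → F.tangent x) (v : Fin j → G.tangent y) :
    (cross h α β).1 (x, y) (mixed h u v) = α.1 x u * β.1 y v :=
  crossAt_mixed h _ _ u v

theorem cross_mixed_of_ne {i j a b k : ℕ} (h : i + j = k) (h' : a + b = k) (hne : a ≠ i)
    (α : F.Form i) (β : G.Form j) (x : M) (y : N)
    (u : Fin a → F.tangent x) (v : Fin b → G.tangent y) :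
    (cross h α β).1 (x, y) (mixed h' u v) = 0 :=
  crossAt_mixed_of_ne h h' hne _ _ u v

theorem cross_mem_filtration {i j k : ℕ} (h : i + j = k) (α : F.Form i) (β : G.Form j) {p : ℕ}
    (hp : p ≤ i) : cross h α β ∈ filtration F G k p := fun a b hab ha x y u v =>
  cross_mixed_of_ne h hab (by omega) α β x y u v

theorem slice_cross {i j k : ℕ} (h : i + j = k) (α : F.Form i) (β : G.Form j) {x : M}
    (u : Fin i → F.tangent x) : slice h (cross h α β) u = α.1 x u • β := by
  refine form_ext fun y => ?_
  ext v
  rw [slice_apply, cross_mixed]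
  rfl

/-- The values of the cross product in coordinates. -/
theorem rep_cross_mix {i j a b k : ℕ} (h : i + j = k) (h' : a + b = k) (α : F.Form i)
    (β : G.Form j) (c : F.FoliatedChart) (c' : G.FoliatedChart) {e : E} {e' : E'}
    (he : e ∈ c.ext.target) (he' : e' ∈ c'.ext.target) (u : Fin a → E) (v : Fin b → E')
    (hne : a ≠ i) :
    (c.prod c').rep (cross h α β).1 (e, e')
      (mix h' (fun i => (u i, (0 : E'))) (fun j => ((0 : E), v j))) = 0 :=
  (c.prod_rep_mix c' h' _ he he' u v).trans (cross_mixed_of_ne h h' hne α β _ _ _ _)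

/-- The exterior derivative of the cross product. -/
theorem d_cross_eq_add {i j k : ℕ} (h : i + j = k) (h' : i + 1 + j = k + 1)
    (h'' : i + (j + 1) = k + 1) (α : F.Form i) (β : G.Form j) :
    (F.prod G).d k (cross h α β) =
      cross h' (F.d i α) β + (-1 : ℝ) ^ i • cross h'' α (G.d j β) := by
  refine form_ext_mixed fun x y a b hab u v => ?_
  change _ = (cross h' (F.d i α) β).1 (x, y) (mixed hab u v) +
    (-1) ^ i * (cross h'' α (G.d j β)).1 (x, y) (mixed hab u v)
  -- The cross product lies in step `i` of the filtration, so for `a = i` the leading term formula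
  -- gives the summand with `G.d j β`.
  by_cases h0 : a = i
  · subst h0
    obtain rfl : b = j + 1 := by omega
    rw [d_mixed_leading hab h (cross_mem_filtration h α β le_rfl),
      cross_mixed_of_ne h' hab (by omega), slice_cross, map_smul, cross_mixed, zero_add]
    rfl
  rw [cross_mixed_of_ne h'' hab h0, mul_zero, add_zero]
  obtain ⟨c', hy⟩ := G.exists_foliatedChart_at y
  obtain ⟨c, hx⟩ := F.exists_foliatedChart_at x
  have he := c.ext_mem hx
  have he' := c'.ext_mem hy
  rw [d_mixed hab _ c c' hx hy]
  -- Differentiating along the second factor leaves `a` vectors of the first, and the cross product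
  -- vanishes on such tuples because `a ≠ i`.
  have hright : ∀ l : Fin b, fderiv ℝ (fun p => (c.prod c').rep (cross h α β).1 p
        ((Fin.cast hab (Fin.natAdd a l)).removeNth (mix hab (fun i => (c.coframe x (u i), 0))
          (fun j => (0, c'.coframe y (v j)))))) (c.ext x, c'.ext y) = 0 := by
    intro l
    obtain _ | b := b
    · exact l.elim0
    rw [removeNth_mix_right hab (by omega)]
    have : (fun p : E × E' => (c.prod c').rep (cross h α β).1 p (mix (by omega)
        (fun i => (c.coframe x (u i), (0 : E')))
        (l.removeNth (fun j => ((0 : E), c'.coframe y (v j)))))) =ᶠ[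
        𝓝 (c.ext x, c'.ext y)] fun _ => (0 : ℝ) := by
      filter_upwards [(c.isOpen_target.prod c'.isOpen_target).mem_nhds ⟨he, he'⟩]
      rintro ⟨e, e'⟩ ⟨h1, h2⟩
      exact rep_cross_mix h (by omega) α β c c' h1 h2 _ _ h0
    rw [this.fderiv_eq]
    exact fderiv_const_apply 0
  simp only [hright, zero_apply, mul_zero, Finset.sum_const_zero, add_zero]
  by_cases h1 : a = i + 1
  · subst h1
    obtain rfl : b = j := by omega
    rw [cross_mixed, d_apply _ c hx, extDeriv_apply
      ((c.contDiffAt_rep α.2 he).differentiableAt (by simp)), Finset.sum_mul]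
    refine Finset.sum_congr rfl fun l _ => ?_
    rw [removeNth_mix_left hab h, zsmul_eq_mul, Int.cast_pow, Int.cast_neg,
      Int.cast_one, mul_assoc]
    congr 1
    have h2 : DifferentiableAt ℝ (fun e : E => c.rep α.1 e
        (l.removeNth fun i => c.coframe x (u i))) (c.ext x) :=
      (contDiffAt_alternating_apply (g := fun m _ => l.removeNth (fun i => c.coframe x (u i)) m)
        (c.contDiffAt_rep α.2 he) fun _ => contDiffAt_const).differentiableAt (by simp)
    have h3 : DifferentiableAt ℝ (fun e' : E' => c'.rep β.1 e'
        (fun i => c'.coframe y (v i))) (c'.ext y) :=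
      (contDiffAt_alternating_apply (g := fun m _ => c'.coframe y (v m))
        (c'.contDiffAt_rep β.2 he') fun _ => contDiffAt_const).differentiableAt (by simp)
    -- In coordinates the cross product is a function of the first variable times one of the second;
    -- the second is constant in the direction of differentiation.
    have h4 := (h2.hasFDerivAt.comp (c.ext x, c'.ext y) (hasFDerivAt_fst (𝕜 := ℝ))).mul
      (h3.hasFDerivAt.comp (c.ext x, c'.ext y) (hasFDerivAt_snd (𝕜 := ℝ)))
    have h5 : (fun p : E × E' => (c.prod c').rep (cross h α β).1 p (mix h
        (l.removeNth (fun i => (c.coframe x (u i), (0 : E'))))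
        (fun j => ((0 : E), c'.coframe y (v j))))) =ᶠ[𝓝 (c.ext x, c'.ext y)]
        ((fun e : E => c.rep α.1 e (l.removeNth fun i => c.coframe x (u i))) ∘ Prod.fst) *
        ((fun e' : E' => c'.rep β.1 e' (fun i => c'.coframe y (v i))) ∘ Prod.snd) := by
      filter_upwards [(c.isOpen_target.prod c'.isOpen_target).mem_nhds ⟨he, he'⟩]
      rintro ⟨e, e'⟩ ⟨h1, h2⟩
      exact (c.prod_rep_mix c' h _ h1 h2 _ _).trans (cross_mixed h α β _ _ _ _)
    rw [h5.fderiv_eq, h4.fderiv]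
    have h6 := c'.rep_coframe β.1 hy v
    simp only [add_apply, smul_apply, ContinuousLinearMap.comp_apply, ContinuousLinearMap.coe_fst',
      ContinuousLinearMap.coe_snd', map_zero, smul_eq_mul, mul_zero, zero_add, Function.comp_apply]
    rw [mul_comm, h6]
  · rw [cross_mixed_of_ne h' hab h1]
    refine Finset.sum_eq_zero fun l _ => ?_
    obtain _ | a := a
    · exact l.elim0
    rw [removeNth_mix_left hab (by omega)]
    have : (fun p : E × E' => (c.prod c').rep (cross h α β).1 p (mix (by omega)
        (l.removeNth (fun i => (c.coframe x (u i), (0 : E'))))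
        (fun j => ((0 : E), c'.coframe y (v j))))) =ᶠ[
        𝓝 (c.ext x, c'.ext y)] fun _ => (0 : ℝ) := by
      filter_upwards [(c.isOpen_target.prod c'.isOpen_target).mem_nhds ⟨he, he'⟩]
      rintro ⟨e, e'⟩ ⟨h1, h2⟩
      exact rep_cross_mix h (by omega) α β c c' h1 h2 _ _ (by omega)
    rw [this.fderiv_eq]
    simp

/-- The exterior derivative of the cross product with a closed form. -/
theorem d_cross {i j k : ℕ} (h : i + j = k) (h' : i + 1 + j = k + 1) (α : F.Form i)
    {β : G.Form j} (hβ : G.d j β = 0) :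
    (F.prod G).d k (cross h α β) = cross h' (F.d i α) β := by
  rw [d_cross_eq_add h h' (by omega), hβ, map_zero, smul_zero, add_zero]

end Foliation

end

/-! ### Open mapping theorem and lifting of rapidly decreasing families -/

section

open scoped Pointwise in
/-- The image under a continuous linear surjection onto a Baire space of a neighbourhood of zero is
dense in a neighbourhood of zero. -/
theorem ContinuousLinearMap.closure_image_mem_nhds_zero {X Z : Type*} [AddCommGroup X] [Module ℝ X]
    [TopologicalSpace X] [IsTopologicalAddGroup X] [ContinuousSMul ℝ X]
    [AddCommGroup Z] [Module ℝ Z] [TopologicalSpace Z] [IsTopologicalAddGroup Z]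
    [ContinuousSMul ℝ Z] [BaireSpace Z] (π : X →L[ℝ] Z) (hπ : Function.Surjective π)
    {U : Set X} (hU : U ∈ 𝓝 (0 : X)) : closure (π '' U) ∈ 𝓝 (0 : Z) := by
  obtain ⟨V, hV, hVU⟩ : ∃ V ∈ 𝓝 (0 : X), V - V ⊆ U := by
    have h : Tendsto (fun p : X × X => p.1 - p.2) (𝓝 0 ×ˢ 𝓝 0) (𝓝 0) := by
      rw [← nhds_prod_eq]
      exact (continuous_fst.sub continuous_snd).tendsto' (0, 0) 0 (sub_zero 0)
    obtain ⟨V, hV, hVU⟩ := mem_prod_self_iff.1 (h hU)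
    refine ⟨V, hV, ?_⟩
    rintro _ ⟨a, ha, b, hb, rfl⟩
    exact hVU (Set.mk_mem_prod ha hb)
  -- `V` is absorbing, so the multiples of its image cover `Z`, and by Baire one of their closures
  -- has an interior point.
  have hcov : ⋃ n : ℕ, closure (((n : ℝ) + 1) • (π '' V)) = univ := by
    refine eq_univ_of_forall fun z => ?_
    obtain ⟨x, rfl⟩ := hπ z
    have h : Tendsto (fun n : ℕ => ((n : ℝ) + 1)⁻¹ • x) atTop (𝓝 0) := by
      have h1 : Tendsto (fun n : ℕ => ((n : ℝ) + 1)⁻¹) atTop (𝓝 0) := by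
        simpa [one_div] using tendsto_one_div_add_atTop_nhds_zero_nat (𝕜 := ℝ)
      simpa using h1.smul_const x
    obtain ⟨n, hn⟩ := (h.eventually hV).exists
    refine mem_iUnion.2 ⟨n, subset_closure ⟨π (((n : ℝ) + 1)⁻¹ • x), mem_image_of_mem _ hn, ?_⟩⟩
    have : ((n : ℝ) + 1) ≠ 0 := by positivity
    simp [smul_smul, this]
  obtain ⟨n, hn⟩ := nonempty_interior_of_iUnion_of_closed (fun _ => isClosed_closure) hcov
  have hne : ((n : ℝ) + 1) ≠ 0 := by positivity
  obtain ⟨w, hw⟩ : (interior (closure (π '' V))).Nonempty := by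
    rw [closure_smul₀' hne, interior_smul₀ hne] at hn
    exact Set.smul_set_nonempty.1 hn
  -- Subtracting an interior point `w` moves a neighbourhood of `w` to one of zero; the difference
  -- is absorbed by `V - V ⊆ U`.
  have hsub : closure (π '' V) - closure (π '' V) ⊆ closure (π '' U) := by
    rintro _ ⟨a, ha, b, hb, rfl⟩
    refine map_mem_closure₂ continuous_sub ha hb ?_
    rintro _ ⟨a, ha, rfl⟩ _ ⟨b, hb, rfl⟩
    exact ⟨a - b, hVU ⟨a, ha, b, hb, rfl⟩, map_sub _ _ _⟩
  refine mem_of_superset ?_ hsub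
  have h : Tendsto (fun z => z + w) (𝓝 (0 : Z)) (𝓝 w) :=
    (continuous_id.add continuous_const).tendsto' 0 w (zero_add w)
  filter_upwards [h (isOpen_interior.mem_nhds hw)] with z hz
  exact ⟨z + w, interior_subset hz, w, interior_subset hw, add_sub_cancel_right z w⟩

open scoped Pointwise in
/-- The open mapping theorem for complete, first countable topological vector spaces. -/
theorem ContinuousLinearMap.isOpenMap_of_baireSpace {X Z : Type*} [AddCommGroup X] [Module ℝ X]
    [UniformSpace X] [IsUniformAddGroup X] [ContinuousSMul ℝ X] [FirstCountableTopology X]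
    [CompleteSpace X]
    [AddCommGroup Z] [Module ℝ Z] [TopologicalSpace Z] [IsTopologicalAddGroup Z]
    [ContinuousSMul ℝ Z] [BaireSpace Z] [T2Space Z] [FirstCountableTopology Z] (π : X →L[ℝ] Z)
    (hπ : Function.Surjective π) {U : Set X} (hU : U ∈ 𝓝 (0 : X)) : π '' U ∈ 𝓝 (0 : Z) := by
  obtain ⟨B, hB, hBadd⟩ := IsTopologicalAddGroup.exists_antitone_basis_nhds_zero X
  obtain ⟨C, hC, -⟩ := IsTopologicalAddGroup.exists_antitone_basis_nhds_zero Z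
  obtain ⟨V, hV, hVc, hVU⟩ : ∃ V ∈ 𝓝 (0 : X), IsClosed V ∧ V ⊆ U := by
    obtain ⟨V, h1, h2⟩ := (closed_nhds_basis (0 : X)).mem_iff.1 hU
    exact ⟨V, h1.1, h1.2, h2⟩
  obtain ⟨N, hN⟩ := hB.mem_iff.1 hV
  have hB0 : ∀ n, (0 : X) ∈ B n := fun n => mem_of_mem_nhds (hB.mem n)
  have hcl := fun n => π.closure_image_mem_nhds_zero hπ (hB.mem n)
  refine mem_of_superset (hcl (N + 1)) fun z hz => ?_
  -- Successive approximation: the residual stays in the closure of the next image, so that the step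
  -- can be repeated, and lies in `C n`, so that the residuals tend to zero.
  have step : ∀ (n : ℕ) (w : closure (π '' B n)),
      ∃ x ∈ B n, w.1 - π x ∈ closure (π '' B (n + 1)) ∧ w.1 - π x ∈ C n := by
    rintro n ⟨w, hw⟩
    have h : ∀ᶠ w' in 𝓝 w, w - w' ∈ closure (π '' B (n + 1)) ∩ C n :=
      (continuous_const.sub continuous_id).tendsto' w (0 : Z) (sub_self w)
        (inter_mem (hcl (n + 1)) (hC.mem n))
    obtain ⟨_, h1, x, hx, rfl⟩ := mem_closure_iff_nhds.1 hw _ h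
    exact ⟨x, hx, h1.1, h1.2⟩
  choose s hsB hscl hsC using step
  let w : ∀ n : ℕ, closure (π '' B (N + 1 + n)) := fun n =>
    Nat.rec (motive := fun n => closure (π '' B (N + 1 + n))) ⟨z, hz⟩
      (fun n w => ⟨w.1 - π (s _ w), hscl _ w⟩) n
  let x : ℕ → X := fun n => s _ (w n)
  have hx : ∀ n, x n ∈ B (N + 1 + n) := fun n => hsB _ (w n)
  have hw : ∀ n, (w (n + 1)).1 = (w n).1 - π (x n) := fun n => rfl
  have hwC : ∀ n, (w (n + 1)).1 ∈ C (N + 1 + n) := fun n => hsC _ (w n)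
  have hsum : ∀ n, π (∑ i ∈ Finset.range n, x i) = z - (w n).1 := by
    intro n
    induction n with
    | zero => exact (map_zero π).trans (sub_self z).symm
    | succ n ih => rw [Finset.sum_range_succ, map_add, ih, hw]; abel
  -- As `B (n + 1) + B (n + 1) ⊆ B n`, starting the corrections at index `N + 1` keeps all partial
  -- sums in `B N ⊆ V`.
  have htail : ∀ l m, ∑ i ∈ Finset.Ico m (m + l), x i ∈ B (N + m) := by
    intro l
    induction l with
    | zero => intro m; simpa using hB0 _
    | succ l ih =>
      intro m
      rw [Finset.sum_eq_sum_Ico_succ_bot (by omega)]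
      refine hBadd (N + m) (Set.add_mem_add ?_ ?_)
      · have := hx m
        rwa [show N + 1 + m = N + m + 1 by omega] at this
      · have := ih (m + 1)
        rwa [show m + 1 + l = m + (l + 1) by omega] at this
  have hcau : CauchySeq fun n => ∑ i ∈ Finset.range n, x i := by
    rw [hB.toHasBasis.uniformity_of_nhds_zero_swapped.cauchySeq_iff']
    refine fun i _ => ⟨i, fun n hn => ?_⟩
    have h1 := htail (n - i) i
    rw [show i + (n - i) = n by omega, Finset.sum_Ico_eq_sub _ hn] at h1
    exact hB.antitone (by omega) h1
  obtain ⟨l, hl⟩ := cauchySeq_tendsto_of_complete hcau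
  refine ⟨l, hVU (hVc.mem_of_tendsto hl (Eventually.of_forall fun n => hN ?_)), ?_⟩
  · have h1 := htail n 0
    simpa using h1
  · have h1 := (π.continuous.tendsto l).comp hl
    refine tendsto_nhds_unique h1 ?_
    have h2 : Tendsto (fun n => (w n).1) atTop (𝓝 0) := by
      rw [← tendsto_add_atTop_iff_nat 1]
      refine hC.tendsto_right_iff.2 fun i _ => ?_
      filter_upwards [eventually_ge_atTop i] with n hn
      exact hC.antitone (by omega) (hwC n)
    have h3 := h2.const_sub z
    rw [sub_zero] at h3
    exact h3.congr fun n => (hsum n).symm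

/-- A choice of indices tending to infinity along which a sequence of eventually true predicates
holds. -/
theorem exists_tendsto_atTop_of_eventually {ι : Type*} [Countable ι] {P : ℕ → ι → Prop}
    (h0 : ∀ n, P 0 n) (hP : ∀ m, ∀ᶠ n in cofinite, P m n) :
    ∃ m : ι → ℕ, Tendsto m cofinite atTop ∧ ∀ n, P (m n) n := by
  classical
  obtain ⟨enc, henc⟩ := exists_injective_nat ι
  refine ⟨fun n => Nat.findGreatest (P · n) (enc n), ?_, fun n =>
    Nat.findGreatest_spec (P := (P · n)) (Nat.zero_le _) (h0 n)⟩
  refine tendsto_atTop.2 fun K => ?_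
  have h1 : ∀ᶠ n in cofinite, K ≤ enc n := by
    have := henc.tendsto_cofinite
    rw [Nat.cofinite_eq_atTop] at this
    exact this.eventually_ge_atTop K
  filter_upwards [h1, hP K] with n h1 h2
  exact Nat.le_findGreatest h1 h2

/-- Rapidly decreasing families can be lifted under open surjective linear maps. -/
theorem ContinuousLinearMap.exists_rapid_lift {X Z : Type*} [AddCommGroup X] [Module ℝ X]
    [TopologicalSpace X] [IsTopologicalAddGroup X] [ContinuousSMul ℝ X] [FirstCountableTopology X]
    [AddCommGroup Z] [Module ℝ Z] [TopologicalSpace Z] (π : X →L[ℝ] Z)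
    (hπ : Function.Surjective π) (hopen : ∀ U ∈ 𝓝 (0 : X), π '' U ∈ 𝓝 (0 : Z))
    {ι : Type*} [Countable ι] {w : ι → ℝ} (hw : ∀ n, 1 ≤ w n) {z : ι → Z}
    (hz : ∀ k : ℕ, Tendsto (fun n => w n ^ k • z n) cofinite (𝓝 0)) :
    ∃ x : ι → X, (∀ n, π (x n) = z n) ∧
      ∀ k : ℕ, Tendsto (fun n => w n ^ k • x n) cofinite (𝓝 0) := by
  obtain ⟨B, hB⟩ := (𝓝 (0 : X)).exists_antitone_basis
  have hw0 : ∀ n, 0 < w n := fun n => one_pos.trans_le (hw n)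
  -- One lift must serve all exponents `k`. The lift of `z n` is chosen with `w n ^ m n • x n` in
  -- the `m n`-th neighbourhood, where `m n → ∞`. Once `m n ≥ k`, lowering the exponent to `k` is a
  -- contraction, which balanced neighbourhoods tolerate. For `m = 0` any lift is allowed.
  obtain ⟨m, hm, hP⟩ := exists_tendsto_atTop_of_eventually
    (P := fun m n => ∃ x, π x = z n ∧ (m = 0 ∨ w n ^ m • x ∈ balancedCore ℝ (B m)))
    (fun n => (hπ (z n)).imp fun x hx => ⟨hx, Or.inl rfl⟩) (fun m => by
      filter_upwards [hz m (hopen _ (balancedCore_mem_nhds_zero (𝕜 := ℝ) (hB.mem m)))] with n hn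
      obtain ⟨x, hx, hxz⟩ := hn
      have h0 : w n ^ m ≠ 0 := (pow_pos (hw0 n) m).ne'
      refine ⟨(w n ^ m)⁻¹ • x, ?_, Or.inr ?_⟩
      · rw [map_smul, hxz, smul_smul, inv_mul_cancel₀ h0, one_smul]
      · rwa [smul_smul, mul_inv_cancel₀ h0, one_smul])
  choose x hxz hx using hP
  refine ⟨x, hxz, fun k => hB.tendsto_right_iff.2 fun i _ => ?_⟩
  filter_upwards [hm.eventually_ge_atTop (max (max k i) 1)] with n hn
  have h1 := (hx n).resolve_left (by omega)
  have h2 : (w n ^ k / w n ^ m n) • (w n ^ m n • x n) ∈ balancedCore ℝ (B (m n)) := by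
    refine (balancedCore_balanced (𝕜 := ℝ) (B (m n))).smul_mem ?_ h1
    have h3 := pow_pos (hw0 n) (m n)
    rw [Real.norm_of_nonneg (by have := pow_pos (hw0 n) k; positivity), div_le_one h3]
    exact pow_le_pow_right₀ (hw n) (by omega)
  rw [smul_smul, div_mul_cancel₀ _ (pow_pos (hw0 n) (m n)).ne'] at h2
  exact hB.antitone (by omega) (balancedCore_subset _ h2)

end

/-! ### Lifting series through closed linear relations -/

section

/-- Rapidly decreasing families in the range of a closed linear relation between complete
metrizable topological vector spaces lift to rapidly decreasing families, if the range is closed. -/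
theorem exists_rapid_lift_of_isClosed {X Z : Type*} [AddCommGroup X] [Module ℝ X]
    [UniformSpace X] [IsUniformAddGroup X] [ContinuousSMul ℝ X] [FirstCountableTopology X]
    [CompleteSpace X] [AddCommGroup Z] [Module ℝ Z]
    [UniformSpace Z] [IsUniformAddGroup Z] [ContinuousSMul ℝ Z] [(uniformity Z).IsCountablyGenerated]
    [CompleteSpace Z] [T2Space Z] {Γ : Submodule ℝ (X × Z)} (hΓ : IsClosed (Γ : Set (X × Z)))
    {S : Submodule ℝ Z} (hS : IsClosed (S : Set Z)) (hmem : ∀ p ∈ Γ, p.2 ∈ S)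
    (hsurj : ∀ z ∈ S, ∃ x, (x, z) ∈ Γ)
    {ι : Type*} [Countable ι] {w : ι → ℝ} (hw : ∀ n, 1 ≤ w n) {z : ι → Z} (hzS : ∀ n, z n ∈ S)
    (hz : ∀ k : ℕ, Tendsto (fun n => w n ^ k • z n) cofinite (𝓝 0)) :
    ∃ x : ι → X, (∀ n, (x n, z n) ∈ Γ) ∧
      ∀ k : ℕ, Tendsto (fun n => w n ^ k • x n) cofinite (𝓝 0) := by
  have : CompleteSpace Γ := hΓ.completeSpace_coe
  have : CompleteSpace S := hS.completeSpace_coe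
  have : (uniformity S).IsCountablyGenerated := by
    rw [uniformity_subtype]; infer_instance
  let _ := UniformSpace.pseudoMetricSpace S
  have : FirstCountableTopology Z := UniformSpace.firstCountableTopology Z
  have : FirstCountableTopology Γ := inferInstanceAs (FirstCountableTopology (Γ : Set (X × Z)))
  have : IsUniformAddGroup Γ := inferInstanceAs (IsUniformAddGroup Γ.toAddSubgroup)
  have : BaireSpace S := inferInstance
  -- The closed relation serves as the complete domain, so the open mapping theorem applies to its
  -- second projection and no continuous operator has to be given.
  let π : Γ →L[ℝ] S :=
    ((ContinuousLinearMap.snd ℝ X Z).comp Γ.subtypeL).codRestrict S fun p => hmem p.1 p.2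
  have hπ : Function.Surjective π := by
    rintro ⟨z, hz⟩
    obtain ⟨x, hx⟩ := hsurj z hz
    exact ⟨⟨(x, z), hx⟩, rfl⟩
  obtain ⟨x, hx, hx'⟩ := π.exists_rapid_lift hπ (fun U hU => π.isOpenMap_of_baireSpace hπ hU) hw
    (z := fun n => ⟨z n, hzS n⟩) (fun k => by
      rw [tendsto_subtype_rng]
      exact hz k)
  refine ⟨fun n => (x n).1.1, fun n => ?_, fun k => ?_⟩
  · have : (x n).1.2 = z n := congrArg Subtype.val (hx n)
    rw [← this]
    exact (x n).2
  · have h1 : Continuous fun p : Γ => p.1.1 := continuous_fst.comp continuous_subtype_val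
    exact (h1.tendsto' 0 0 rfl).comp (hx' k)

theorem summable_smul_of_rapid {ι A : Type*} [NormedAddCommGroup A] [NormedSpace ℝ A]
    [CompleteSpace A] {w : ι → ℝ} (hw : ∀ n, 1 ≤ w n) {K : ℕ} (hK : Summable fun n => (w n ^ K)⁻¹)
    {x : ι → A} (hx : Tendsto (fun n => w n ^ K • x n) cofinite (𝓝 0)) {g : ι → ℝ}
    (hg : ∀ n, |g n| ≤ 1) : Summable fun n => g n • x n := by
  refine Summable.of_norm_bounded_eventually hK ?_
  filter_upwards [Metric.tendsto_nhds.1 hx 1 one_pos] with n hn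
  have h0 : 0 < w n ^ K := pow_pos (one_pos.trans_le (hw n)) K
  rw [dist_zero_right, norm_smul, Real.norm_of_nonneg h0.le] at hn
  rw [norm_smul, ← one_div, le_div_iff₀ h0, mul_comm]
  calc w n ^ K * (‖g n‖ * ‖x n‖) = ‖g n‖ * (w n ^ K * ‖x n‖) := by ring
    _ ≤ 1 * 1 := mul_le_mul (hg n) hn.le (by positivity) zero_le_one
    _ = 1 := one_mul 1

/-- In a closed linear relation between countable products of Banach spaces, rapidly convergent
series in the range lift to rapidly convergent series. -/
theorem exists_series_lift {S I J : Type*} [Finite S] [Countable I] [Countable J]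
    {A : I → Type*} {B : J → Type*}
    [∀ i, NormedAddCommGroup (A i)] [∀ i, NormedSpace ℝ (A i)] [∀ i, CompleteSpace (A i)]
    [∀ i, NormedAddCommGroup (B i)] [∀ i, NormedSpace ℝ (B i)] [∀ i, CompleteSpace (B i)]
    {Γ : Submodule ℝ (((S → ℝ) × ∀ i, A i) × ∀ j, B j)}
    (hΓ : IsClosed (Γ : Set (((S → ℝ) × ∀ i, A i) × ∀ j, B j)))
    {C : Submodule ℝ (∀ j, B j)} (hC : IsClosed (C : Set (∀ j, B j))) (hmem : ∀ p ∈ Γ, p.2 ∈ C)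
    (hsurj : ∀ z ∈ C, ∃ x, (x, z) ∈ Γ)
    {ι : Type*} [Countable ι] {w : ι → ℝ} (hw : ∀ n, 1 ≤ w n) {K : ℕ}
    (hK : Summable fun n => (w n ^ K)⁻¹) {z : ι → ∀ j, B j} (hzC : ∀ n, z n ∈ C)
    (hz : ∀ (k : ℕ) (j : J), Tendsto (fun n => w n ^ k • z n j) cofinite (𝓝 0)) :
    ∃ (a : ι → S → ℝ) (x : ι → ∀ i, A i), (∀ n, ((a n, x n), z n) ∈ Γ) ∧
      (∀ (k : ℕ) (s : S), Tendsto (fun n => w n ^ k • a n s) cofinite (𝓝 0)) ∧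
      (∀ (k : ℕ) (i : I), Tendsto (fun n => w n ^ k • x n i) cofinite (𝓝 0)) ∧
      ∀ g : ι → ℝ, (∀ n, |g n| ≤ 1) → (((fun s => ∑' n, g n • a n s),
        (fun i => ∑' n, g n • x n i)), (fun j => ∑' n, g n • z n j)) ∈ Γ := by
  obtain ⟨x, hx, hx'⟩ := exists_rapid_lift_of_isClosed hΓ hC hmem hsurj hw hzC fun k =>
    tendsto_pi_nhds.2 (hz k)
  have ha : ∀ (k : ℕ) (s : S), Tendsto (fun n => w n ^ k • (x n).1 s) cofinite (𝓝 0) := fun k s =>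
    (((continuous_apply s).comp continuous_fst).tendsto' (0 : (S → ℝ) × ∀ i, A i) 0 rfl).comp (hx' k)
  have hb : ∀ (k : ℕ) (i : I), Tendsto (fun n => w n ^ k • (x n).2 i) cofinite (𝓝 0) := fun k i =>
    (((continuous_apply i).comp continuous_snd).tendsto' (0 : (S → ℝ) × ∀ i, A i) 0 rfl).comp (hx' k)
  refine ⟨fun n => (x n).1, fun n => (x n).2, hx, ha, hb, fun g hg => ?_⟩
  have h1 : HasSum (fun n => g n • (x n).1) (fun s => ∑' n, g n • (x n).1 s) :=
    Pi.hasSum.2 fun s => (summable_smul_of_rapid hw hK (ha K s) hg).hasSum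
  have h2 : HasSum (fun n => g n • (x n).2) (fun i => ∑' n, g n • (x n).2 i) :=
    Pi.hasSum.2 fun i => (summable_smul_of_rapid hw hK (hb K i) hg).hasSum
  have h3 : HasSum (fun n => g n • z n) (fun j => ∑' n, g n • z n j) :=
    Pi.hasSum.2 fun j => (summable_smul_of_rapid hw hK (hz K j) hg).hasSum
  -- Finite partial sums lie in the subspace `Γ`, and closedness passes to the limit.
  exact hΓ.mem_of_tendsto ((h1.prodMk h2).prodMk h3)
    (Eventually.of_forall fun s => Γ.sum_mem fun n _ => Γ.smul_mem (g n) (hx n))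

end

/-! ### Parameter integrals and decay of Fourier coefficients -/

section

namespace Foliation

open MeasureTheory

section ParametricIntegral

universe u

variable {X : Type*} [NormedAddCommGroup X] [NormedSpace ℝ X] [FiniteDimensional ℝ X]
  [MeasurableSpace X] [BorelSpace X] {μ : Measure X} [IsFiniteMeasureOnCompacts μ]
  {E' : Type u} [NormedAddCommGroup E'] [NormedSpace ℝ E']
  {V : Type u} [NormedAddCommGroup V] [NormedSpace ℝ V]

/-- The derivative with respect to the second variable. -/
def sndDeriv (f : X × E' → V) (p : X × E') : E' →L[ℝ] V :=
  (fderiv ℝ f p).comp (ContinuousLinearMap.inr ℝ X E')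

theorem contDiff_sndDeriv {f : X × E' → V} (hf : ContDiff ℝ ∞ f) : ContDiff ℝ ∞ (sndDeriv f) :=
  (hf.fderiv_right (by simp)).clm_comp contDiff_const

theorem hasCompactSupport_sndDeriv {f : X × E' → V} (hf : HasCompactSupport f) :
    HasCompactSupport (sndDeriv f) :=
  (hf.fderiv ℝ).comp_left (g := fun T : X × E' →L[ℝ] V => T.comp (ContinuousLinearMap.inr ℝ X E'))
    (ContinuousLinearMap.zero_comp _)

theorem exists_integrable_bound {f : X × E' → V} (hf : Continuous f) (hc : HasCompactSupport f) :
    ∃ b : X → ℝ, Integrable b μ ∧ ∀ x e, ‖f (x, e)‖ ≤ b x := by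
  obtain ⟨C, hC⟩ := hc.exists_bound_of_continuous hf
  have hK : IsCompact (Prod.fst '' tsupport f) := hc.image continuous_fst
  refine ⟨(Prod.fst '' tsupport f).indicator fun _ => C, ?_, fun x e => ?_⟩
  · exact (integrable_indicator_iff hK.measurableSet).2
      (integrableOn_const hK.measure_lt_top.ne)
  · by_cases hx : x ∈ Prod.fst '' tsupport f
    · rw [indicator_of_mem hx]
      exact hC _
    · rw [indicator_of_notMem hx, image_eq_zero_of_notMem_tsupport (f := f) (fun h => hx ⟨_, h, rfl⟩),
        norm_zero]

theorem integrable_smul_of_bound {g : X → ℝ} (hg : Continuous g) (hg1 : ∀ x, |g x| ≤ 1)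
    {f : X × E' → V} (hf : Continuous f) (hc : HasCompactSupport f) (e : E') :
    Integrable (fun x => g x • f (x, e)) μ := by
  obtain ⟨b, hb, hfb⟩ := exists_integrable_bound (μ := μ) hf hc
  refine hb.mono' (hg.smul (hf.comp (continuous_id.prodMk continuous_const))).aestronglyMeasurable
    (Eventually.of_forall fun x => ?_)
  rw [norm_smul]
  calc ‖g x‖ * ‖f (x, e)‖ ≤ 1 * ‖f (x, e)‖ := by gcongr; exact hg1 x
    _ ≤ b x := by rw [one_mul]; exact hfb x e

/-- The integral of a function of two variables against a function of the first variable. -/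
def paramInt (μ : Measure X) (g : X → ℝ) (f : X × E' → V) (e : E') : V := ∫ x, g x • f (x, e) ∂μ

theorem hasFDerivAt_paramInt {g : X → ℝ} (hg : Continuous g) (hg1 : ∀ x, |g x| ≤ 1)
    {f : X × E' → V} (hf : ContDiff ℝ ∞ f) (hc : HasCompactSupport f) (e : E') :
    HasFDerivAt (paramInt μ g f) (paramInt μ g (sndDeriv f) e) e := by
  have hf' := contDiff_sndDeriv hf
  obtain ⟨b, hb, hfb⟩ := exists_integrable_bound (μ := μ) hf'.continuous
    (hasCompactSupport_sndDeriv hc)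
  refine hasFDerivAt_integral_of_dominated_of_fderiv_le (s := univ) (bound := b)
    (F := fun e x => g x • f (x, e)) (F' := fun e x => g x • sndDeriv f (x, e)) univ_mem
    (Eventually.of_forall fun e => (integrable_smul_of_bound hg hg1 hf.continuous hc
      e).aestronglyMeasurable) (integrable_smul_of_bound hg hg1 hf.continuous hc e)
    (integrable_smul_of_bound hg hg1 hf'.continuous
      (hasCompactSupport_sndDeriv hc) e).aestronglyMeasurable
    (Eventually.of_forall fun x e _ => ?_) hb (Eventually.of_forall fun x e _ => ?_)
  · rw [norm_smul]
    calc ‖g x‖ * ‖sndDeriv f (x, e)‖ ≤ 1 * ‖sndDeriv f (x, e)‖ := by gcongr; exact hg1 x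
      _ ≤ b x := by rw [one_mul]; exact hfb x e
  · exact (HasFDerivAt.comp (g := f) e (hf.differentiable (by simp) (x, e)).hasFDerivAt
      (hasFDerivAt_prodMk_right x e)).const_smul (g x)

theorem fderiv_paramInt {g : X → ℝ} (hg : Continuous g) (hg1 : ∀ x, |g x| ≤ 1)
    {f : X × E' → V} (hf : ContDiff ℝ ∞ f) (hc : HasCompactSupport f) :
    fderiv ℝ (paramInt μ g f) = paramInt μ g (sndDeriv f) :=
  funext fun e => (hasFDerivAt_paramInt hg hg1 hf hc e).fderiv

/-- Differentiation under the integral replaces `f` by `sndDeriv f`, with values in `E' →L[ℝ] V`.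
The induction therefore varies `V`, and for this `E'` and `V` share a universe. -/
theorem contDiff_paramInt {g : X → ℝ} (hg : Continuous g) (hg1 : ∀ x, |g x| ≤ 1)
    {f : X × E' → V} (hf : ContDiff ℝ ∞ f) (hc : HasCompactSupport f) :
    ContDiff ℝ ∞ (paramInt μ g f) := by
  refine contDiff_infty.2 fun n => ?_
  induction n generalizing V with
  | zero =>
    exact contDiff_zero.2 (continuous_iff_continuousAt.2 fun e =>
      (hasFDerivAt_paramInt hg hg1 hf hc e).continuousAt)
  | succ n ih =>
    refine (contDiff_succ_iff_fderiv (n := n)).2 ⟨fun e =>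
      (hasFDerivAt_paramInt hg hg1 hf hc e).differentiableAt, by simp, ?_⟩
    rw [fderiv_paramInt hg hg1 hf hc]
    exact ih (contDiff_sndDeriv hf) (hasCompactSupport_sndDeriv hc)

/-- The point is that `C` is independent of `g`, hence uniform in frequency and phase. -/
theorem exists_norm_iteratedFDeriv_paramInt_le {f : X × E' → V} (hf : ContDiff ℝ ∞ f)
    (hc : HasCompactSupport f) (r : ℕ) : ∃ C : ℝ, ∀ g : X → ℝ, Continuous g → (∀ x, |g x| ≤ 1) →
      ∀ e, ‖iteratedFDeriv ℝ r (paramInt μ g f) e‖ ≤ C := by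
  induction r generalizing V with
  | zero =>
    obtain ⟨b, hb, hfb⟩ := exists_integrable_bound (μ := μ) hf.continuous hc
    refine ⟨∫ x, b x ∂μ, fun g hg hg1 e => ?_⟩
    rw [norm_iteratedFDeriv_zero]
    refine norm_integral_le_of_norm_le hb (Eventually.of_forall fun x => ?_)
    rw [norm_smul]
    calc ‖g x‖ * ‖f (x, e)‖ ≤ 1 * ‖f (x, e)‖ := by gcongr; exact hg1 x
      _ ≤ b x := by rw [one_mul]; exact hfb x e
  | succ r ih =>
    obtain ⟨C, hC⟩ := ih (contDiff_sndDeriv hf) (hasCompactSupport_sndDeriv hc)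
    refine ⟨C, fun g hg hg1 e => ?_⟩
    rw [← norm_iteratedFDeriv_fderiv, fderiv_paramInt hg hg1 hf hc]
    exact hC g hg hg1 e

end ParametricIntegral

section Trigonometric

universe u

/-- The trigonometric function with frequency `n` and phase `φ`. -/
def trig {d : ℕ} (n : Fin d → ℤ) (φ : ℝ) (x : Fin d → ℝ) : ℝ :=
  Real.cos (2 * Real.pi * ∑ i, n i * x i + φ)

theorem contDiff_trig {d : ℕ} (n : Fin d → ℤ) (φ : ℝ) : ContDiff ℝ ∞ (trig n φ) := by
  unfold trig
  fun_prop

theorem abs_trig_le {d : ℕ} (n : Fin d → ℤ) (φ : ℝ) (x : Fin d → ℝ) : |trig n φ x| ≤ 1 :=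
  Real.abs_cos_le_one _

theorem fderiv_trig {d : ℕ} (n : Fin d → ℤ) (φ : ℝ) (x : Fin d → ℝ) (i : Fin d) :
    fderiv ℝ (trig n φ) x (Pi.single i 1) =
      2 * Real.pi * n i * trig n (φ + Real.pi / 2) x := by
  have h1 : HasFDerivAt (fun x : Fin d → ℝ => 2 * Real.pi * ∑ i, (n i : ℝ) * x i + φ)
      ((2 * Real.pi) • ∑ i, (n i : ℝ) • ContinuousLinearMap.proj (R := ℝ) (φ := fun _ : Fin d => ℝ) i) x := by
    refine HasFDerivAt.add_const _ (HasFDerivAt.const_mul (HasFDerivAt.fun_sum fun i _ => ?_) _)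
    exact (hasFDerivAt_apply i x).const_mul _
  have h2 := (Real.hasDerivAt_cos _).comp_hasFDerivAt x h1
  have h3 : fderiv ℝ (trig n φ) x = _ := h2.fderiv
  rw [h3, trig, ← add_assoc, Real.cos_add_pi_div_two]
  simp [sum_apply, Pi.single_apply]
  ring

variable {d : ℕ} {E' : Type u} [NormedAddCommGroup E'] [NormedSpace ℝ E']
  {V : Type u} [NormedAddCommGroup V] [NormedSpace ℝ V]

/-- The partial derivative with respect to a coordinate of the first variable. -/
def fstPartial (i : Fin d) (f : (Fin d → ℝ) × E' → V) (p : (Fin d → ℝ) × E') : V :=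
  fderiv ℝ f p (Pi.single i 1, 0)

theorem contDiff_fstPartial (i : Fin d) {f : (Fin d → ℝ) × E' → V} (hf : ContDiff ℝ ∞ f) :
    ContDiff ℝ ∞ (fstPartial i f) :=
  (hf.fderiv_right (by simp)).clm_apply contDiff_const

theorem hasCompactSupport_fstPartial (i : Fin d) {f : (Fin d → ℝ) × E' → V}
    (hf : HasCompactSupport f) : HasCompactSupport (fstPartial i f) :=
  (hf.fderiv ℝ).comp_left (g := fun T : (Fin d → ℝ) × E' →L[ℝ] V => T (Pi.single i 1, 0))
    (zero_apply _)

/-- Integration by parts; compact support removes the boundary terms, and differentiating a cosine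
shifts its phase by a quarter turn. -/
theorem paramInt_fstPartial (n : Fin d → ℤ) (φ : ℝ) (i : Fin d) {f : (Fin d → ℝ) × E' → V}
    (hf : ContDiff ℝ ∞ f) (hc : HasCompactSupport f) (e : E') :
    paramInt volume (trig n φ) (fstPartial i f) e =
      -((2 * Real.pi * n i) • paramInt volume (trig n (φ + Real.pi / 2)) f e) := by
  have h1 : ∀ x, fderiv ℝ (fun x => f (x, e)) x (Pi.single i 1) = fstPartial i f (x, e) := by
    intro x
    have h0 : HasFDerivAt (fun x => f (x, e))
        ((fderiv ℝ f (x, e)).comp (ContinuousLinearMap.inl ℝ (Fin d → ℝ) E')) x :=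
      HasFDerivAt.comp (f := fun x : Fin d → ℝ => (x, e)) x
        (hf.differentiable (by simp) (x, e)).hasFDerivAt (hasFDerivAt_prodMk_left x e)
    have := h0.fderiv
    exact congrArg (fun T : (Fin d → ℝ) →L[ℝ] V => T (Pi.single i 1)) this
  have h2 := integral_smul_fderiv_eq_neg_fderiv_smul_of_integrable (μ := volume) (f := trig n φ)
    (g := fun x => f (x, e)) (v := Pi.single i 1) ?_ ?_ ?_ ?_ ?_
  · simp only [h1, fderiv_trig] at h2
    rw [paramInt, h2, paramInt, ← integral_smul]
    simp only [smul_smul]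
  · simp only [fderiv_trig, mul_smul _ (trig _ _ _)]
    exact (integrable_smul_of_bound (contDiff_trig n _).continuous (abs_trig_le n _)
      hf.continuous hc e).smul (2 * Real.pi * (n i : ℝ))
  · simp only [h1]
    exact integrable_smul_of_bound (contDiff_trig n _).continuous (abs_trig_le n _)
      (contDiff_fstPartial i hf).continuous (hasCompactSupport_fstPartial i hc) e
  · exact integrable_smul_of_bound (contDiff_trig n _).continuous (abs_trig_le n _)
      hf.continuous hc e
  · exact fun x _ => (contDiff_trig n φ).differentiable (by simp) x
  · exact fun x _ => (hf.comp (contDiff_id.prodMk contDiff_const)).differentiable (by simp) x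

/-- Every integration by parts in the `i`-th coordinate gains a factor `2π|n i|` and shifts the
phase, so the induction needs a bound uniform in the phase. -/
theorem exists_pow_mul_norm_le (i : Fin d) {f : (Fin d → ℝ) × E' → V}
    (hf : ContDiff ℝ ∞ f) (hc : HasCompactSupport f) (r k : ℕ) : ∃ C : ℝ, ∀ n φ e,
      |(n i : ℝ)| ^ k * ‖iteratedFDeriv ℝ r (paramInt volume (trig n φ) f) e‖ ≤ C := by
  induction k generalizing f with
  | zero =>
    obtain ⟨C, hC⟩ := exists_norm_iteratedFDeriv_paramInt_le (μ := volume) hf hc r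
    refine ⟨C, fun n φ e => ?_⟩
    rw [pow_zero, one_mul]
    exact hC _ (contDiff_trig n φ).continuous (abs_trig_le n φ) e
  | succ k ih =>
    obtain ⟨C, hC⟩ := ih (contDiff_fstPartial i hf) (hasCompactSupport_fstPartial i hc)
    refine ⟨C, fun n φ e => ?_⟩
    have h := hC n (φ - Real.pi / 2) e
    have h1 : paramInt volume (trig n (φ - Real.pi / 2)) (fstPartial i f) =
        (-(2 * Real.pi * n i)) • paramInt volume (trig n φ) f := by
      funext e
      rw [paramInt_fstPartial n _ i hf hc, sub_add_cancel, Pi.smul_apply, neg_smul]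
    rw [h1, iteratedFDeriv_const_smul_apply ((contDiff_paramInt (contDiff_trig n φ).continuous
      (abs_trig_le n φ) hf hc).of_le (by exact_mod_cast le_top)).contDiffAt, norm_smul] at h
    refine le_trans ?_ h
    rw [pow_succ, mul_assoc]
    gcongr
    rw [norm_neg, norm_mul, norm_mul]
    have := Real.two_le_pi
    have h2 : (1 : ℝ) ≤ ‖(2 : ℝ)‖ * ‖Real.pi‖ := by
      rw [Real.norm_of_nonneg zero_le_two, Real.norm_of_nonneg Real.pi_pos.le]
      linarith
    nlinarith [abs_nonneg (n i : ℝ), Real.norm_eq_abs (n i : ℝ)]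

/-- The weight on frequencies. -/
def freqWeight (n : Fin d → ℤ) : ℝ := 1 + ∑ i, |(n i : ℝ)|

theorem one_le_freqWeight (n : Fin d → ℤ) : 1 ≤ freqWeight n :=
  le_add_of_nonneg_right (Finset.sum_nonneg fun _ _ => abs_nonneg _)

theorem exists_freqWeight_pow_mul_norm_le {f : (Fin d → ℝ) × E' → V}
    (hf : ContDiff ℝ ∞ f) (hc : HasCompactSupport f) (r k : ℕ) : ∃ C : ℝ, ∀ n φ e,
      freqWeight n ^ k * ‖iteratedFDeriv ℝ r (paramInt volume (trig n φ) f) e‖ ≤ C := by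
  choose C hC using fun i => exists_pow_mul_norm_le (d := d) i hf hc r k
  obtain ⟨C0, hC0⟩ := exists_norm_iteratedFDeriv_paramInt_le
    (μ := (volume : Measure (Fin d → ℝ))) hf hc r
  refine ⟨(d + 1 : ℝ) ^ k * (C0 + ∑ i, C i), fun n φ e => ?_⟩
  set t := ‖iteratedFDeriv ℝ r (paramInt volume (trig n φ) f) e‖ with ht
  have h0 : t ≤ C0 := hC0 _ (contDiff_trig n φ).continuous (abs_trig_le n φ) e
  have hC' : ∀ i, 0 ≤ C i := fun i => (mul_nonneg (by positivity) (norm_nonneg _)).trans (hC i n φ e)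
  have ht0 : 0 ≤ t := norm_nonneg _
  -- The weight is at most `d + 1` if all `|n i| ≤ 1`; otherwise it is at most `d + 1` times the
  -- largest `|n i|`.
  have key : freqWeight n ^ k * t ≤ (d + 1 : ℝ) ^ k * (t + ∑ i, |(n i : ℝ)| ^ k * t) := by
    by_cases hn : ∀ i, |(n i : ℝ)| ≤ 1
    · have h1 : freqWeight n ≤ d + 1 := by
        have := Finset.sum_le_sum fun i (_ : i ∈ Finset.univ) => hn i
        simp at this
        rw [freqWeight]
        linarith
      have h2 : 0 ≤ ∑ i, |(n i : ℝ)| ^ k * t := Finset.sum_nonneg fun _ _ => by positivity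
      calc freqWeight n ^ k * t ≤ (d + 1 : ℝ) ^ k * t := by
            gcongr
            exact zero_le_one.trans (one_le_freqWeight n)
        _ ≤ _ := by gcongr; linarith
    · push Not at hn
      obtain ⟨i0, hi0⟩ := hn
      obtain ⟨i, -, hi⟩ := Finset.exists_max_image Finset.univ (fun i => |(n i : ℝ)|) ⟨i0, by simp⟩
      have h1 : freqWeight n ≤ (d + 1) * |(n i : ℝ)| := by
        have := Finset.sum_le_sum fun j (hj : j ∈ Finset.univ) => hi j hj
        simp at this
        rw [freqWeight]
        have := hi i0 (by simp)
        linarith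
      calc freqWeight n ^ k * t ≤ ((d + 1) * |(n i : ℝ)|) ^ k * t := by
            gcongr
            exact zero_le_one.trans (one_le_freqWeight n)
        _ = (d + 1 : ℝ) ^ k * (|(n i : ℝ)| ^ k * t) := by rw [mul_pow, mul_assoc]
        _ ≤ _ := by
          gcongr
          have := Finset.single_le_sum (f := fun i => |(n i : ℝ)| ^ k * t)
            (fun _ _ => by positivity) (Finset.mem_univ i)
          exact this.trans (le_add_of_nonneg_left ht0)
  refine key.trans ?_
  gcongr with i
  exact hC i n φ e

end Trigonometric

end Foliation

end

/-! ### Summability of the weights and smoothness of trigonometric series -/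

section

namespace Foliation

open MeasureTheory

theorem summable_int_weight : Summable fun m : ℤ => ((1 + |(m : ℝ)|) ^ 2)⁻¹ := by
  have h := (Real.summable_one_div_int_pow (p := 2)).2 one_lt_two
  refine Summable.of_norm_bounded_eventually h ?_
  filter_upwards [(finite_singleton (0 : ℤ)).compl_mem_cofinite] with m hm
  have hm' : (m : ℝ) ≠ 0 := by simpa using hm
  have h1 : 0 < |(m : ℝ)| := abs_pos.2 hm'
  rw [Real.norm_of_nonneg (by positivity), one_div, ← sq_abs (m : ℝ)]
  gcongr
  linarith

theorem summable_prod_weight (d : ℕ) :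
    Summable fun n : Fin d → ℤ => ∏ i, ((1 + |(n i : ℝ)|) ^ 2)⁻¹ := by
  induction d with
  | zero => exact Summable.of_finite
  | succ d ih =>
    rw [← (Fin.consEquiv fun _ : Fin (d + 1) => ℤ).summable_iff]
    refine (summable_int_weight.mul_of_nonneg ih (fun _ => by positivity)
      (fun _ => Finset.prod_nonneg fun _ _ => by positivity)).congr fun p => ?_
    simp [Fin.prod_univ_succ, Fin.consEquiv, mul_comm]

/-- The weight dominates each factor `1 + |n i|`, so its power `2 * d` dominates the product of
their squares, and the inverses of these are summable coordinate by coordinate. -/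
theorem summable_freqWeight (d : ℕ) :
    Summable fun n : Fin d → ℤ => (freqWeight n ^ (2 * d))⁻¹ := by
  refine (summable_prod_weight d).of_nonneg_of_le (fun n => ?_) fun n => ?_
  · have := one_le_freqWeight n
    positivity
  · rw [Finset.prod_inv_distrib]
    refine inv_anti₀ (Finset.prod_pos fun _ _ => by positivity) ?_
    calc ∏ i, (1 + |(n i : ℝ)|) ^ 2 ≤ ∏ _i : Fin d, freqWeight n ^ 2 := by
          refine Finset.prod_le_prod (fun _ _ => by positivity) fun i _ => ?_
          gcongr
          exact add_le_add_right (Finset.single_le_sum (f := fun i => |(n i : ℝ)|)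
            (fun _ _ => abs_nonneg _) (Finset.mem_univ i)) 1
      _ = freqWeight n ^ (2 * d) := by simp [pow_mul]

/-- The function is a shifted cosine, all of whose derivatives are bounded by one, composed with a
linear form of norm at most `2π` times the weight. -/
theorem norm_iteratedFDeriv_trig_le {d : ℕ} (n : Fin d → ℤ) (φ : ℝ) (k : ℕ) (x : Fin d → ℝ) :
    ‖iteratedFDeriv ℝ k (trig n φ) x‖ ≤ (2 * Real.pi * freqWeight n) ^ k := by
  let L : (Fin d → ℝ) →L[ℝ] ℝ := (2 * Real.pi) • ∑ i, (n i : ℝ) •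
    ContinuousLinearMap.proj (R := ℝ) (φ := fun _ : Fin d => ℝ) i
  have hL : ‖L‖ ≤ 2 * Real.pi * freqWeight n := by
    refine L.opNorm_le_bound (by have := one_le_freqWeight n; positivity) fun x => ?_
    have h1 : L x = 2 * Real.pi * ∑ i, (n i : ℝ) * x i := by simp [L, sum_apply]
    rw [h1, norm_mul, norm_mul, Real.norm_of_nonneg zero_le_two,
      Real.norm_of_nonneg Real.pi_pos.le, mul_assoc (2 * Real.pi)]
    gcongr
    calc ‖∑ i, (n i : ℝ) * x i‖ ≤ ∑ i, |(n i : ℝ)| * ‖x‖ := by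
          refine norm_sum_le_of_le _ fun i _ => ?_
          rw [norm_mul]
          gcongr
          · exact le_rfl
          · exact norm_le_pi_norm x i
      _ ≤ freqWeight n * ‖x‖ := by
          rw [← Finset.sum_mul, freqWeight]
          gcongr
          linarith
  have hcos : ContDiff ℝ ∞ fun s : ℝ => Real.cos (s + φ) := by fun_prop
  have h1 : trig n φ = (fun s : ℝ => Real.cos (s + φ)) ∘ L := by
    funext x
    simp [trig, L, sum_apply]
  rw [h1, L.iteratedFDeriv_comp_right hcos x (by exact_mod_cast le_top)]
  refine (ContinuousMultilinearMap.norm_compContinuousLinearMap_le _ _).trans ?_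
  rw [Finset.prod_const, Finset.card_univ, Fintype.card_fin, norm_iteratedFDeriv_eq_norm_iteratedDeriv,
    iteratedDeriv_comp_add_const]
  calc _ ≤ 1 * ‖L‖ ^ k := by gcongr; exact Real.abs_iteratedDeriv_cos_le_one k _
    _ ≤ _ := by rw [one_mul]; gcongr

section Series

variable {d : ℕ}

/-- The index set of the real trigonometric functions: cosines and sines. -/
abbrev Freq (d : ℕ) : Type := (Fin d → ℤ) ⊕ (Fin d → ℤ)

/-- The underlying frequency. -/
def Freq.vec (n : Freq d) : Fin d → ℤ := Sum.elim id id n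

/-- The underlying phase. -/
def Freq.phase (n : Freq d) : ℝ := Sum.elim (fun _ => 0) (fun _ => -(Real.pi / 2)) n

/-- The trigonometric function. -/
def Freq.wave (n : Freq d) (x : Fin d → ℝ) : ℝ := trig n.vec n.phase x

/-- The weight. -/
def Freq.weight (n : Freq d) : ℝ := freqWeight n.vec

theorem Freq.one_le_weight (n : Freq d) : 1 ≤ n.weight := one_le_freqWeight _

theorem Freq.abs_wave_le (n : Freq d) (x : Fin d → ℝ) : |n.wave x| ≤ 1 := abs_trig_le _ _ _

theorem Freq.contDiff_wave (n : Freq d) : ContDiff ℝ ∞ n.wave := contDiff_trig _ _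

theorem Freq.summable_weight (d : ℕ) : Summable fun n : Freq d => (n.weight ^ (2 * d))⁻¹ :=
  (HasSum.sum (f := fun n : Freq d => (n.weight ^ (2 * d))⁻¹)
    (h₁ := (summable_freqWeight d).hasSum) (h₂ := (summable_freqWeight d).hasSum)).summable

theorem Freq.tendsto_weight (d : ℕ) : Tendsto (fun n : Freq d => n.weight⁻¹) cofinite (𝓝 0) := by
  obtain rfl | hd := Nat.eq_zero_or_pos d
  · rw [Filter.cofinite_eq_bot]
    exact tendsto_bot
  have h := (Freq.summable_weight d).tendsto_cofinite_zero
  refine Metric.tendsto_nhds.2 fun ε hε => ?_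
  filter_upwards [Metric.tendsto_nhds.1 h (ε ^ (2 * d)) (by positivity)] with n hn
  have h0 := one_pos.trans_le n.one_le_weight
  rw [dist_zero_right, Real.norm_of_nonneg (by positivity)] at hn ⊢
  rw [← inv_pow] at hn
  exact lt_of_pow_lt_pow_left₀ _ hε.le hn

theorem Freq.norm_iteratedFDeriv_wave_le (n : Freq d) (k : ℕ) (x : Fin d → ℝ) :
    ‖iteratedFDeriv ℝ k n.wave x‖ ≤ (2 * Real.pi * n.weight) ^ k :=
  norm_iteratedFDeriv_trig_le _ _ _ _

/-- Trigonometric series with rapidly decreasing smooth coefficients are jointly smooth. -/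
theorem contDiff_tsum_wave {E' V : Type*} [NormedAddCommGroup E'] [NormedSpace ℝ E']
    [NormedAddCommGroup V] [NormedSpace ℝ V] [CompleteSpace V] {f : Freq d → E' → V}
    (hf : ∀ n, ContDiff ℝ ∞ (f n)) (hdecay : ∀ r k : ℕ, ∀ᶠ n : Freq d in cofinite, ∀ e,
      n.weight ^ k * ‖iteratedFDeriv ℝ r (f n) e‖ ≤ 1) :
    ContDiff ℝ ∞ fun p : (Fin d → ℝ) × E' => ∑' n : Freq d, n.wave p.1 • f n p.2 := by
  refine contDiff_tsum_of_eventually (N := (⊤ : ℕ∞)) (v := fun k n => (∑ i ∈ Finset.range (k + 1),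
    (k.choose i : ℝ) * (2 * Real.pi) ^ i) * (n.weight ^ (2 * d))⁻¹) (fun n => ?_) (fun k _ => ?_)
    fun k _ => ?_
  · exact (n.contDiff_wave.comp contDiff_fst).smul ((hf n).comp contDiff_snd)
  · exact (Freq.summable_weight d).mul_left _
  -- Of the exponent `k + 2 * d`, the part `k` pays for derivatives falling on the wave and `2 * d`
  -- for summability.
  · have h1 : ∀ᶠ n : Freq d in cofinite, ∀ r ∈ Finset.range (k + 1), ∀ e,
        n.weight ^ (k + 2 * d) * ‖iteratedFDeriv ℝ r (f n) e‖ ≤ 1 :=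
      (Finset.eventually_all _).2 fun r _ => hdecay r _
    filter_upwards [h1] with n hn p
    have h0 := one_pos.trans_le n.one_le_weight
    have hw : ContDiff ℝ ∞ (n.wave ∘ Prod.fst : (Fin d → ℝ) × E' → ℝ) :=
      n.contDiff_wave.comp contDiff_fst
    have hf' : ContDiff ℝ ∞ (f n ∘ Prod.snd : (Fin d → ℝ) × E' → V) := (hf n).comp contDiff_snd
    have hfst : ∀ i : ℕ, ‖iteratedFDeriv ℝ i (n.wave ∘ Prod.fst : (Fin d → ℝ) × E' → ℝ) p‖ ≤
        (2 * Real.pi * n.weight) ^ i := by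
      intro i
      have := (ContinuousLinearMap.fst ℝ (Fin d → ℝ) E').iteratedFDeriv_comp_right n.contDiff_wave p
        (i := i) (by exact_mod_cast le_top)
      refine (congrArg norm this).trans_le ?_
      refine (ContinuousMultilinearMap.norm_compContinuousLinearMap_le _ _).trans ?_
      refine (mul_le_of_le_one_right (norm_nonneg _) (Finset.prod_le_one (fun _ _ => norm_nonneg _)
        fun _ _ => ContinuousLinearMap.norm_fst_le ..)).trans (n.norm_iteratedFDeriv_wave_le i _)
    have hsnd : ∀ i : ℕ, ‖iteratedFDeriv ℝ i (f n ∘ Prod.snd : (Fin d → ℝ) × E' → V) p‖ ≤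
        ‖iteratedFDeriv ℝ i (f n) p.2‖ := by
      intro i
      have := (ContinuousLinearMap.snd ℝ (Fin d → ℝ) E').iteratedFDeriv_comp_right (hf n) p
        (i := i) (by exact_mod_cast le_top)
      refine (congrArg norm this).trans_le ?_
      refine (ContinuousMultilinearMap.norm_compContinuousLinearMap_le _ _).trans ?_
      exact mul_le_of_le_one_right (norm_nonneg _) (Finset.prod_le_one (fun _ _ => norm_nonneg _)
        fun _ _ => ContinuousLinearMap.norm_snd_le ..)
    refine (norm_iteratedFDeriv_smul_le hw hf' p (n := k) (by exact_mod_cast le_top)).trans ?_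
    rw [Finset.sum_mul]
    refine Finset.sum_le_sum fun i hi => ?_
    have hi' : i ≤ k := Nat.lt_succ_iff.1 (Finset.mem_range.1 hi)
    have h2 := hn (k - i) (Finset.mem_range.2 (by omega)) p.2
    rw [mul_assoc, mul_assoc (k.choose i : ℝ) ((2 * Real.pi) ^ i)]
    refine mul_le_mul_of_nonneg_left ?_ (Nat.cast_nonneg _)
    calc _ ≤ (2 * Real.pi * n.weight) ^ i * ‖iteratedFDeriv ℝ (k - i) (f n) p.2‖ := by
          exact mul_le_mul (hfst i) (hsnd _) (norm_nonneg _) (by positivity)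
      _ = (2 * Real.pi) ^ i * (n.weight ^ i * ‖iteratedFDeriv ℝ (k - i) (f n) p.2‖) := by
          rw [mul_pow, mul_assoc]
      _ ≤ (2 * Real.pi) ^ i * (n.weight ^ (2 * d))⁻¹ := by
          gcongr
          rw [← one_div, le_div_iff₀ (by positivity)]
          refine le_trans ?_ h2
          rw [mul_right_comm, ← pow_add]
          gcongr
          exact n.one_le_weight

end Series

end Foliation

end

/-! ### Fourier expansion of functions supported in a small cube -/

section

namespace Foliation

open MeasureTheory

variable {d : ℕ}

/-- The representative in `[-1/2, 1/2)` of a point of the circle. -/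
def circleRep (t : UnitAddCircle) : ℝ := (AddCircle.equivIco (1 : ℝ) (-(1 / 2)) t : ℝ)

theorem circleRep_coe {x : ℝ} (h1 : -(1 / 2) ≤ x) (h2 : x < 1 / 2) :
    circleRep (x : UnitAddCircle) = x := by
  rw [circleRep, AddCircle.equivIco_coe_eq (x := x) ⟨h1, by linarith⟩]

theorem coe_circleRep (t : UnitAddCircle) : (circleRep t : UnitAddCircle) = t :=
  AddCircle.coe_equivIco

theorem norm_le_abs_circleRep (t : UnitAddCircle) : ‖t‖ ≤ |circleRep t| := by
  conv_lhs => rw [← coe_circleRep t]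
  rw [UnitAddCircle.norm_eq]
  have := round_le (circleRep t) 0
  simpa using this

/-- The periodization of a continuous function with small support is continuous. -/
theorem continuous_periodize {h : (Fin d → ℝ) → ℝ} (hc : Continuous h)
    (hs : ∀ x, h x ≠ 0 → ∀ i, |x i| ≤ 1 / 4) :
    Continuous fun t : UnitAddTorus (Fin d) => h fun i => circleRep (t i) := by
  refine continuous_iff_continuousAt.2 fun t => ?_
  -- `circleRep` jumps only at the class of `-1/2`. Near a point with such a coordinate the norm of
  -- that coordinate exceeds `1/4`, so the periodized function is locally zero.
  by_cases ht : ∀ i, t i ≠ ((-(1 / 2) : ℝ) : UnitAddCircle)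
  · refine hc.continuousAt.comp (continuousAt_pi.2 fun i => ?_)
    have h1 : ContinuousAt circleRep (t i) :=
      continuousAt_subtype_val.comp (AddCircle.continuousAt_equivIco (1 : ℝ) (-(1 / 2)) (ht i))
    exact ContinuousAt.comp (f := fun t : UnitAddTorus (Fin d) => t i) h1
      (continuous_apply i).continuousAt
  · push Not at ht
    obtain ⟨i, hi⟩ := ht
    have h1 : ‖t i‖ = 1 / 2 := by
      rw [hi, AddCircle.coe_neg, norm_neg, UnitAddCircle.norm_eq]
      norm_num [round_two_inv]
    have h2 : ∀ᶠ s : UnitAddTorus (Fin d) in 𝓝 t, 1 / 4 < ‖s i‖ :=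
      (continuous_apply i).norm.continuousAt.eventually_const_lt (by
        change 1 / 4 < ‖t i‖
        rw [h1]; norm_num)
    refine (continuousAt_const (y := (0 : ℝ))).congr (h2.mono fun s hs' => ?_)
    by_contra h3
    have := hs _ (Ne.symm h3) i
    have := norm_le_abs_circleRep (s i)
    linarith

theorem mFourier_coe (n : Fin d → ℤ) (x : Fin d → ℝ) :
    UnitAddTorus.mFourier n (fun i => (x i : UnitAddCircle)) =
      trig n 0 x + trig n (-(Real.pi / 2)) x * Complex.I := by
  have h1 : trig n (-(Real.pi / 2)) x = Real.sin (2 * Real.pi * ∑ i, n i * x i) := by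
    rw [trig, ← sub_eq_add_neg, Real.cos_sub_pi_div_two]
  rw [h1, trig, add_zero, Complex.ofReal_cos, Complex.ofReal_sin, ← Complex.exp_mul_I]
  simp only [UnitAddTorus.mFourier, ContinuousMap.coe_mk, fourier_coe_apply]
  rw [← Complex.exp_sum]
  congr 1
  push_cast
  rw [Finset.mul_sum, Finset.sum_mul]
  exact Finset.sum_congr rfl fun i _ => by ring

theorem trig_neg_zero (n : Fin d → ℤ) (x : Fin d → ℝ) : trig (-n) 0 x = trig n 0 x := by
  simp only [trig, Pi.neg_apply, Int.cast_neg, neg_mul, Finset.sum_neg_distrib, mul_neg, add_zero,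
    Real.cos_neg]

theorem trig_neg_phase (n : Fin d → ℤ) (x : Fin d → ℝ) :
    trig (-n) (-(Real.pi / 2)) x = -trig n (-(Real.pi / 2)) x := by
  simp only [trig, Pi.neg_apply, Int.cast_neg, neg_mul, Finset.sum_neg_distrib, mul_neg,
    ← sub_eq_add_neg, Real.cos_sub_pi_div_two, Real.sin_neg]

/-- The Fourier expansion of a function with small support, in real form. -/
theorem hasSum_trig {h : (Fin d → ℝ) → ℝ} (hc : Continuous h)
    (hs : ∀ x, h x ≠ 0 → ∀ i, |x i| ≤ 1 / 4)
    (h1 : Summable fun n : Fin d → ℤ => ∫ t, trig n 0 t * h t)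
    (h2 : Summable fun n : Fin d → ℤ => ∫ t, trig n (-(Real.pi / 2)) t * h t)
    {x : Fin d → ℝ} (hx : ∀ i, |x i| < 1 / 2) :
    HasSum (fun n : Fin d → ℤ => trig n 0 x * (∫ t, trig n 0 t * h t) +
      trig n (-(Real.pi / 2)) x * ∫ t, trig n (-(Real.pi / 2)) t * h t) (h x) := by
  have hcs : HasCompactSupport h := by
    refine HasCompactSupport.intro (isCompact_closedBall (0 : Fin d → ℝ) (1 / 4)) fun x hx => ?_
    by_contra h0
    refine hx (mem_closedBall_zero_iff.2 ((pi_norm_le_iff_of_nonneg (by norm_num)).2 fun i => ?_))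
    exact hs x h0 i
  have hintegrable : ∀ (n : Fin d → ℤ) (φ : ℝ), Integrable fun t => trig n φ t * h t := fun n φ =>
    ((contDiff_trig n φ).continuous.mul hc).integrable_of_hasCompactSupport hcs.mul_left
  let f : C(UnitAddTorus (Fin d), ℂ) :=
    ⟨fun t => (h fun i => circleRep (t i) : ℝ), Complex.continuous_ofReal.comp
      (continuous_periodize hc hs)⟩
  have hf : ∀ x : Fin d → ℝ, (∀ i, x i ∈ Ioc (-(1 / 2) : ℝ) (-(1 / 2) + 1)) →
      f (fun i => (x i : UnitAddCircle)) = h x := by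
    intro x hx
    change ((h fun i => circleRep (x i) : ℝ) : ℂ) = h x
    congr 1
    -- The coefficients are integrals over `(-1/2, 1/2]`, while `circleRep` takes values in `[-1/2,
    -- 1/2)`. The two conventions differ only where some `x i = 1/2`, and there both sides vanish.
    by_cases hx1 : ∀ i, x i < 1 / 2
    · congr 1
      funext i
      exact circleRep_coe (hx i).1.le (hx1 i)
    · push Not at hx1
      obtain ⟨i, hi⟩ := hx1
      have hi' : x i = 1 / 2 := le_antisymm (by have := (hx i).2; linarith) hi
      have e1 : h x = 0 := by
        by_contra h0
        have := hs x h0 i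
        rw [hi', abs_of_pos (by norm_num)] at this
        norm_num at this
      rw [e1]
      by_contra h0
      have h3 := hs _ h0 i
      have h4 := norm_le_abs_circleRep (x i)
      have h5 : ‖(x i : UnitAddCircle)‖ = 1 / 2 := by
        rw [hi', UnitAddCircle.norm_eq]
        norm_num [round_two_inv]
      linarith
  have hcoef : ∀ n, UnitAddTorus.mFourierCoeff f n = ((∫ t, trig n 0 t * h t : ℝ) : ℂ) -
      ((∫ t, trig n (-(Real.pi / 2)) t * h t : ℝ) : ℂ) * Complex.I := by
    intro n
    rw [UnitAddTorus.mFourierCoeff_eq_integral f n (fun _ => -(1 / 2))]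
    have e1 : ∫ (x : Fin d → ℝ) in {x : Fin d → ℝ | ∀ i, x i ∈ Ioc (-(1 / 2) : ℝ) (-(1 / 2) + 1)},
        UnitAddTorus.mFourier (-n) (fun i => (x i : UnitAddCircle)) •
          f (fun i => (x i : UnitAddCircle)) =
        ∫ (x : Fin d → ℝ) in {x : Fin d → ℝ | ∀ i, x i ∈ Ioc (-(1 / 2) : ℝ) (-(1 / 2) + 1)},
        (((trig n 0 x * h x : ℝ) : ℂ) - ((trig n (-(Real.pi / 2)) x * h x : ℝ) : ℂ) * Complex.I) := by
      refine setIntegral_congr_fun ?_ fun x hx => ?_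
      · have : {x : Fin d → ℝ | ∀ i, x i ∈ Ioc (-(1 / 2) : ℝ) (-(1 / 2) + 1)} =
            Set.pi univ fun _ => Ioc (-(1 / 2) : ℝ) (-(1 / 2) + 1) := by ext; simp
        rw [this]
        exact MeasurableSet.univ_pi fun _ => measurableSet_Ioc
      · rw [hf x hx, mFourier_coe, trig_neg_zero, trig_neg_phase, smul_eq_mul]
        push_cast
        ring
    rw [e1, setIntegral_eq_integral_of_forall_compl_eq_zero]
    · rw [integral_sub (hintegrable n 0).ofReal ((hintegrable n _).ofReal.mul_const _), integral_mul_const,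
        integral_complex_ofReal, integral_complex_ofReal]
    · intro x hx
      have : h x = 0 := by
        by_contra h0
        apply hx
        intro i
        have := abs_le.1 (hs x h0 i)
        constructor <;> linarith
      simp [this]
  have hsum : Summable (UnitAddTorus.mFourierCoeff f) := by
    rw [show UnitAddTorus.mFourierCoeff f = _ from funext hcoef]
    exact (Complex.ofRealCLM.summable h1).sub ((Complex.ofRealCLM.summable h2).mul_right _)
  have key := UnitAddTorus.hasSum_mFourier_series_apply_of_summable hsum
    (fun i => (x i : UnitAddCircle))
  rw [hf x fun i => by have := abs_lt.1 (hx i); constructor <;> linarith] at key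
  -- With `A`, `B` the cosine and sine integrals, a complex term is `(A - iB)(cos + i sin)`; its
  -- real part is the stated one.
  have key' := Complex.hasSum_re key
  rw [Complex.ofReal_re] at key'
  refine key'.congr_fun fun n => ?_
  rw [hcoef, mFourier_coe]
  simp [mul_comm]

theorem Freq.wave_inl (n : Fin d → ℤ) : Freq.wave (Sum.inl n) = trig n 0 := rfl

theorem Freq.wave_inr (n : Fin d → ℤ) : Freq.wave (Sum.inr n) = trig n (-(Real.pi / 2)) := rfl

/-- The Fourier expansion of a function with small support. -/
theorem hasSum_wave {h : (Fin d → ℝ) → ℝ} (hc : Continuous h)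
    (hs : ∀ x, h x ≠ 0 → ∀ i, |x i| ≤ 1 / 4)
    (hsum : Summable fun n : Freq d => ∫ t, n.wave t * h t)
    {x : Fin d → ℝ} (hx : ∀ i, |x i| < 1 / 2) :
    HasSum (fun n : Freq d => n.wave x * ∫ t, n.wave t * h t) (h x) := by
  have h1 : Summable fun n : Fin d → ℤ => ∫ t, trig n 0 t * h t := by
    have := hsum.comp_injective (i := Sum.inl) Sum.inl_injective
    simpa only [Function.comp_def, Freq.wave_inl] using this
  have h2 : Summable fun n : Fin d → ℤ => ∫ t, trig n (-(Real.pi / 2)) t * h t := by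
    have := hsum.comp_injective (i := Sum.inr) Sum.inr_injective
    simpa only [Function.comp_def, Freq.wave_inr] using this
  have key := hasSum_trig hc hs h1 h2 hx
  have h3 : Summable fun n : Fin d → ℤ => trig n 0 x * ∫ t, trig n 0 t * h t :=
    Summable.of_norm_bounded h1.norm fun n => by
      rw [norm_mul]
      exact mul_le_of_le_one_left (norm_nonneg _) (abs_trig_le n 0 x)
  have h4 : Summable fun n : Fin d → ℤ => trig n (-(Real.pi / 2)) x *
      ∫ t, trig n (-(Real.pi / 2)) t * h t :=
    Summable.of_norm_bounded h2.norm fun n => by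
      rw [norm_mul]
      exact mul_le_of_le_one_left (norm_nonneg _) (abs_trig_le n _ x)
  rw [key.unique (h3.hasSum.add h4.hasSum)]
  refine HasSum.sum ?_ ?_
  · simpa only [Function.comp_def, Freq.wave_inl] using h3.hasSum
  · simpa only [Function.comp_def, Freq.wave_inr] using h4.hasSum

end Foliation

end

/-! ### Jets of leafwise forms: the Fréchet structure -/

section

namespace Foliation

section Limits

open scoped BoundedContinuousFunction

variable {E V : Type*} [NormedAddCommGroup E] [NormedSpace ℝ E] [NormedAddCommGroup V]
  [NormedSpace ℝ V]

/-- The space of bounded continuous functions with values in the `r`-multilinear maps. -/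
def JetSpace (E V : Type*) [NormedAddCommGroup E] [NormedSpace ℝ E] [NormedAddCommGroup V]
    [NormedSpace ℝ V] (r : ℕ) : Type _ := E →ᵇ (E [×r]→L[ℝ] V)

namespace JetSpace

variable {r : ℕ}

instance : NormedAddCommGroup (JetSpace E V r) :=
  inferInstanceAs (NormedAddCommGroup (E →ᵇ (E [×r]→L[ℝ] V)))

instance : NormedSpace ℝ (JetSpace E V r) :=
  inferInstanceAs (NormedSpace ℝ (E →ᵇ (E [×r]→L[ℝ] V)))

instance [CompleteSpace V] : CompleteSpace (JetSpace E V r) :=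
  inferInstanceAs (CompleteSpace (E →ᵇ (E [×r]→L[ℝ] V)))

instance : FunLike (JetSpace E V r) E (E [×r]→L[ℝ] V) :=
  inferInstanceAs (FunLike (E →ᵇ (E [×r]→L[ℝ] V)) E (E [×r]→L[ℝ] V))

/-- The bounded continuous function given by a continuous function and a bound. -/
def mk {f : E → E [×r]→L[ℝ] V} (hf : Continuous f) {C : ℝ} (hC : ∀ e, ‖f e‖ ≤ C) :
    JetSpace E V r := BoundedContinuousFunction.ofNormedAddCommGroup f hf C hC

theorem ext {a b : JetSpace E V r} (h : ∀ e, a e = b e) : a = b := BoundedContinuousFunction.ext h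

theorem add_apply (a b : JetSpace E V r) (e : E) : (a + b) e = a e + b e := rfl

theorem smul_apply (c : ℝ) (a : JetSpace E V r) (e : E) : (c • a) e = c • a e := rfl

theorem continuous (a : JetSpace E V r) : Continuous a := BoundedContinuousFunction.continuous a

theorem norm_le {a : JetSpace E V r} {C : ℝ} (hC : 0 ≤ C) : ‖a‖ ≤ C ↔ ∀ e, ‖a e‖ ≤ C :=
  BoundedContinuousFunction.norm_le hC

theorem tendstoUniformly {ι : Type*} {l : Filter ι} {a : ι → JetSpace E V r} {b : JetSpace E V r}
    (h : Tendsto a l (𝓝 b)) : TendstoUniformly (fun n => a n) b l :=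
  BoundedContinuousFunction.tendsto_iff_tendstoUniformly.1 h

/-- The evaluation at a point. -/
def evalCLM (e : E) : JetSpace E V r →L[ℝ] E [×r]→L[ℝ] V :=
  BoundedContinuousFunction.evalCLM ℝ e

end JetSpace

/-- The product of a smooth function with a function which is smooth on its support is smooth. -/
theorem contDiff_smul_of_tsupport {b : E → ℝ} (hb : ContDiff ℝ ∞ b) {f : E → V}
    (hf : ∀ x ∈ tsupport b, ContDiffAt ℝ ∞ f x) : ContDiff ℝ ∞ fun x => b x • f x := by
  refine contDiff_iff_contDiffAt.2 fun x => ?_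
  by_cases hx : x ∈ tsupport b
  · exact hb.contDiffAt.smul (hf x hx)
  · refine contDiffAt_const (c := (0 : V)) |>.congr_of_eventuallyEq ?_
    filter_upwards [(isClosed_tsupport b).isOpen_compl.mem_nhds hx] with y hy
    rw [image_eq_zero_of_notMem_tsupport hy, zero_smul]

/-- A function which is the limit of smooth functions, uniformly with all derivatives, is smooth. -/
theorem hasFTaylorSeriesUpTo_of_tendsto {ι : Type*} {l : Filter ι} [l.NeBot] {f : ι → E → V}
    (hf : ∀ n, ContDiff ℝ ∞ (f n)) {a : ∀ r : ℕ, JetSpace E V r}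
    (ha : ∀ r, TendstoUniformly (fun n => iteratedFDeriv ℝ r (f n)) (a r) l) :
    HasFTaylorSeriesUpTo ∞ (fun x => (a 0 x).curry0) (fun x r => a r x) where
  zero_eq _ := rfl
  fderiv r hr x := by
    refine hasFDerivAt_of_tendstoUniformly (f := fun n => iteratedFDeriv ℝ r (f n))
      (f' := fun n x => (iteratedFDeriv ℝ (r + 1) (f n) x).curryLeft) (l := l)
      (g' := fun x => (a (r + 1) x).curryLeft) ?_ ?_ (fun x => (ha r).tendsto_at x) x
    · exact (continuousMultilinearCurryLeftEquiv ℝ (fun _ : Fin (r + 1) => E)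
        V).isometry.uniformContinuous.comp_tendstoUniformly (ha (r + 1))
    · intro n x
      exact (((hf n).differentiable_iteratedFDeriv (m := r) (by
        exact_mod_cast ENat.natCast_lt_top r)) x).hasFDerivAt
  cont r _ := (a r).continuous

end Limits

variable {E H : Type*} [NormedAddCommGroup E] [NormedSpace ℝ E] [FiniteDimensional ℝ E]
  [TopologicalSpace H] {I : ModelWithCorners ℝ E H} [I.Boundaryless]
  {M : Type*} [TopologicalSpace M] [ChartedSpace H M] [IsManifold I ∞ M] [T2Space M]

/-- A foliated chart together with a compactly supported smooth function on its target. -/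
structure Cutoff (F : Foliation I M) where
  /-- the chart -/
  chart : F.FoliatedChart
  /-- the function -/
  fn : E → ℝ
  smooth : ContDiff ℝ ∞ fn
  compact : HasCompactSupport fn
  tsupport_subset : tsupport fn ⊆ chart.ext.target

namespace Cutoff

variable {F : Foliation I M} {q : ℕ}

/-- The points around which the function of a cutoff is equal to one. -/
def core (κ : F.Cutoff) : Set M :=
  {x | x ∈ κ.chart.chart.source ∧ κ.fn =ᶠ[𝓝 (κ.chart.ext x)] 1}

theorem core_mem_nhds (κ : F.Cutoff) {x : M} (hx : x ∈ κ.core) : κ.core ∈ 𝓝 x := by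
  have h1 : ContinuousAt κ.chart.ext x := (κ.chart.contMDiffAt_ext hx.1).continuousAt
  filter_upwards [κ.chart.isOpen_source.mem_nhds hx.1,
    h1.eventually (eventually_eventually_nhds.2 hx.2)] with y h2 h3
  exact ⟨h2, h3⟩

theorem exists_mem_core (F : Foliation I M) (x : M) : ∃ κ : F.Cutoff, x ∈ κ.core := by
  obtain ⟨c, hx⟩ := F.exists_foliatedChart_at x
  obtain ⟨ε, hε, hsub⟩ := Metric.nhds_basis_closedBall.mem_iff.1
    (c.isOpen_target.mem_nhds (c.ext_mem hx))
  let b : ContDiffBump (c.ext x) := ⟨ε / 2, ε, by positivity, by linarith⟩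
  refine ⟨⟨c, b, b.contDiff, b.hasCompactSupport, ?_⟩, hx, b.eventuallyEq_one⟩
  rw [b.tsupport_eq]
  exact hsub

/-- Countability of the cover makes the product of all jet spaces metrizable, as the open mapping
argument requires. -/
theorem exists_countable_cover (F : Foliation I M) [SecondCountableTopology M] :
    ∃ S : Set F.Cutoff, S.Countable ∧ ∀ x, ∃ κ ∈ S, x ∈ κ.core := by
  choose κ hκ using exists_mem_core F
  obtain ⟨s, hs, hcov⟩ := TopologicalSpace.countable_cover_nhds fun x => (κ x).core_mem_nhds (hκ x)
  refine ⟨κ '' s, hs.image κ, fun x => ?_⟩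
  have : x ∈ ⋃ x ∈ s, (κ x).core := hcov ▸ mem_univ x
  obtain ⟨y, hy, hx⟩ := mem_iUnion₂.1 this
  exact ⟨κ y, mem_image_of_mem κ hy, hx⟩

/-- A leafwise form in coordinates, cut off. -/
def loc (κ : F.Cutoff) (α : ∀ x, (F.tangent x) [⋀^Fin q]→ₗ[ℝ] ℝ) (e : E) : E [⋀^Fin q]→L[ℝ] ℝ :=
  κ.fn e • κ.chart.rep α e

theorem loc_apply (κ : F.Cutoff) (α : ∀ x, (F.tangent x) [⋀^Fin q]→ₗ[ℝ] ℝ) (e : E)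
    (v : Fin q → E) : κ.loc α e v =
      κ.fn e * α (κ.chart.ext.symm e) (fun i => κ.chart.frame (κ.chart.ext.symm e) (v i)) := rfl

theorem contDiff_loc (κ : F.Cutoff) {α : ∀ x, (F.tangent x) [⋀^Fin q]→ₗ[ℝ] ℝ}
    (hα : α ∈ F.formSubmodule q) : ContDiff ℝ ∞ (κ.loc α) :=
  contDiff_smul_of_tsupport κ.smooth fun _ he =>
    κ.chart.contDiffAt_rep hα (κ.tsupport_subset he)

theorem hasCompactSupport_loc (κ : F.Cutoff) (α : ∀ x, (F.tangent x) [⋀^Fin q]→ₗ[ℝ] ℝ) :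
    HasCompactSupport (κ.loc α) := κ.compact.smul_right

theorem loc_eventuallyEq (κ : F.Cutoff) (α : ∀ x, (F.tangent x) [⋀^Fin q]→ₗ[ℝ] ℝ) {x : M}
    (hx : x ∈ κ.core) : κ.loc α =ᶠ[𝓝 (κ.chart.ext x)] κ.chart.rep α :=
  hx.2.mono fun e he => by rw [loc, he, Pi.one_apply, one_smul]

theorem loc_coframe (κ : F.Cutoff) (α : ∀ x, (F.tangent x) [⋀^Fin q]→ₗ[ℝ] ℝ) {x : M}
    (hx : x ∈ κ.core) (v : Fin q → F.tangent x) :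
    κ.loc α (κ.chart.ext x) (fun i => κ.chart.coframe x (v i)) = α x v := by
  rw [(κ.loc_eventuallyEq α hx).eq_of_nhds, κ.chart.rep_coframe α hx.1]

theorem d_eq_extDeriv_loc (κ : F.Cutoff) (α : F.Form q) {x : M}
    (hx : x ∈ κ.core) (v : Fin (q + 1) → F.tangent x) :
    (F.d q α).1 x v =
      extDeriv (κ.loc α.1) (κ.chart.ext x) (fun i => κ.chart.coframe x (v i)) := by
  rw [(κ.loc_eventuallyEq α.1 hx).extDeriv_eq, d_apply α κ.chart hx.1]

theorem exists_iteratedFDeriv_loc_le (κ : F.Cutoff) (r : ℕ) (α : F.Form q) :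
    ∃ C, ∀ e, ‖iteratedFDeriv ℝ r (κ.loc α.1) e‖ ≤ C :=
  ((κ.hasCompactSupport_loc α.1).iteratedFDeriv (𝕜 := ℝ) r).exists_bound_of_continuous
    ((κ.contDiff_loc α.2).continuous_iteratedFDeriv (by exact_mod_cast le_top))

/-- The derivatives of a leafwise form in coordinates, cut off. -/
def jet (κ : F.Cutoff) (r : ℕ) : F.Form q →ₗ[ℝ] JetSpace E (E [⋀^Fin q]→L[ℝ] ℝ) r where
  toFun α := JetSpace.mk ((κ.contDiff_loc α.2).continuous_iteratedFDeriv (by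
    exact_mod_cast le_top)) (κ.exists_iteratedFDeriv_loc_le r α).choose_spec
  map_add' α β := by
    refine JetSpace.ext fun e => ?_
    have h1 : κ.loc (α + β).1 = κ.loc α.1 + κ.loc β.1 := by
      funext e
      exact smul_add (κ.fn e) (κ.chart.rep α.1 e) (κ.chart.rep β.1 e)
    change iteratedFDeriv ℝ r (κ.loc (α + β).1) e = _
    rw [h1, iteratedFDeriv_add_apply]
    · rfl
    · exact ((κ.contDiff_loc α.2).of_le (by exact_mod_cast le_top)).contDiffAt
    · exact ((κ.contDiff_loc β.2).of_le (by exact_mod_cast le_top)).contDiffAt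
  map_smul' s α := by
    refine JetSpace.ext fun e => ?_
    have h1 : κ.loc (s • α).1 = s • κ.loc α.1 := by
      funext e
      exact smul_comm (κ.fn e) s (κ.chart.rep α.1 e)
    change iteratedFDeriv ℝ r (κ.loc (s • α).1) e = _
    rw [h1, iteratedFDeriv_const_smul_apply]
    · rfl
    · exact ((κ.contDiff_loc α.2).of_le (by exact_mod_cast le_top)).contDiffAt

theorem jet_apply (κ : F.Cutoff) (r : ℕ) (α : F.Form q) (e : E) :
    κ.jet r α e = iteratedFDeriv ℝ r (κ.loc α.1) e := rfl

/-- The value of a form as a function of its jet. -/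
def evalJet (κ : F.Cutoff) {x : M} (v : Fin q → F.tangent x) :
    JetSpace E (E [⋀^Fin q]→L[ℝ] ℝ) 0 →L[ℝ] ℝ :=
  (ContinuousAlternatingMap.apply ℝ E ℝ (fun i => κ.chart.coframe x (v i))).comp
    ((continuousMultilinearCurryFin0 ℝ E (E [⋀^Fin q]→L[ℝ] ℝ)).toContinuousLinearEquiv.toContinuousLinearMap.comp
      (JetSpace.evalCLM (κ.chart.ext x)))

theorem evalJet_jet (κ : F.Cutoff) (α : F.Form q) {x : M} (hx : x ∈ κ.core)
    (v : Fin q → F.tangent x) : κ.evalJet v (κ.jet 0 α) = α.1 x v :=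
  κ.loc_coframe α.1 hx v

theorem tendsto_apply_of_jet (κ : F.Cutoff) {ι : Type*} {l : Filter ι} {α : ι → F.Form q}
    {β : F.Form q} (h : Tendsto (fun n => κ.jet 0 (α n)) l (𝓝 (κ.jet 0 β))) {x : M}
    (hx : x ∈ κ.core) (v : Fin q → F.tangent x) :
    Tendsto (fun n => (α n).1 x v) l (𝓝 (β.1 x v)) := by
  have := ((κ.evalJet v).continuous.tendsto _).comp h
  rw [κ.evalJet_jet β hx] at this
  exact this.congr fun n => κ.evalJet_jet (α n) hx v

/-- On the core of a cutoff the derivative at a point is a continuous linear function `Λ` of the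
first-order jet. -/
theorem tendsto_d_apply_of_jet (κ : F.Cutoff) {ι : Type*} {l : Filter ι} {α : ι → F.Form q}
    {β : F.Form q} (h : Tendsto (fun n => κ.jet 1 (α n)) l (𝓝 (κ.jet 1 β))) {x : M}
    (hx : x ∈ κ.core) (v : Fin (q + 1) → F.tangent x) :
    Tendsto (fun n => (F.d q (α n)).1 x v) l (𝓝 ((F.d q β).1 x v)) := by
  let Λ : JetSpace E (E [⋀^Fin q]→L[ℝ] ℝ) 1 →L[ℝ] ℝ :=
    (ContinuousAlternatingMap.apply ℝ E ℝ (fun i => κ.chart.coframe x (v i))).comp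
    ((ContinuousAlternatingMap.alternatizeUncurryFinCLM ℝ E ℝ).comp
    ((continuousMultilinearCurryFin1 ℝ E
      (E [⋀^Fin q]→L[ℝ] ℝ)).toContinuousLinearEquiv.toContinuousLinearMap.comp
      (JetSpace.evalCLM (κ.chart.ext x))))
  have key : ∀ α : F.Form q, Λ (κ.jet 1 α) = (F.d q α).1 x v := by
    intro α
    rw [κ.d_eq_extDeriv_loc α hx]
    have : continuousMultilinearCurryFin1 ℝ E (E [⋀^Fin q]→L[ℝ] ℝ)
        (iteratedFDeriv ℝ 1 (κ.loc α.1) (κ.chart.ext x)) = fderiv ℝ (κ.loc α.1) (κ.chart.ext x) := by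
      ext1 w
      rw [continuousMultilinearCurryFin1_apply, iteratedFDeriv_one_apply]
      rfl
    change ContinuousAlternatingMap.alternatizeUncurryFin (continuousMultilinearCurryFin1 ℝ E _
      (iteratedFDeriv ℝ 1 (κ.loc α.1) (κ.chart.ext x))) _ = _
    rw [this]
    rfl
  have := (Λ.continuous.tendsto _).comp h
  rw [key] at this
  exact this.congr fun n => key (α n)

end Cutoff

/-- The limit, uniformly with all derivatives, of leafwise forms is a leafwise form. -/
theorem exists_form_of_tendsto_jet {F : Foliation I M} {q : ℕ} {S : Set F.Cutoff}
    (hS : ∀ x, ∃ κ ∈ S, x ∈ κ.core) {ι : Type*} {l : Filter ι} [l.NeBot] {α : ι → F.Form q}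
    {a : ∀ i : S × ℕ, JetSpace E (E [⋀^Fin q]→L[ℝ] ℝ) i.2}
    (h : ∀ i : S × ℕ, Tendsto (fun n => i.1.1.jet i.2 (α n)) l (𝓝 (a i))) :
    ∃ β : F.Form q, ∀ i : S × ℕ, i.1.1.jet i.2 β = a i := by
  have hT : ∀ κ : S, HasFTaylorSeriesUpTo ∞ (fun e => (a (κ, 0) e).curry0)
      (fun e r => a (κ, r) e) := fun κ =>
    hasFTaylorSeriesUpTo_of_tendsto (l := l) (f := fun n => κ.1.loc (α n).1)
      (a := fun r => a (κ, r)) (fun n => κ.1.contDiff_loc (α n).2) fun r =>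
      JetSpace.tendstoUniformly (h (κ, r))
  have hlim : ∀ (κ : S) e v, Tendsto (fun n => κ.1.loc (α n).1 e v) l
      (𝓝 ((a (κ, 0) e).curry0 v)) := by
    intro κ e v
    have h1 := (JetSpace.tendstoUniformly (h (κ, 0))).tendsto_at e
    have h2 := ((continuousMultilinearCurryFin0 ℝ E (E [⋀^Fin q]→L[ℝ] ℝ)).continuous.tendsto _).comp h1
    exact ((ContinuousAlternatingMap.apply ℝ E ℝ v).continuous.tendsto _).comp h2
  choose κ hκS hκ using hS
  let β : ∀ x, (F.tangent x) [⋀^Fin q]→ₗ[ℝ] ℝ := fun x =>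
    ((a (⟨κ x, hκS x⟩, 0) ((κ x).chart.ext x)).curry0.toAlternatingMap).compLinearMap
      ((κ x).chart.coframe x)
  have hβ : ∀ x v, Tendsto (fun n => (α n).1 x v) l (𝓝 (β x v)) := by
    intro x v
    have := hlim ⟨κ x, hκS x⟩ ((κ x).chart.ext x) (fun i => (κ x).chart.coframe x (v i))
    exact this.congr fun n => (κ x).loc_coframe (α n).1 (hκ x) v
  -- The cutoff chosen at each point to define `β` does not matter: by uniqueness of limits, `β` is
  -- the limit in every cutoff of `S`.
  have hloc : ∀ κ : S, κ.1.loc β = fun e => (a (κ, 0) e).curry0 := by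
    intro κ
    funext e
    ext v
    refine tendsto_nhds_unique ?_ (hlim κ e v)
    exact (hβ _ _).const_mul (κ.1.fn e)
  have hmem : β ∈ F.formSubmodule q := by
    refine FoliatedChart.mem_formSubmodule fun x => ⟨(κ x).chart, (hκ x).1, ?_⟩
    have h1 : ContDiff ℝ ∞ ((κ x).loc β) := by
      rw [hloc ⟨κ x, hκS x⟩]
      exact contDiffOn_univ.1 ((hasFTaylorSeriesUpToOn_univ_iff.2
        (hT ⟨κ x, hκS x⟩)).contDiffOn)
    exact h1.contDiffAt.congr_of_eventuallyEq ((κ x).loc_eventuallyEq β (hκ x)).symm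
  refine ⟨⟨β, hmem⟩, fun i => ?_⟩
  refine JetSpace.ext fun e => ?_
  change iteratedFDeriv ℝ i.2 (i.1.1.loc β) e = _
  rw [hloc i.1]
  exact ((hT i.1).eq_iteratedFDeriv (by exact_mod_cast le_top) e).symm

end Foliation

end

/-! ### Fourier coefficients of smooth families of leafwise forms -/

section

namespace Foliation

open MeasureTheory

variable {E H : Type*} [NormedAddCommGroup E] [NormedSpace ℝ E] [FiniteDimensional ℝ E]
  [TopologicalSpace H] {I : ModelWithCorners ℝ E H} [I.Boundaryless]
  {M : Type*} [TopologicalSpace M] [ChartedSpace H M] [IsManifold I ∞ M] [T2Space M]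
  {F : Foliation I M} {q d : ℕ}

/-- A family of leafwise forms depending smoothly on a parameter. -/
def SmoothFamily {X : Type*} [NormedAddCommGroup X] [NormedSpace ℝ X] (f : X → F.Form q) : Prop :=
  ∀ (c : F.FoliatedChart) (p : X × E), p.2 ∈ c.ext.target →
    ContDiffAt ℝ ∞ (fun p : X × E => c.rep (f p.1).1 p.2) p

/-- A family of leafwise forms in coordinates, cut off. -/
def Cutoff.famLoc {X : Type*} (κ : F.Cutoff) (f : X → F.Form q) (p : X × E) :
    E [⋀^Fin q]→L[ℝ] ℝ := κ.loc (f p.1).1 p.2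

theorem SmoothFamily.contDiff_famLoc {X : Type*} [NormedAddCommGroup X] [NormedSpace ℝ X]
    {f : X → F.Form q} (hf : SmoothFamily f) (κ : F.Cutoff) : ContDiff ℝ ∞ (κ.famLoc f) := by
  have h1 : ContDiff ℝ ∞ fun p : X × E => κ.fn p.2 := κ.smooth.comp contDiff_snd
  refine contDiff_smul_of_tsupport (f := fun p : X × E => κ.chart.rep (f p.1).1 p.2) h1 fun p hp =>
    hf κ.chart p ?_
  exact κ.tsupport_subset (tsupport_comp_subset_preimage κ.fn continuous_snd hp)

/-- The condition that a family is supported in a small cube. -/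
def SmallSupport (f : (Fin d → ℝ) → F.Form q) : Prop := ∀ x, f x ≠ 0 → ∀ i, |x i| ≤ 1 / 4

theorem SmallSupport.hasCompactSupport_famLoc {f : (Fin d → ℝ) → F.Form q} (hf : SmallSupport f)
    (κ : F.Cutoff) : HasCompactSupport (κ.famLoc f) := by
  refine HasCompactSupport.intro ((isCompact_closedBall (0 : Fin d → ℝ) (1 / 4)).prod κ.compact)
    fun p hp => ?_
  rw [Set.mem_prod, not_and_or] at hp
  rcases hp with hp | hp
  · have h0 : f p.1 = 0 := by
      by_contra h0
      exact hp (mem_closedBall_zero_iff.2 ((pi_norm_le_iff_of_nonneg (by norm_num)).2 (hf _ h0)))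
    rw [Cutoff.famLoc, h0]
    ext v
    exact mul_zero _
  · rw [Cutoff.famLoc, Cutoff.loc, image_eq_zero_of_notMem_tsupport hp, zero_smul]

theorem integrable_wave_mul {f : (Fin d → ℝ) → F.Form q} (hf : SmoothFamily f)
    (hs : SmallSupport f) (n : Freq d) {y : M} (v : Fin q → F.tangent y) :
    Integrable fun x => n.wave x * (f x).1 y v := by
  obtain ⟨κ, hκ⟩ := Cutoff.exists_mem_core F y
  have h1 := integrable_smul_of_bound (μ := volume) n.contDiff_wave.continuous n.abs_wave_le
    (hf.contDiff_famLoc κ).continuous (hs.hasCompactSupport_famLoc κ) (κ.chart.ext y)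
  have h2 := (ContinuousAlternatingMap.apply ℝ E ℝ
    (fun i => κ.chart.coframe y (v i))).integrable_comp h1
  refine h2.congr (Eventually.of_forall fun x => ?_)
  exact congrArg (n.wave x * ·) (κ.loc_coframe (f x).1 hκ v)

/-- The Fourier coefficient of a family of leafwise forms, pointwise. -/
def fourierCoefAt {f : (Fin d → ℝ) → F.Form q} (hf : SmoothFamily f) (hs : SmallSupport f)
    (n : Freq d) (y : M) : (F.tangent y) [⋀^Fin q]→ₗ[ℝ] ℝ where
  toFun v := ∫ x, n.wave x * (f x).1 y v
  map_update_add' {inst} v i a b := by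
    obtain rfl : inst = instDecidableEqFin q := Subsingleton.elim _ _
    simp only [AlternatingMap.map_update_add, mul_add]
    exact integral_add (integrable_wave_mul hf hs n _) (integrable_wave_mul hf hs n _)
  map_update_smul' {inst} v i c a := by
    obtain rfl : inst = instDecidableEqFin q := Subsingleton.elim _ _
    simp only [AlternatingMap.map_update_smul, mul_smul_comm]
    exact integral_smul c _
  map_eq_zero_of_eq' v i j hv hij := by
    simp only [AlternatingMap.map_eq_zero_of_eq _ v hv hij, mul_zero, integral_zero]

/-- Localisation commutes with integration over the parameter, which makes the smoothness and decay
results for vector-valued parameter integrals applicable. -/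
theorem loc_fourierCoefAt {f : (Fin d → ℝ) → F.Form q} (hf : SmoothFamily f) (hs : SmallSupport f)
    (n : Freq d) (κ : F.Cutoff) :
    κ.loc (fourierCoefAt hf hs n) = paramInt volume n.wave (κ.famLoc f) := by
  funext e
  ext v
  have h1 := integrable_smul_of_bound (μ := volume) n.contDiff_wave.continuous n.abs_wave_le
    (hf.contDiff_famLoc κ).continuous (hs.hasCompactSupport_famLoc κ) e
  have h2 := (ContinuousAlternatingMap.apply ℝ E ℝ v).integral_comp_comm h1
  refine Eq.trans ?_ h2
  rw [Cutoff.loc_apply]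
  change κ.fn e * (∫ x, n.wave x * (f x).1 _ _) = ∫ x, n.wave x * (κ.fn e * (f x).1 _ _)
  rw [← integral_const_mul]
  refine integral_congr_ae (Eventually.of_forall fun x => ?_)
  exact mul_left_comm _ _ _

/-- The Fourier coefficient of a family of leafwise forms. -/
def fourierCoef {f : (Fin d → ℝ) → F.Form q} (hf : SmoothFamily f) (hs : SmallSupport f)
    (n : Freq d) : F.Form q :=
  ⟨fourierCoefAt hf hs n, by
    refine FoliatedChart.mem_formSubmodule fun x => ?_
    obtain ⟨κ, hκ⟩ := Cutoff.exists_mem_core F x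
    refine ⟨κ.chart, hκ.1, ?_⟩
    have h1 : ContDiff ℝ ∞ (κ.loc (fourierCoefAt hf hs n)) := by
      rw [loc_fourierCoefAt]
      exact contDiff_paramInt n.contDiff_wave.continuous n.abs_wave_le (hf.contDiff_famLoc κ)
        (hs.hasCompactSupport_famLoc κ)
    exact h1.contDiffAt.congr_of_eventuallyEq (κ.loc_eventuallyEq _ hκ).symm⟩

theorem loc_fourierCoef {f : (Fin d → ℝ) → F.Form q} (hf : SmoothFamily f) (hs : SmallSupport f)
    (n : Freq d) (κ : F.Cutoff) :
    κ.loc (fourierCoef hf hs n).1 = paramInt volume n.wave (κ.famLoc f) :=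
  loc_fourierCoefAt hf hs n κ

/-- The Fourier coefficients of a family of closed forms are closed. -/
theorem d_fourierCoef {f : (Fin d → ℝ) → F.Form q} (hf : SmoothFamily f) (hs : SmallSupport f)
    (hd : ∀ x, F.d q (f x) = 0) (n : Freq d) : F.d q (fourierCoef hf hs n) = 0 := by
  refine form_ext fun y => ?_
  ext v
  obtain ⟨κ, hκ⟩ := Cutoff.exists_mem_core F y
  have hU := hf.contDiff_famLoc κ
  have hUc := hs.hasCompactSupport_famLoc κ
  -- `Λ` expresses the leafwise derivative at `y` linearly through the derivative of the localised
  -- form, so it can be moved under the integral.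
  let Λ : (E →L[ℝ] (E [⋀^Fin q]→L[ℝ] ℝ)) →L[ℝ] ℝ :=
    (ContinuousAlternatingMap.apply ℝ E ℝ (fun i => κ.chart.coframe y (v i))).comp
      (ContinuousAlternatingMap.alternatizeUncurryFinCLM ℝ E ℝ)
  have h1 : (F.d q (fourierCoef hf hs n)).1 y v =
      Λ (fderiv ℝ (κ.loc (fourierCoef hf hs n).1) (κ.chart.ext y)) :=
    κ.d_eq_extDeriv_loc _ hκ v
  have h2 : ∀ x, Λ (sndDeriv (κ.famLoc f) (x, κ.chart.ext y)) = 0 := by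
    intro x
    have h3 : (F.d q (f x)).1 y v = Λ (fderiv ℝ (κ.loc (f x).1) (κ.chart.ext y)) :=
      κ.d_eq_extDeriv_loc _ hκ v
    have h4 : HasFDerivAt (κ.loc (f x).1) (sndDeriv (κ.famLoc f) (x, κ.chart.ext y))
        (κ.chart.ext y) :=
      HasFDerivAt.comp (g := κ.famLoc f) (f := fun e => (x, e)) (κ.chart.ext y)
        (hU.differentiable (by simp) (x, κ.chart.ext y)).hasFDerivAt
        (hasFDerivAt_prodMk_right x (κ.chart.ext y))
    rw [← h4.fderiv, ← h3, hd]
    rfl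
  rw [h1, loc_fourierCoef, fderiv_paramInt n.contDiff_wave.continuous n.abs_wave_le hU hUc]
  have h5 := Λ.integral_comp_comm (integrable_smul_of_bound (μ := volume)
    n.contDiff_wave.continuous n.abs_wave_le (contDiff_sndDeriv hU).continuous
    (hasCompactSupport_sndDeriv hUc) (κ.chart.ext y))
  refine h5.symm.trans ?_
  simp only [map_smul, h2, smul_zero, integral_zero]
  rfl

/-- The Fourier coefficients of a smooth family are rapidly decreasing. -/
theorem tendsto_jet_fourierCoef {f : (Fin d → ℝ) → F.Form q} (hf : SmoothFamily f)
    (hs : SmallSupport f) (κ : F.Cutoff) (r k : ℕ) :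
    Tendsto (fun n : Freq d => n.weight ^ k • κ.jet r (fourierCoef hf hs n)) cofinite (𝓝 0) := by
  -- The spare power of the weight turns boundedness into convergence to zero.
  obtain ⟨C, hC⟩ := exists_freqWeight_pow_mul_norm_le (hf.contDiff_famLoc κ)
    (hs.hasCompactSupport_famLoc κ) r (k + 1)
  refine squeeze_zero_norm (a := fun n : Freq d => |C| * n.weight⁻¹) (fun n => ?_) ?_
  · have h0 := one_pos.trans_le n.one_le_weight
    rw [norm_smul, Real.norm_of_nonneg (by positivity), ← le_div_iff₀' (by positivity)]
    refine (JetSpace.norm_le (by positivity)).2 fun e => ?_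
    rw [le_div_iff₀' (by positivity), ← div_eq_mul_inv, le_div_iff₀ h0]
    refine le_trans (le_of_eq ?_) ((hC n.vec n.phase e).trans (le_abs_self C))
    rw [mul_right_comm, ← pow_succ, Cutoff.jet_apply, loc_fourierCoef]
    rfl
  · simpa using (Freq.tendsto_weight d).const_mul |C|

end Foliation

end

/-! ### Lifting the Fourier series of a family of closed forms -/

section

namespace Foliation

variable {E H : Type*} [NormedAddCommGroup E] [NormedSpace ℝ E] [FiniteDimensional ℝ E]
  [TopologicalSpace H] {I : ModelWithCorners ℝ E H} [I.Boundaryless]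
  {M : Type*} [TopologicalSpace M] [ChartedSpace H M] [IsManifold I ∞ M] [T2Space M]
  {F : Foliation I M} {q d : ℕ}

/-- The family of all jets of a leafwise form, with respect to a set of cutoffs. -/
def jets (S : Set F.Cutoff) :
    F.Form q →ₗ[ℝ] ∀ i : S × ℕ, JetSpace E (E [⋀^Fin q]→L[ℝ] ℝ) i.2 :=
  LinearMap.pi fun i => i.1.1.jet i.2

/-- The value at a point of a trigonometric series of leafwise forms. -/
theorem hasSum_fourierCoef {f : (Fin d → ℝ) → F.Form q} (hf : SmoothFamily f)
    (hs : SmallSupport f) {x : Fin d → ℝ} (hx : ∀ i, |x i| < 1 / 2) (y : M)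
    (v : Fin q → F.tangent y) :
    HasSum (fun n : Freq d => n.wave x * (fourierCoef hf hs n).1 y v) ((f x).1 y v) := by
  obtain ⟨κ, hκ⟩ := Cutoff.exists_mem_core F y
  refine hasSum_wave (h := fun x => (f x).1 y v) ?_ ?_ ?_ hx
  · have h1 : Continuous fun x => κ.famLoc f (x, κ.chart.ext y) :=
      (hf.contDiff_famLoc κ).continuous.comp (continuous_id.prodMk continuous_const)
    exact ((ContinuousAlternatingMap.apply ℝ E ℝ
      (fun i => κ.chart.coframe y (v i))).continuous.comp h1).congr fun x =>
        κ.loc_coframe (f x).1 hκ v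
  · intro x h0
    refine hs x fun h => h0 ?_
    simp only [h]
    rfl
  · have h1 := summable_smul_of_rapid (fun n : Freq d => n.one_le_weight) (Freq.summable_weight d)
      (tendsto_jet_fourierCoef hf hs κ 0 _) (g := fun _ => 1) (fun _ => by simp)
    refine ((κ.evalJet v).summable h1).congr fun n => ?_
    rw [one_smul]
    exact κ.evalJet_jet (fourierCoef hf hs n) hκ v

/-- A smooth family of closed forms lifts to a rapidly convergent trigonometric series, under a
closed linear map `D` which together with finitely many forms spans all closed forms. -/
theorem exists_family_lift {S : Set F.Cutoff} (hS : S.Countable) (hcov : ∀ x, ∃ κ ∈ S, x ∈ κ.core)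
    {Y : Type*} [AddCommGroup Y] [Module ℝ Y] (D : Y →ₗ[ℝ] F.Form q)
    {K : Type*} [Countable K] {A : K → Type*} [∀ i, NormedAddCommGroup (A i)]
    [∀ i, NormedSpace ℝ (A i)] [∀ i, CompleteSpace (A i)] (jY : Y →ₗ[ℝ] ∀ i, A i)
    (hY : ∀ (y : ℕ → Y) (a : ∀ i, A i), Tendsto (fun n => jY (y n)) atTop (𝓝 a) →
      ∃ y0, jY y0 = a ∧ ∀ x v, Tendsto (fun n => (D (y n)).1 x v) atTop (𝓝 ((D y0).1 x v)))
    (hD : ∀ y, F.d q (D y) = 0) {σ : Type*} [Fintype σ] {h : σ → F.Form q}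
    (hh : ∀ s, F.d q (h s) = 0)
    (hspan : ∀ β : F.Form q, F.d q β = 0 → ∃ (a : σ → ℝ) (y : Y), ∑ s, a s • h s + D y = β)
    {f : (Fin d → ℝ) → F.Form q} (hf : SmoothFamily f) (hs : SmallSupport f)
    (hd : ∀ x, F.d q (f x) = 0) :
    ∃ (a : Freq d → σ → ℝ) (y : Freq d → Y),
      (∀ (k : ℕ) (s : σ), Tendsto (fun n => n.weight ^ k • a n s) cofinite (𝓝 0)) ∧
      (∀ (k : ℕ) (i : K), Tendsto (fun n => n.weight ^ k • jY (y n) i) cofinite (𝓝 0)) ∧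
      ∀ x : Fin d → ℝ, (∀ i, |x i| < 1 / 2) → ∃ y0, (∀ i, jY y0 i = ∑' n, n.wave x • jY (y n) i) ∧
        f x = ∑ s, (∑' n, n.wave x • a n s) • h s + D y0 := by
  have : Countable S := hS.to_subtype
  let comb : (σ → ℝ) × Y →ₗ[ℝ] F.Form q :=
    LinearMap.coprod (∑ s, (LinearMap.proj s).smulRight (h s)) D
  have hcomb : ∀ a y, comb (a, y) = ∑ s, a s • h s + D y := by
    intro a y
    simp [comb, LinearMap.sum_apply]
  have hdcomb : ∀ p, F.d q (comb p) = 0 := by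
    rintro ⟨a, y⟩
    rw [hcomb, map_add, map_sum, hD, add_zero]
    exact Finset.sum_eq_zero fun s _ => by rw [map_smul, hh, smul_zero]
  have hcombapp : ∀ a y x v, (comb (a, y)).1 x v = ∑ s, a s * (h s).1 x v + (D y).1 x v := by
    intro a y x v
    let ev : F.Form q →ₗ[ℝ] ℝ :=
      { toFun := fun β => β.1 x v, map_add' := fun _ _ => rfl, map_smul' := fun _ _ => rfl }
    have h1 : ev (comb (a, y)) = ∑ s, a s • ev (h s) + ev (D y) := by
      rw [hcomb, map_add, map_sum]
      simp only [map_smul]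
    exact h1
  -- The range of `T` is the graph of `comb` as seen through jets. All topology lives in products of
  -- Banach spaces; none is put on the spaces of forms.
  let T : (σ → ℝ) × Y →ₗ[ℝ] ((σ → ℝ) × ∀ i, A i) ×
      ∀ i : S × ℕ, JetSpace E (E [⋀^Fin q]→L[ℝ] ℝ) i.2 :=
    (LinearMap.prodMap LinearMap.id jY).prod ((jets S).comp comb)
  have hTapp : ∀ a y, T (a, y) = ((a, jY y), jets S (comb (a, y))) := fun _ _ => rfl
  -- Along a convergent sequence in the range, `hY` supplies a limit `y0` with pointwise convergence
  -- under `D`, while the jets of the combinations converge to those of a form `β`. Pointwise limits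
  -- identify `β` with the combination at the limit.
  have hΓ : IsClosed (LinearMap.range T : Set (((σ → ℝ) × ∀ i, A i) ×
      ∀ i : S × ℕ, JetSpace E (E [⋀^Fin q]→L[ℝ] ℝ) i.2)) := by
    refine IsSeqClosed.isClosed fun p P hp hP => ?_
    choose z hz using hp
    obtain rfl : (fun n => T (z n)) = p := funext hz
    have h1 : Tendsto (fun n => (z n).1) atTop (𝓝 P.1.1) :=
      ((continuous_fst.comp continuous_fst).tendsto P).comp hP
    have h2 : Tendsto (fun n => jY (z n).2) atTop (𝓝 P.1.2) :=
      ((continuous_snd.comp continuous_fst).tendsto P).comp hP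
    have h3 : Tendsto (fun n => jets S (comb (z n))) atTop (𝓝 P.2) :=
      (continuous_snd.tendsto P).comp hP
    obtain ⟨y0, hy0, hlim⟩ := hY (fun n => (z n).2) P.1.2 h2
    obtain ⟨β, hβ⟩ := exists_form_of_tendsto_jet hcov (fun i => tendsto_pi_nhds.1 h3 i)
    have hβ' : jets S β = P.2 := funext hβ
    have key : comb (P.1.1, y0) = β := by
      refine form_ext fun x => ?_
      ext v
      obtain ⟨κ, hκS, hκ⟩ := hcov x
      have h4 : Tendsto (fun n => (comb (z n)).1 x v) atTop (𝓝 (β.1 x v)) := by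
        refine κ.tendsto_apply_of_jet ?_ hκ v
        have := tendsto_pi_nhds.1 h3 (⟨κ, hκS⟩, 0)
        rw [← hβ'] at this
        exact this
      refine tendsto_nhds_unique ?_ h4
      rw [hcombapp]
      have h5 : ∀ n, (comb (z n)).1 x v = ∑ s, (z n).1 s * (h s).1 x v + (D (z n).2).1 x v :=
        fun n => hcombapp _ _ x v
      simp only [h5]
      exact (tendsto_finsetSum _ fun s _ => (tendsto_pi_nhds.1 h1 s).mul_const _).add (hlim x v)
    refine ⟨(P.1.1, y0), ?_⟩
    rw [hTapp, key, hβ', hy0]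
  -- A jet limit of forms is a form, and it is closed because first-order jets control the
  -- derivative.
  have hC : IsClosed (((LinearMap.ker (F.d q)).map (jets S) :
      Submodule ℝ (∀ i : S × ℕ, JetSpace E (E [⋀^Fin q]→L[ℝ] ℝ) i.2)) :
      Set (∀ i : S × ℕ, JetSpace E (E [⋀^Fin q]→L[ℝ] ℝ) i.2)) := by
    refine IsSeqClosed.isClosed fun p P hp hP => ?_
    choose z hz0 hz using hp
    obtain rfl : (fun n => jets S (z n)) = p := funext hz
    obtain ⟨β, hβ⟩ := exists_form_of_tendsto_jet hcov (fun i => tendsto_pi_nhds.1 hP i)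
    refine ⟨β, ?_, funext hβ⟩
    refine LinearMap.mem_ker.2 (form_ext fun x => ?_)
    ext v
    obtain ⟨κ, hκS, hκ⟩ := hcov x
    have h4 : Tendsto (fun n => (F.d q (z n)).1 x v) atTop (𝓝 ((F.d q β).1 x v)) := by
      refine κ.tendsto_d_apply_of_jet ?_ hκ v
      have := tendsto_pi_nhds.1 hP (⟨κ, hκS⟩, 1)
      rw [← hβ] at this
      exact this
    refine tendsto_nhds_unique h4 ?_
    refine tendsto_const_nhds.congr fun n => ?_
    rw [LinearMap.mem_ker.1 (hz0 n)]
  obtain ⟨a, x, hmem, ha, hx, hsum⟩ := exists_series_lift hΓ hC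
    (by
      rintro _ ⟨p, rfl⟩
      exact ⟨comb p, hdcomb p, rfl⟩)
    (by
      rintro _ ⟨β, hβ, rfl⟩
      obtain ⟨a, y, rfl⟩ := hspan β hβ
      exact ⟨(a, jY y), (a, y), by rw [hTapp, hcomb]⟩)
    (fun n : Freq d => n.one_le_weight) (Freq.summable_weight d)
    (z := fun n => jets S (fourierCoef hf hs n))
    (fun n => ⟨_, d_fourierCoef hf hs hd n, rfl⟩)
    (fun k i => tendsto_jet_fourierCoef hf hs i.1.1 i.2 k)
  choose p hp using hmem
  have hxp : ∀ n, x n = jY (p n).2 := fun n => congrArg (fun P => P.1.2) (hp n).symm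
  refine ⟨a, fun n => (p n).2, ha, fun k i => ?_, fun t ht => ?_⟩
  · have := hx k i
    simp only [hxp] at this
    exact this
  obtain ⟨⟨a0, y0⟩, h0⟩ := hsum (fun n => n.wave t) (fun n => n.abs_wave_le t)
  rw [hTapp] at h0
  have h1 : a0 = fun s => ∑' n, n.wave t • a n s := congrArg (fun P => P.1.1) h0
  have h2 : jY y0 = fun i => ∑' n, n.wave t • x n i := congrArg (fun P => P.1.2) h0
  have h3 : jets S (comb (a0, y0)) = fun i => ∑' n, n.wave t • jets S (fourierCoef hf hs n) i :=
    congrArg (fun P => P.2) h0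
  refine ⟨y0, fun i => ?_, ?_⟩
  · rw [h2]
    simp only [hxp]
  -- At each point of the manifold both sides are the sum of the same scalar Fourier series.
  · have key : f t = comb (a0, y0) := by
      refine form_ext fun x => ?_
      ext v
      obtain ⟨κ, hκS, hκ⟩ := hcov x
      have h4 := congrFun h3 (⟨κ, hκS⟩, 0)
      have h5 := congrArg (κ.evalJet v) h4
      have h6 := summable_smul_of_rapid (fun n : Freq d => n.one_le_weight)
        (Freq.summable_weight d) (tendsto_jet_fourierCoef hf hs κ 0 _)
        (g := fun n => n.wave t) (fun n => n.abs_wave_le t)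
      have h7 : κ.evalJet v (jets S (comb (a0, y0)) (⟨κ, hκS⟩, 0)) = (comb (a0, y0)).1 x v :=
        κ.evalJet_jet _ hκ v
      rw [← h7, h5]
      refine Eq.trans ?_ ((κ.evalJet v).map_tsum h6).symm
      refine (hasSum_fourierCoef hf hs ht x v).tsum_eq.symm.trans (tsum_congr fun n => ?_)
      rw [map_smul, κ.evalJet_jet _ hκ v]
      rfl
    rw [key, hcomb, h1]

end Foliation

end

/-! ### Smooth coefficients and smooth primitives -/

section

namespace Foliation

variable {E H : Type*} [NormedAddCommGroup E] [NormedSpace ℝ E] [FiniteDimensional ℝ E]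
  [TopologicalSpace H] {I : ModelWithCorners ℝ E H} [I.Boundaryless]
  {M : Type*} [TopologicalSpace M] [ChartedSpace H M] [IsManifold I ∞ M] [T2Space M]
  {F : Foliation I M} {q d : ℕ}

theorem eventually_weight_pow_mul_norm_le {A : Type*} [NormedAddCommGroup A] [NormedSpace ℝ A]
    {a : Freq d → A} {k : ℕ} (h : Tendsto (fun n => n.weight ^ k • a n) cofinite (𝓝 0)) :
    ∀ᶠ n in cofinite, n.weight ^ k * ‖a n‖ ≤ 1 := by
  filter_upwards [Metric.tendsto_nhds.1 h 1 one_pos] with n hn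
  have h0 := one_pos.trans_le n.one_le_weight
  rw [dist_zero_right, norm_smul, Real.norm_of_nonneg (by positivity)] at hn
  exact hn.le

theorem contDiff_tsum_wave_const {a : Freq d → ℝ}
    (h : ∀ k : ℕ, Tendsto (fun n => n.weight ^ k • a n) cofinite (𝓝 0)) :
    ContDiff ℝ ∞ fun x : Fin d → ℝ => ∑' n : Freq d, n.wave x • a n := by
  have h0 : ∀ r k : ℕ, ∀ᶠ n : Freq d in cofinite, ∀ e : ℝ,
      n.weight ^ k * ‖iteratedFDeriv ℝ r (fun _ : ℝ => a n) e‖ ≤ 1 := by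
    intro r k
    filter_upwards [eventually_weight_pow_mul_norm_le (h k)] with n hn e
    have h0 := one_pos.trans_le n.one_le_weight
    refine le_trans (mul_le_mul_of_nonneg_left ?_ (by positivity)) hn
    obtain _ | r := r
    · exact norm_iteratedFDeriv_zero.le
    · rw [iteratedFDeriv_const_of_ne r.succ_ne_zero]
      exact (norm_zero (E := ℝ [×(r + 1)]→L[ℝ] ℝ)).le.trans (norm_nonneg _)
  -- The constants are treated as functions of a dummy real variable, which is then set to zero.
  have h1 : ContDiff ℝ ∞ fun p : (Fin d → ℝ) × ℝ => ∑' n : Freq d, n.wave p.1 • a n :=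
    contDiff_tsum_wave (f := fun n (_ : ℝ) => a n) (fun n => contDiff_const) h0
  have h2 : ContDiff ℝ ∞ fun x : Fin d → ℝ => (x, (0 : ℝ)) := contDiff_id.prodMk contDiff_const
  exact ContDiff.comp (g := fun p : (Fin d → ℝ) × ℝ => ∑' n : Freq d, n.wave p.1 • a n)
    (f := fun x : Fin d → ℝ => (x, (0 : ℝ))) h1 h2

/-- A trigonometric series of forms is smooth in coordinates. -/
theorem contDiff_famLoc_of_jet (κ : F.Cutoff) {y : Freq d → F.Form q}
    (hy : ∀ r k : ℕ, Tendsto (fun n => n.weight ^ k • κ.jet r (y n)) cofinite (𝓝 0)) :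
    ContDiff ℝ ∞ fun p : (Fin d → ℝ) × E => ∑' n : Freq d, n.wave p.1 • κ.loc (y n).1 p.2 := by
  refine contDiff_tsum_wave (f := fun n => κ.loc (y n).1) (fun n => κ.contDiff_loc (y n).2) fun r k => ?_
  filter_upwards [eventually_weight_pow_mul_norm_le (hy r k)] with n hn e
  refine le_trans ?_ hn
  have h0 := one_pos.trans_le n.one_le_weight
  gcongr
  exact (JetSpace.norm_le (a := κ.jet r (y n)) (norm_nonneg _)).1 le_rfl e

theorem loc_eq_tsum_of_jet (κ : F.Cutoff) {y : Freq d → F.Form q}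
    (hy : ∀ k : ℕ, Tendsto (fun n => n.weight ^ k • κ.jet 0 (y n)) cofinite (𝓝 0))
    {x : Fin d → ℝ} {β : F.Form q} (hβ : κ.jet 0 β = ∑' n : Freq d, n.wave x • κ.jet 0 (y n))
    (e : E) : κ.loc β.1 e = ∑' n : Freq d, n.wave x • κ.loc (y n).1 e := by
  let Λ : JetSpace E (E [⋀^Fin q]→L[ℝ] ℝ) 0 →L[ℝ] (E [⋀^Fin q]→L[ℝ] ℝ) :=
    (continuousMultilinearCurryFin0 ℝ E
      (E [⋀^Fin q]→L[ℝ] ℝ)).toContinuousLinearEquiv.toContinuousLinearMap.comp (JetSpace.evalCLM e)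
  have h1 := summable_smul_of_rapid (fun n : Freq d => n.one_le_weight) (Freq.summable_weight d)
    (hy _) (g := fun n => n.wave x) (fun n => n.abs_wave_le x)
  have h2 : κ.loc β.1 e = Λ (κ.jet 0 β) := rfl
  rw [h2, hβ, Λ.map_tsum h1]
  refine tsum_congr fun n => ?_
  rw [map_smul]
  rfl

variable [SecondCountableTopology M]

/-- The coefficients of a smooth family of closed forms with respect to a finite family of forms
spanning the cohomology depend smoothly on the parameter, and the difference has a primitive which
depends smoothly on the parameter. -/
theorem exists_smooth_primitive {σ : Type*} [Fintype σ] {h : σ → F.Form (q + 1)}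
    (hh : ∀ s, F.d (q + 1) (h s) = 0)
    (hspan : ∀ β : F.Form (q + 1), F.d (q + 1) β = 0 →
      ∃ (a : σ → ℝ) (y : F.Form q), ∑ s, a s • h s + F.d q y = β)
    {f : (Fin d → ℝ) → F.Form (q + 1)} (hf : SmoothFamily f) (hs : SmallSupport f)
    (hd : ∀ x, F.d (q + 1) (f x) = 0) :
    ∃ (c : σ → (Fin d → ℝ) → ℝ) (η : (Fin d → ℝ) → F.Form q),
      (∀ s, ContDiff ℝ ∞ (c s)) ∧
      (∀ x : Fin d → ℝ, (∀ i, |x i| < 1 / 2) → ∀ y : M, ∃ κ : F.FoliatedChart,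
        y ∈ κ.chart.source ∧
        ContDiffAt ℝ ∞ (fun p : (Fin d → ℝ) × E => κ.rep (η p.1).1 p.2) (x, κ.ext y)) ∧
      ∀ x : Fin d → ℝ, (∀ i, |x i| < 1 / 2) → f x = ∑ s, c s x • h s + F.d q (η x) := by
  classical
  obtain ⟨S, hS, hcov⟩ := Cutoff.exists_countable_cover F
  have : Countable S := hS.to_subtype
  -- Here `Y` is the space of forms one degree lower, seen through its jets. The closedness
  -- condition holds because jet limits are jets of forms and first-order jets control `F.d q`.
  obtain ⟨a, y, ha, hy, hsol⟩ := exists_family_lift hS hcov (F.d q) (jets (q := q) S)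
    (by
      intro y a hya
      obtain ⟨β, hβ⟩ := exists_form_of_tendsto_jet hcov (fun i => tendsto_pi_nhds.1 hya i)
      refine ⟨β, funext hβ, fun x v => ?_⟩
      obtain ⟨κ, hκS, hκ⟩ := hcov x
      refine κ.tendsto_d_apply_of_jet ?_ hκ v
      have := tendsto_pi_nhds.1 hya (⟨κ, hκS⟩, 1)
      rw [← hβ] at this
      exact this)
    d_d hh hspan hf hs hd
  -- The value zero outside the cube is harmless: every claim about `η` concerns only the open cube.
  let η : (Fin d → ℝ) → F.Form q := fun x =>
    if hx : ∀ i, |x i| < 1 / 2 then (hsol x hx).choose else 0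
  have hη : ∀ x : Fin d → ℝ, (∀ i, |x i| < 1 / 2) →
      (∀ i, jets S (η x) i = ∑' n : Freq d, n.wave x • jets S (y n) i) ∧
        f x = ∑ s, (∑' n : Freq d, n.wave x • a n s) • h s + F.d q (η x) := by
    intro x hx
    simp only [η, dif_pos hx]
    exact (hsol x hx).choose_spec
  refine ⟨fun s x => ∑' n : Freq d, n.wave x • a n s, η,
    fun s => contDiff_tsum_wave_const fun k => ha k s, fun x hx m => ?_, fun x hx => (hη x hx).2⟩
  obtain ⟨κ, hκS, hκ⟩ := hcov m
  refine ⟨κ.chart, hκ.1, ?_⟩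
  refine (contDiff_famLoc_of_jet κ (y := y) fun r k => hy k (⟨κ, hκS⟩, r)).contDiffAt.congr_of_eventuallyEq ?_
  have hopen : IsOpen {x : Fin d → ℝ | ∀ i, |x i| < 1 / 2} := by
    simp only [ofPred_forall]
    exact isOpen_iInter_of_finite fun i =>
      isOpen_lt (continuous_abs.comp (continuous_apply i)) continuous_const
  have h1 : ∀ᶠ p : (Fin d → ℝ) × E in 𝓝 (x, κ.chart.ext m), ∀ i, |p.1 i| < 1 / 2 :=
    continuous_fst.continuousAt.eventually (hopen.mem_nhds (show (x, κ.chart.ext m).1 ∈ _ from hx))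
  have h2 : ∀ᶠ p : (Fin d → ℝ) × E in 𝓝 (x, κ.chart.ext m), κ.fn p.2 = 1 :=
    (continuous_snd.continuousAt (x := (x, κ.chart.ext m))).eventually hκ.2
  filter_upwards [h1, h2] with p hp1 hp2
  have h3 := loc_eq_tsum_of_jet κ (y := y) (fun k => hy k (⟨κ, hκS⟩, 0))
    ((hη p.1 hp1).1 (⟨κ, hκS⟩, 0)) p.2
  rw [← h3, Cutoff.loc, hp2, one_smul]

/-- The coefficients of a smooth family of closed functions with respect to a finite spanning
family depend smoothly on the parameter. -/
theorem exists_smooth_coefficients {σ : Type*} [Fintype σ] {h : σ → F.Form 0}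
    (hh : ∀ s, F.d 0 (h s) = 0)
    (hspan : ∀ β : F.Form 0, F.d 0 β = 0 → ∃ (a : σ → ℝ), ∑ s, a s • h s = β)
    {f : (Fin d → ℝ) → F.Form 0} (hf : SmoothFamily f) (hs : SmallSupport f)
    (hd : ∀ x, F.d 0 (f x) = 0) :
    ∃ (c : σ → (Fin d → ℝ) → ℝ), (∀ s, ContDiff ℝ ∞ (c s)) ∧
      ∀ x : Fin d → ℝ, (∀ i, |x i| < 1 / 2) → f x = ∑ s, c s x • h s := by
  obtain ⟨S, hS, hcov⟩ := Cutoff.exists_countable_cover F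
  -- In degree zero there are no exact forms to add, so `Y` is trivial and has no jets.
  obtain ⟨a, y, ha, hy, hsol⟩ := exists_family_lift hS hcov (Y := PUnit.{1}) 0 (K := Empty)
    (A := fun _ => ℝ) 0 (fun y a _ => ⟨0, Subsingleton.elim _ _, fun x v => tendsto_const_nhds⟩)
    (fun y => by simp) hh
    (fun β hβ => by
      obtain ⟨a, ha⟩ := hspan β hβ
      exact ⟨a, 0, by simpa using ha⟩) hf hs hd
  refine ⟨fun s x => ∑' n : Freq d, n.wave x • a n s,
    fun s => contDiff_tsum_wave_const fun k => ha k s, fun x hx => ?_⟩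
  obtain ⟨y0, -, h0⟩ := hsol x hx
  simpa using h0

end Foliation

end

/-! ### Slices of a form on the product as local smooth families -/

section

namespace Foliation

theorem mix_update_left {X : Type*} {a b k : ℕ} (h : a + b = k) (u : Fin a → X) (v : Fin b → X)
    (j : Fin a) (w : X) : mix h (Function.update u j w) v =
      Function.update (mix h u v) (Fin.cast h (Fin.castAdd b j)) w := by
  funext l
  rcases Nat.lt_or_ge l.1 a with hl | hl
  · have hl2 : l = Fin.cast h (Fin.castAdd b ⟨l.1, hl⟩) := Fin.ext (by simp)
    rw [hl2, mix_left]
    by_cases hj : (⟨l.1, hl⟩ : Fin a) = j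
    · rw [hj, Function.update_self, Function.update_self]
    · rw [Function.update_of_ne hj, Function.update_of_ne, mix_left]
      intro h'
      apply hj
      have := congrArg Fin.val h'
      simp only [Fin.val_cast, Fin.val_castAdd] at this
      exact Fin.ext this
  · have hl2 : l.1 = a + (⟨l.1 - a, by omega⟩ : Fin b).1 := by simp only; omega
    rw [mix_of_ge h _ _ _ hl2, Function.update_of_ne, mix_of_ge h _ _ _ hl2]
    intro hl'
    have := congrArg Fin.val hl'
    simp only [Fin.val_cast, Fin.val_castAdd] at this
    have := j.2
    omega

theorem mixed_update_left {V V' : Type*} [AddCommGroup V] [Module ℝ V] [AddCommGroup V']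
    [Module ℝ V'] {P : Submodule ℝ V} {Q : Submodule ℝ V'} {a b k : ℕ} (h : a + b = k)
    (u : Fin a → P) (v : Fin b → Q) (j : Fin a) (w : P) :
    mixed h (Function.update u j w) v =
      Function.update (mixed h u v) (Fin.cast h (Fin.castAdd b j)) (inP P Q w) := by
  rw [mixed, mixed, ← mix_update_left]
  congr 1
  funext l
  exact Function.apply_update (fun _ => inP P Q) u j w l

theorem mixed_left {V V' : Type*} [AddCommGroup V] [Module ℝ V] [AddCommGroup V']
    [Module ℝ V'] {P : Submodule ℝ V} {Q : Submodule ℝ V'} {a b k : ℕ} (h : a + b = k)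
    (u : Fin a → P) (v : Fin b → Q) (j : Fin a) :
    mixed h u v (Fin.cast h (Fin.castAdd b j)) = inP P Q (u j) := mix_left h _ _ j

/-- Around every point of an open subset of a finite-dimensional space there are linear coordinates
for which the subset contains a given cube. -/
theorem exists_cube_coordinates {E : Type*} [NormedAddCommGroup E] [NormedSpace ℝ E]
    [FiniteDimensional ℝ E] {U : Set E} (hU : IsOpen U) {e₀ : E} (he : e₀ ∈ U) :
    ∃ (ψ : (Fin (Module.finrank ℝ E) → ℝ) → E) (A : E → Fin (Module.finrank ℝ E) → ℝ),
      ContDiff ℝ ∞ ψ ∧ ContDiff ℝ ∞ A ∧ (∀ e, ψ (A e) = e) ∧ A e₀ = 0 ∧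
      ∀ t, ‖t‖ ≤ 1 / 4 → ψ t ∈ U := by
  let φ : E ≃L[ℝ] (Fin (Module.finrank ℝ E) → ℝ) := ContinuousLinearEquiv.ofFinrankEq (by simp)
  have h1 : Continuous fun t => e₀ + φ.symm t := continuous_const.add φ.symm.continuous
  have h2 : ∀ᶠ t in 𝓝 (0 : Fin (Module.finrank ℝ E) → ℝ), e₀ + φ.symm t ∈ U :=
    h1.continuousAt.eventually (hU.mem_nhds (by simpa using he))
  obtain ⟨δ, hδ, h3⟩ := Metric.eventually_nhds_iff.1 h2
  refine ⟨fun t => e₀ + φ.symm (δ • t), fun e => δ⁻¹ • φ (e - e₀), ?_, ?_, fun e => ?_, ?_,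
    fun t ht => h3 ?_⟩
  · exact contDiff_const.add (φ.symm.contDiff.comp (contDiff_id.const_smul δ))
  · exact (φ.contDiff.comp (contDiff_id.sub contDiff_const)).const_smul δ⁻¹
  · beta_reduce
    rw [smul_inv_smul₀ hδ.ne', φ.symm_apply_apply]
    abel
  · simp
  · rw [dist_zero_right, norm_smul, Real.norm_of_nonneg hδ.le]
    nlinarith

variable {E H : Type*} [NormedAddCommGroup E] [NormedSpace ℝ E] [FiniteDimensional ℝ E]
  [TopologicalSpace H] {I : ModelWithCorners ℝ E H} [I.Boundaryless]
  {M : Type*} [TopologicalSpace M] [ChartedSpace H M] [IsManifold I ∞ M]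
  {E' H' : Type*} [NormedAddCommGroup E'] [NormedSpace ℝ E'] [FiniteDimensional ℝ E']
  [TopologicalSpace H'] {J : ModelWithCorners ℝ E' H'} [J.Boundaryless]
  {N : Type*} [TopologicalSpace N] [ChartedSpace H' N] [IsManifold J ∞ N]
  [T2Space M] [T2Space N]
  {F : Foliation I M} {G : Foliation J N} {p q m : ℕ}

/-- The slices of a form on a product, as an alternating map with values in the forms on the second
factor. -/
def sliceAlt (h : p + q = m) (τ : (F.prod G).Form m) (x : M) :
    (F.tangent x) [⋀^Fin p]→ₗ[ℝ] G.Form q where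
  toFun u := slice h τ u
  map_update_add' {inst} u j w w' := by
    obtain rfl : inst = instDecidableEqFin p := Subsingleton.elim _ _
    refine form_ext fun y => ?_
    ext v
    have key : ∀ w : F.tangent x, (slice h τ (Function.update u j w)).1 y v =
        τ.1 (x, y) (Function.update (mixed h u v) (Fin.cast h (Fin.castAdd q j))
          (inP (F.tangent x) (G.tangent y) w)) := fun w =>
      congrArg (τ.1 (x, y)) (mixed_update_left h u v j w)
    change _ = (slice h τ (Function.update u j w)).1 y v + (slice h τ (Function.update u j w')).1 y v
    rw [key, key, key, map_add]
    exact (τ.1 (x, y)).map_update_add _ _ _ _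
  map_update_smul' {inst} u j r w := by
    obtain rfl : inst = instDecidableEqFin p := Subsingleton.elim _ _
    refine form_ext fun y => ?_
    ext v
    have key : ∀ w : F.tangent x, (slice h τ (Function.update u j w)).1 y v =
        τ.1 (x, y) (Function.update (mixed h u v) (Fin.cast h (Fin.castAdd q j))
          (inP (F.tangent x) (G.tangent y) w)) := fun w =>
      congrArg (τ.1 (x, y)) (mixed_update_left h u v j w)
    change _ = r * (slice h τ (Function.update u j w)).1 y v
    rw [key, key, map_smul]
    exact (τ.1 (x, y)).map_update_smul _ _ _ _
  map_eq_zero_of_eq' u i j hu hij := by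
    refine form_ext fun y => ?_
    ext v
    refine (τ.1 (x, y)).map_eq_zero_of_eq _ (i := Fin.cast h (Fin.castAdd q i))
      (j := Fin.cast h (Fin.castAdd q j)) ?_ ?_
    · exact (mixed_left h u v i).trans ((congrArg _ hu).trans (mixed_left h u v j).symm)
    · intro heq
      apply hij
      simpa using heq

/-- The slice of a form on a product with respect to vectors which are constant in a chart. -/
def frameSlice (h : p + q = m) (τ : (F.prod G).Form m) (c : F.FoliatedChart) (t : Fin p → E)
    (e : E) : G.Form q :=
  slice h τ (x := c.ext.symm e) fun i => c.frame _ (t i)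

theorem rep_frameSlice (h : p + q = m) (τ : (F.prod G).Form m) (c : F.FoliatedChart)
    (t : Fin p → E) {e : E} (he : e ∈ c.ext.target) (c' : G.FoliatedChart) {e' : E'}
    (he' : e' ∈ c'.ext.target) (w : Fin q → E') :
    c'.rep (frameSlice h τ c t e).1 e' w =
      (c.prod c').rep τ.1 (e, e') (mix h (fun i => (t i, 0)) (fun j => (0, w j))) :=
  (c.prod_rep_mix c' h τ.1 he he' t w).symm

/-- A linear functional on the forms on the second factor turns a form on the product into a family
of alternating maps on the first factor. -/
def contract (h : p + q = m) (τ : (F.prod G).Form m) (l : G.Form q →ₗ[ℝ] ℝ) (x : M) :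
    (F.tangent x) [⋀^Fin p]→ₗ[ℝ] ℝ := l.compAlternatingMap (sliceAlt h τ x)

theorem contract_apply (h : p + q = m) (τ : (F.prod G).Form m) (l : G.Form q →ₗ[ℝ] ℝ) {x : M}
    (u : Fin p → F.tangent x) : contract h τ l x u = l (slice h τ u) := rfl

theorem rep_contract (h : p + q = m) (τ : (F.prod G).Form m) (l : G.Form q →ₗ[ℝ] ℝ)
    (c : F.FoliatedChart) (e : E) (t : Fin p → E) :
    c.rep (contract h τ l) e t = l (frameSlice h τ c t e) := rfl

/-- The slice is alternating in `u`, so the reproducing family, applied after contraction with any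
evaluation functional, reduces all slices to finitely many families of forms over the chart. -/
theorem slice_eq_sum (h : p + q = m) (τ : (F.prod G).Form m) (c : F.FoliatedChart) {n : ℕ}
    {t : Fin n → Fin p → E} {θ : Fin n → E [⋀^Fin p]→L[ℝ] ℝ}
    (hθ : ∀ α : E [⋀^Fin p]→L[ℝ] ℝ, α = ∑ i, α (t i) • θ i) {x : M} (hx : x ∈ c.chart.source)
    (u : Fin p → F.tangent x) :
    slice h τ u = ∑ j, θ j (fun i => c.coframe x (u i)) • frameSlice h τ c (t j) (c.ext x) := by
  refine form_ext fun y => ?_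
  ext v
  let l : G.Form q →ₗ[ℝ] ℝ :=
    { toFun := fun β => β.1 y v, map_add' := fun _ _ => rfl, map_smul' := fun _ _ => rfl }
  change l (slice h τ u) = l _
  rw [← contract_apply, ← c.rep_coframe (contract h τ l) hx u, hθ (c.rep (contract h τ l) _),
    map_sum]
  simp only [map_smul, rep_contract, ContinuousAlternatingMap.sum_apply,
    ContinuousAlternatingMap.smul_apply, smul_eq_mul]
  exact Finset.sum_congr rfl fun j _ => mul_comm _ _

/-- The slices of a form on a product are locally given by smooth families. -/
theorem exists_slice_family (h : p + q = m) (τ : (F.prod G).Form m) (c : F.FoliatedChart) {n : ℕ}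
    (t : Fin n → Fin p → E) {x₀ : M} (hx₀ : x₀ ∈ c.chart.source) :
    ∃ (A : E → Fin (Module.finrank ℝ E) → ℝ)
      (f : Fin n → (Fin (Module.finrank ℝ E) → ℝ) → G.Form q) (U : Set E),
      ContDiff ℝ ∞ A ∧ (∀ j, SmoothFamily (f j)) ∧ (∀ j, SmallSupport (f j)) ∧
      (∀ j s, ∃ (r : ℝ) (e : E), f j s = r • frameSlice h τ c (t j) e) ∧
      IsOpen U ∧ c.ext x₀ ∈ U ∧ U ⊆ c.ext.target ∧
      ∀ e ∈ U, (∀ i, |A e i| < 1 / 2) ∧ ∀ j, f j (A e) = frameSlice h τ c (t j) e := by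
  obtain ⟨ψ, A, hψ, hA, hψA, hA0, hcube⟩ := exists_cube_coordinates c.isOpen_target (c.ext_mem hx₀)
  -- The outer radius `1/4` meets the support condition of the Fourier expansion and keeps `ψ`
  -- inside the chart. On the ball of radius `1/8` the family is unchanged.
  let χ : ContDiffBump (0 : Fin (Module.finrank ℝ E) → ℝ) :=
    ⟨1 / 8, 1 / 4, by norm_num, by norm_num⟩
  have hχ : ContDiff ℝ ∞ χ := χ.contDiff
  refine ⟨A, fun j s => χ s • frameSlice h τ c (t j) (ψ s),
    A ⁻¹' Metric.ball 0 (1 / 8) ∩ c.ext.target, hA, fun j c' P hP => ?_, fun j s hs => ?_,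
    fun j s => ⟨_, _, rfl⟩, (Metric.isOpen_ball.preimage hA.continuous).inter c.isOpen_target,
    ⟨by rw [mem_preimage, hA0]; simp, c.ext_mem hx₀⟩, inter_subset_right, fun e he => ?_⟩
  · by_cases hs : P.1 ∈ tsupport χ
    · refine contDiffAt_alternating fun w => ?_
      have hψP : ψ P.1 ∈ c.ext.target := hcube _ (by
        rw [χ.tsupport_eq] at hs
        exact mem_closedBall_zero_iff.1 hs)
      have h1 := (c.prod c').contDiffAt_rep τ.2 (c.mem_prod_target c' hψP hP)
      have h2 : ContDiffAt ℝ ∞ (fun Q : (Fin (Module.finrank ℝ E) → ℝ) × E' =>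
          (c.prod c').rep τ.1 (ψ Q.1, Q.2)) P :=
        ContDiffAt.comp (g := (c.prod c').rep τ.1) P h1
          ((hψ.comp contDiff_fst).contDiffAt.prodMk contDiffAt_snd)
      have h3 := contDiffAt_alternating_apply (g := fun l _ =>
        mix h (fun i => (t j i, 0)) (fun i => (0, w i)) l) h2 fun _ => contDiffAt_const
      have h4 : ContDiffAt ℝ ∞ (fun Q : (Fin (Module.finrank ℝ E) → ℝ) × E' => χ Q.1) P :=
        (hχ.comp contDiff_fst).contDiffAt
      refine (h4.mul h3).congr_of_eventuallyEq ?_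
      have h5 : ∀ᶠ Q in 𝓝 P, ψ Q.1 ∈ c.ext.target :=
        (hψ.continuous.comp continuous_fst).continuousAt.eventually (c.isOpen_target.mem_nhds hψP)
      have h6 : ∀ᶠ Q in 𝓝 P, Q.2 ∈ c'.ext.target :=
        continuous_snd.continuousAt.eventually (c'.isOpen_target.mem_nhds hP)
      filter_upwards [h5, h6] with Q hQ1 hQ2
      exact congrArg (χ Q.1 * ·) (rep_frameSlice h τ c (t j) hQ1 c' hQ2 w)
    · refine (contDiffAt_const (c := (0 : E' [⋀^Fin q]→L[ℝ] ℝ))).congr_of_eventuallyEq ?_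
      have h5 : ∀ᶠ Q in 𝓝 P, Q.1 ∈ (tsupport χ)ᶜ :=
        continuous_fst.continuousAt.eventually ((isClosed_tsupport χ).isOpen_compl.mem_nhds hs)
      filter_upwards [h5] with Q hQ
      ext w
      change χ Q.1 * _ = 0
      rw [image_eq_zero_of_notMem_tsupport hQ, zero_mul]
  · have h1 : s ∈ Metric.ball (0 : Fin (Module.finrank ℝ E) → ℝ) (1 / 4) := by
      rw [← χ.support_eq]
      intro h0
      exact hs (by beta_reduce; rw [h0, zero_smul])
    intro i
    exact (norm_le_pi_norm s i).trans (mem_ball_zero_iff.1 h1).le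
  · have h1 : ‖A e‖ < 1 / 8 := mem_ball_zero_iff.1 he.1
    refine ⟨fun i => ((norm_le_pi_norm (A e) i).trans_lt h1).trans (by norm_num), fun j => ?_⟩
    have h2 : χ (A e) = 1 := χ.one_of_mem_closedBall (mem_closedBall_zero_iff.2 h1.le)
    beta_reduce
    rw [h2, one_smul, hψA]

end Foliation

end

/-! ### Representatives of cohomology and local primitives -/

section

namespace Foliation

variable {E H : Type*} [NormedAddCommGroup E] [NormedSpace ℝ E] [FiniteDimensional ℝ E]
  [TopologicalSpace H] {I : ModelWithCorners ℝ E H} [I.Boundaryless]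
  {M : Type*} [TopologicalSpace M] [ChartedSpace H M] [IsManifold I ∞ M]
  {E' H' : Type*} [NormedAddCommGroup E'] [NormedSpace ℝ E'] [FiniteDimensional ℝ E']
  [TopologicalSpace H'] {J : ModelWithCorners ℝ E' H'} [J.Boundaryless]
  {N : Type*} [TopologicalSpace N] [ChartedSpace H' N] [IsManifold J ∞ N]
  [T2Space M] [T2Space N]
  {F : Foliation I M} {G : Foliation J N} {p q m : ℕ}

/-- Closed forms which represent a basis of the cohomology, together with linear functionals which
compute the coefficients of cohomology classes with respect to this basis. -/
structure Representatives (G : Foliation J N) (q : ℕ) where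
  /-- the dimension of the cohomology -/
  rank : ℕ
  /-- the representatives -/
  form : Fin rank → G.Form q
  /-- the coefficients -/
  coef : Fin rank → G.Form q →ₗ[ℝ] ℝ
  d_form : ∀ s, G.d q (form s) = 0
  coef_form : ∀ s r, coef s (form r) = if s = r then 1 else 0
  coef_coboundary : ∀ s, ∀ β ∈ G.coboundaries q, coef s β = 0
  sub_mem : ∀ β, G.d q β = 0 → β - ∑ s, coef s β • form s ∈ G.coboundaries q

namespace Representatives

theorem coef_sum (R : G.Representatives q) (s : Fin R.rank) (a : Fin R.rank → ℝ) :
    R.coef s (∑ r, a r • R.form r) = a s := by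
  simp [R.coef_form]

theorem coef_d (R : G.Representatives (q + 1)) (s : Fin R.rank) (η : G.Form q) :
    R.coef s (G.d q η) = 0 :=
  R.coef_coboundary s _ (mem_coboundaries_succ_iff.2 ⟨η, rfl⟩)

variable [SecondCountableTopology N]

/-- The coefficients of the classes of a smooth family of closed forms are smooth. -/
theorem exists_contDiff_coef (R : G.Representatives q) (s : Fin R.rank) {d : ℕ}
    {f : (Fin d → ℝ) → G.Form q} (hf : SmoothFamily f) (hs : SmallSupport f)
    (hd : ∀ x, G.d q (f x) = 0) :
    ∃ c : (Fin d → ℝ) → ℝ, ContDiff ℝ ∞ c ∧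
      ∀ x : Fin d → ℝ, (∀ i, |x i| < 1 / 2) → R.coef s (f x) = c x := by
  cases q with
  | zero =>
    obtain ⟨c, hc, hfc⟩ := exists_smooth_coefficients (h := R.form) R.d_form
      (fun β hβ => ⟨fun s => R.coef s β, (sub_eq_zero.1 (R.sub_mem β hβ)).symm⟩) hf hs hd
    exact ⟨c s, hc s, fun x hx => by rw [hfc x hx, R.coef_sum]⟩
  | succ q =>
    obtain ⟨c, η, hc, -, hfc⟩ := exists_smooth_primitive (h := R.form) R.d_form
      (fun β hβ => by
        obtain ⟨y, hy⟩ := mem_coboundaries_succ_iff.1 (R.sub_mem β hβ)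
        exact ⟨fun s => R.coef s β, y, by rw [hy]; exact add_sub_cancel _ _⟩) hf hs hd
    exact ⟨c s, hc s, fun x hx => by rw [hfc x hx, map_add, R.coef_sum, R.coef_d, add_zero]⟩

/-- A smooth family of exact forms has a smooth family of primitives. -/
theorem exists_primitive (R : G.Representatives (q + 1)) {d : ℕ}
    {f : (Fin d → ℝ) → G.Form (q + 1)} (hf : SmoothFamily f) (hs : SmallSupport f)
    (hd : ∀ x, f x ∈ G.coboundaries (q + 1)) :
    ∃ η : (Fin d → ℝ) → G.Form q,
      (∀ x : Fin d → ℝ, (∀ i, |x i| < 1 / 2) → ∀ y : N, ∃ κ : G.FoliatedChart,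
        y ∈ κ.chart.source ∧
        ContDiffAt ℝ ∞ (fun p : (Fin d → ℝ) × E' => κ.rep (η p.1).1 p.2) (x, κ.ext y)) ∧
      ∀ x : Fin d → ℝ, (∀ i, |x i| < 1 / 2) → f x = G.d q (η x) := by
  obtain ⟨c, η, hc, hη, hfc⟩ := exists_smooth_primitive (h := R.form) R.d_form
    (fun β hβ => by
      obtain ⟨y, hy⟩ := mem_coboundaries_succ_iff.1 (R.sub_mem β hβ)
      exact ⟨fun s => R.coef s β, y, by rw [hy]; exact add_sub_cancel _ _⟩) hf hs
    (fun x => by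
      obtain ⟨y, hy⟩ := mem_coboundaries_succ_iff.1 (hd x)
      rw [← hy]
      exact d_d y)
  refine ⟨η, hη, fun x hx => ?_⟩
  -- The functionals kill exact forms and recover `c s x` from the decomposition.
  have h0 : ∀ s, c s x = 0 := fun s => by
    have h1 := R.coef_coboundary s _ (hd x)
    rwa [hfc x hx, map_add, R.coef_sum, R.coef_d, add_zero] at h1
  rw [hfc x hx]
  simp [h0]

/-- The coefficients of the classes of the slices of a form are smooth. -/
theorem contract_mem (R : G.Representatives q) (h : p + q = m) (τ : (F.prod G).Form m)
    (hτ : ∀ (x : M) (u : Fin p → F.tangent x), G.d q (slice h τ u) = 0) (s : Fin R.rank) :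
    contract h τ (R.coef s) ∈ F.formSubmodule p := by
  refine FoliatedChart.mem_formSubmodule fun x => ?_
  obtain ⟨c, hx⟩ := F.exists_foliatedChart_at x
  refine ⟨c, hx, contDiffAt_alternating fun w => ?_⟩
  obtain ⟨A, f, U, hA, hf, hs, hfs, hU, hxU, hUt, hAf⟩ :=
    exists_slice_family h τ c (n := 1) (fun _ => w) hx
  obtain ⟨a, ha, hfa⟩ := R.exists_contDiff_coef s (hf 0) (hs 0) fun t => by
    obtain ⟨r, e, hre⟩ := hfs 0 t
    rw [hre, map_smul, frameSlice, hτ, smul_zero]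
  refine (ha.comp hA).contDiffAt.congr_of_eventuallyEq ?_
  filter_upwards [hU.mem_nhds hxU] with e he
  rw [rep_contract, ← (hAf e he).2 0]
  exact hfa _ (hAf e he).1

end Representatives

/-- The map which takes a form on a product to a slice. -/
def sliceMap (h : p + q = m) {x : M} (u : Fin p → F.tangent x) : (F.prod G).Form m →ₗ[ℝ] G.Form q where
  toFun τ := slice h τ u
  map_add' _ _ := rfl
  map_smul' _ _ := rfl

theorem sliceMap_apply (h : p + q = m) {x : M} (u : Fin p → F.tangent x) (τ : (F.prod G).Form m) :
    sliceMap h u τ = slice h τ u := rfl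

/-- A form on a product given by a family of forms on the second factor. -/
theorem exists_family_form (h : p + q = m) (c : F.FoliatedChart) {V : Set M}
    (hV : V ⊆ c.chart.source) {ρ : M → ℝ} (hρ : ContMDiff I 𝓘(ℝ, ℝ) ∞ ρ) (hρV : tsupport ρ ⊆ V)
    (θ : E [⋀^Fin p]→L[ℝ] ℝ) (η : M → G.Form q)
    (hη : ∀ x ∈ V, ∀ y, ∃ κ : G.FoliatedChart, y ∈ κ.chart.source ∧ ContDiffAt ℝ ∞
      (fun P : E × E' => κ.rep (η (c.ext.symm P.1)).1 P.2) (c.ext x, κ.ext y)) :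
    ∃ ζ : (F.prod G).Form m, (∀ P, ρ P.1 = 0 → ζ.1 P = 0) ∧ ζ ∈ filtration F G m p ∧
      ∀ (x : M) (u : Fin p → F.tangent x),
        slice h ζ u = (ρ x * θ fun i => c.coframe x (u i)) • η x := by
  let Θ : ∀ x, (F.tangent x) [⋀^Fin p]→ₗ[ℝ] ℝ := fun x =>
    ρ x • θ.toAlternatingMap.compLinearMap (c.coframe x)
  have hzero : ∀ P : M × N, ρ P.1 = 0 → crossFun h Θ (fun x => (η x).1) P = 0 := by
    intro P hP
    refine alternating_ext_mixed fun a b hab u v => ?_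
    by_cases ha : a = p
    · subst ha
      obtain rfl : b = q := by omega
      refine (crossAt_mixed h _ _ u v).trans ?_
      have : Θ P.1 u = 0 := by
        change ρ P.1 * _ = 0
        rw [hP, zero_mul]
      exact (congrArg (· * _) this).trans (zero_mul _)
    · exact crossAt_mixed_of_ne h hab ha _ _ u v
  have hmem : crossFun h Θ (fun x => (η x).1) ∈ (F.prod G).formSubmodule m := by
    refine FoliatedChart.mem_formSubmodule fun P => ?_
    by_cases hP : P.1 ∈ tsupport ρ
    · obtain ⟨κ, hκ, hηκ⟩ := hη P.1 (hρV hP) P.2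
      have hx := hV (hρV hP)
      refine ⟨c.prod κ, c.mem_prod_source κ hx hκ,
        contDiffAt_rep_crossFun h c κ (c.ext_mem hx) (κ.ext_mem hκ) ?_ hηκ⟩
      have h1 : ContDiffAt ℝ ∞ (ρ ∘ c.ext.symm) (c.ext P.1) := by
        rw [← contMDiffAt_iff_contDiffAt]
        exact hρ.contMDiffAt.comp _ (c.contMDiffAt_symm (c.ext_mem hx))
      have h2 : ContDiffAt ℝ ∞ (fun e => (ρ ∘ c.ext.symm) e • θ.compContinuousLinearMap c.proj)
        (c.ext P.1) := h1.smul contDiffAt_const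
      refine h2.congr_of_eventuallyEq ?_
      filter_upwards [c.isOpen_target.mem_nhds (c.ext_mem hx)] with e he
      ext w
      change ρ _ * θ (fun i => c.coframe _ (c.frame _ (w i))) = ρ _ * θ (fun i => c.proj (w i))
      simp only [c.coframe_frame (c.symm_mem he)]
    -- Off the support of `ρ` the form is zero near `P`, so any chart serves and nothing need be
    -- known about `η`.
    · obtain ⟨c₁, hc₁⟩ := (F.prod G).exists_foliatedChart_at P
      refine ⟨c₁, hc₁, ?_⟩
      refine (contDiffAt_const (c := (0 : (E × E') [⋀^Fin m]→L[ℝ] ℝ))).congr_of_eventuallyEq ?_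
      have h1 : ContinuousAt c₁.ext.symm (c₁.ext P) :=
        (c₁.contMDiffAt_symm (c₁.ext_mem hc₁)).continuousAt
      have h2 : ∀ᶠ Q in 𝓝 P, Q.1 ∈ (tsupport ρ)ᶜ :=
        continuous_fst.continuousAt.eventually ((isClosed_tsupport ρ).isOpen_compl.mem_nhds hP)
      have h3 : ∀ᶠ e in 𝓝 (c₁.ext P), (c₁.ext.symm e).1 ∈ (tsupport ρ)ᶜ := by
        refine h1.eventually (p := fun Q : M × N => Q.1 ∈ (tsupport ρ)ᶜ) ?_
        rw [c₁.symm_ext hc₁]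
        exact h2
      filter_upwards [h3] with e he
      ext w
      have h4 := hzero (c₁.ext.symm e) (image_eq_zero_of_notMem_tsupport he)
      refine (c₁.rep_apply _ e w).trans ?_
      rw [h4]
      rfl
  refine ⟨⟨_, hmem⟩, hzero, fun a b hab ha x y u v =>
    crossAt_mixed_of_ne h hab (by omega) _ _ u v, fun x u => form_ext fun y => ?_⟩
  ext v
  exact crossAt_mixed h _ _ u v

/-- Locally, a form with exact slices has a primitive up to forms with more vectors of the first
factor. -/
theorem exists_local_primitive [SecondCountableTopology N] (R : G.Representatives (q + 1))
    (h : p + (q + 1) = m + 1) (h' : p + q = m) (τ : (F.prod G).Form (m + 1))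
    (hτ : ∀ (x : M) (u : Fin p → F.tangent x), slice h τ u ∈ G.coboundaries (q + 1)) (x₀ : M) :
    ∃ V : Set M, IsOpen V ∧ x₀ ∈ V ∧ ∀ ρ : M → ℝ, ContMDiff I 𝓘(ℝ, ℝ) ∞ ρ → tsupport ρ ⊆ V →
      ∃ ζ : (F.prod G).Form m, (∀ P, ρ P.1 = 0 → ζ.1 P = 0) ∧ ζ ∈ filtration F G m p ∧
        ∀ (x : M) (u : Fin p → F.tangent x), G.d q (slice h' ζ u) = ρ x • slice h τ u := by
  obtain ⟨c, hx₀⟩ := F.exists_foliatedChart_at x₀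
  obtain ⟨n, t, θ, hθ⟩ := exists_alternating_reproducing E p
  obtain ⟨A, f, U, hA, hf, hs, hfs, hU, hxU, hUt, hAf⟩ := exists_slice_family h τ c t hx₀
  choose η hη hfη using fun j => R.exists_primitive (hf j) (hs j) fun x => by
    obtain ⟨r, e, hre⟩ := hfs j x
    rw [hre]
    exact Submodule.smul_mem _ _ (hτ _ _)
  refine ⟨c.chart.source ∩ c.ext ⁻¹' U, ?_, ⟨hx₀, hxU⟩, fun ρ hρ hρV => ?_⟩
  · exact ContinuousOn.isOpen_inter_preimage
      (fun x hx => (c.contMDiffAt_ext hx).continuousAt.continuousWithinAt) c.isOpen_source hU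
  -- Crossing `ρ θ_j` with the primitives `η j` and summing over `j` gives a form whose slices have
  -- `ρ` times the slices of `τ` as derivatives, by `slice_eq_sum`.
  choose ζ hζ0 hζf hζs using fun j => exists_family_form h' c (G := G) inter_subset_left hρ hρV (θ j)
    (fun x => η j (A (c.ext x))) (fun x hx y => by
      obtain ⟨κ, hκ, hκη⟩ := hη j (A (c.ext x)) (hAf _ hx.2).1 y
      refine ⟨κ, hκ, ?_⟩
      have h1 : ContDiffAt ℝ ∞ (fun P : E × E' => κ.rep (η j (A P.1)).1 P.2) (c.ext x, κ.ext y) :=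
        ContDiffAt.comp (g := fun P : (Fin (Module.finrank ℝ E) → ℝ) × E' => κ.rep (η j P.1).1 P.2)
          (f := fun P : E × E' => (A P.1, P.2)) (c.ext x, κ.ext y) hκη
          ((hA.comp contDiff_fst).contDiffAt.prodMk contDiffAt_snd)
      refine h1.congr_of_eventuallyEq ?_
      have h2 : ∀ᶠ P : E × E' in 𝓝 (c.ext x, κ.ext y), P.1 ∈ c.ext.target :=
        continuous_fst.continuousAt.eventually (c.isOpen_target.mem_nhds (c.ext_mem hx.1))
      filter_upwards [h2] with P hP
      rw [c.ext_symm hP])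
  refine ⟨∑ j, ζ j, fun P hP => ?_, Submodule.sum_mem _ fun j _ => hζf j, fun x u => ?_⟩
  · let ev : (F.prod G).Form m →ₗ[ℝ] (((F.prod G).tangent P) [⋀^Fin m]→ₗ[ℝ] ℝ) :=
      { toFun := fun β => β.1 P, map_add' := fun _ _ => rfl, map_smul' := fun _ _ => rfl }
    have h1 : ev (∑ j, ζ j) = 0 := by
      rw [map_sum]
      exact Finset.sum_eq_zero fun j _ => hζ0 j P hP
    exact h1
  · rw [← sliceMap_apply, map_sum]
    simp only [sliceMap_apply, hζs]
    rw [map_sum]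
    simp only [map_smul]
    by_cases hx : x ∈ tsupport ρ
    · have hxV := hρV hx
      rw [slice_eq_sum h τ c hθ hxV.1 u, Finset.smul_sum]
      refine Finset.sum_congr rfl fun j _ => ?_
      rw [← hfη j _ (hAf _ hxV.2).1, (hAf _ hxV.2).2, mul_smul]
    · simp [image_eq_zero_of_notMem_tsupport hx]

end Foliation

end

/-! ### Gluing over the first factor and the reduction step -/

section

namespace Foliation

variable {E H : Type*} [NormedAddCommGroup E] [NormedSpace ℝ E] [FiniteDimensional ℝ E]
  [TopologicalSpace H] {I : ModelWithCorners ℝ E H} [I.Boundaryless]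
  {M : Type*} [TopologicalSpace M] [ChartedSpace H M] [IsManifold I ∞ M]
  {E' H' : Type*} [NormedAddCommGroup E'] [NormedSpace ℝ E'] [FiniteDimensional ℝ E']
  [TopologicalSpace H'] {J : ModelWithCorners ℝ E' H'} [J.Boundaryless]
  {N : Type*} [TopologicalSpace N] [ChartedSpace H' N] [IsManifold J ∞ N]
  [T2Space M] [T2Space N]
  {F : Foliation I M} {G : Foliation J N} {p q m k : ℕ}

theorem alternatingMap_sum_apply {V ι : Type*} [AddCommGroup V] [Module ℝ V] (s : Finset ι)
    (f : ι → V [⋀^Fin m]→ₗ[ℝ] ℝ) (v : Fin m → V) : (∑ i ∈ s, f i) v = ∑ i ∈ s, f i v := by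
  let ev : (V [⋀^Fin m]→ₗ[ℝ] ℝ) →+ ℝ :=
    { toFun := fun g => g v, map_zero' := rfl, map_add' := fun _ _ => rfl }
  exact map_sum ev f s

/-- The value of a form at a point. -/
def evalAt (m : ℕ) (x : M) : F.Form m →ₗ[ℝ] ((F.tangent x) [⋀^Fin m]→ₗ[ℝ] ℝ) where
  toFun τ := τ.1 x
  map_add' _ _ := rfl
  map_smul' _ _ := rfl

/-- Forms on a product can be glued along a partition of unity of the first factor. -/
theorem exists_glue {ι : Type*} (ρ : SmoothPartitionOfUnity ι I M univ)
    (ζ : ι → (F.prod G).Form m) (h0 : ∀ i P, ρ i P.1 = 0 → (ζ i).1 P = 0) :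
    ∃ ξ : (F.prod G).Form m, ∀ P, ξ.1 P = ∑ i ∈ ρ.finsupport P.1, (ζ i).1 P := by
  refine ⟨⟨fun P => ∑ i ∈ ρ.finsupport P.1, (ζ i).1 P, fun X => ?_⟩, fun P => rfl⟩
  have h1 : ContMDiff (I.prod J) 𝓘(ℝ, ℝ) ∞ fun P => ∑ᶠ i, (F.prod G).eval (ζ i).1 X P := by
    refine contMDiff_finsum (fun i => (ζ i).2 X) ?_
    refine (ρ.locallyFinite.preimage_continuous (continuous_fst (Y := N))).subset fun i P hP => ?_
    intro h
    refine hP ?_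
    change (ζ i).1 P _ = 0
    rw [h0 i P h]
    rfl
  convert h1 using 1
  funext P
  rw [finsum_eq_sum_of_support_subset (s := ρ.finsupport P.1)]
  · exact alternatingMap_sum_apply _ _ _
  · intro i hi
    rw [ρ.coe_finsupport]
    intro h
    refine hi ?_
    change (ζ i).1 P _ = 0
    rw [h0 i P h]
    rfl

variable [SecondCountableTopology M] [SecondCountableTopology N]

/-- A form on a product with exact slices is the leading part of an exact form. -/
theorem exists_slice_primitive (R : G.Representatives (q + 1))
    (h : p + (q + 1) = m + 1) (h' : p + q = m) (τ : (F.prod G).Form (m + 1))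
    (hτ : ∀ (x : M) (u : Fin p → F.tangent x), slice h τ u ∈ G.coboundaries (q + 1)) :
    ∃ ξ ∈ filtration F G m p, ∀ (x : M) (u : Fin p → F.tangent x),
      G.d q (slice h' ξ u) = slice h τ u := by
  have : LocallyCompactSpace H := I.locallyCompactSpace
  have : LocallyCompactSpace M := ChartedSpace.locallyCompactSpace H M
  choose V hV hxV hloc using exists_local_primitive R h h' τ hτ
  obtain ⟨ρ, hρ⟩ := SmoothPartitionOfUnity.exists_isSubordinate I isClosed_univ V hV
    fun x _ => mem_iUnion.2 ⟨x, hxV x⟩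
  choose ζ hζ0 hζf hζs using fun i => hloc i (ρ i) (ρ i).contMDiff (hρ i)
  obtain ⟨ξ, hξ⟩ := exists_glue ρ ζ hζ0
  refine ⟨ξ, fun a b hab ha x y u v => ?_, fun x u => ?_⟩
  · rw [hξ]
    refine (alternatingMap_sum_apply _ _ _).trans (Finset.sum_eq_zero fun i _ => ?_)
    exact hζf i a b hab ha x y u v
  · have h1 : slice h' ξ u = ∑ i ∈ ρ.finsupport x, sliceMap h' u (ζ i) := by
      refine form_ext fun y => ?_
      ext v
      rw [slice_apply, hξ]
      refine (alternatingMap_sum_apply _ _ _).trans ?_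
      have h2 := congrArg (fun T => T v) (map_sum (evalAt (F := G) q y)
        (fun i => sliceMap h' u (ζ i)) (ρ.finsupport x))
      refine Eq.trans ?_ h2.symm
      exact (alternatingMap_sum_apply (ρ.finsupport x)
        (fun i => evalAt q y (sliceMap h' u (ζ i))) v).symm
    rw [h1, map_sum]
    -- The functions `ρ i` depend on the first variable only, so along the second factor they are
    -- constants, and they add up to one.
    simp only [sliceMap_apply, hζs]
    rw [← Finset.sum_smul, ρ.sum_finsupport x (mem_univ x), one_smul]

theorem filtration_mono {p' : ℕ} (hp : p ≤ p') : filtration F G m p' ≤ filtration F G m p :=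
  fun _ hτ a b hab ha => hτ a b hab (ha.trans_le hp)

theorem mem_filtration_succ (h : p + q = m) {τ : (F.prod G).Form m} (hτ : τ ∈ filtration F G m p)
    (h0 : ∀ (x : M) (u : Fin p → F.tangent x), slice h τ u = 0) : τ ∈ filtration F G m (p + 1) := by
  intro a b hab ha x y u v
  rcases Nat.lt_succ_iff_lt_or_eq.1 ha with ha | rfl
  · exact hτ a b hab ha x y u v
  · obtain rfl : b = q := by omega
    rw [← slice_apply, h0]
    rfl

theorem filtration_eq_zero {τ : (F.prod G).Form m} (hτ : τ ∈ filtration F G m (m + 1)) : τ = 0 :=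
  form_ext_mixed fun x y a b hab u v => hτ a b hab (by omega) x y u v

theorem slice_eq_zero_of_mem_filtration {a b : ℕ} (hab : a + b = m) (ha : a < p)
    {τ : (F.prod G).Form m} (hτ : τ ∈ filtration F G m p) {x : M} (u : Fin a → F.tangent x) :
    slice hab τ u = 0 :=
  form_ext fun y => AlternatingMap.ext fun v => hτ a b hab ha x y u v

theorem d_mem_filtration {τ : (F.prod G).Form m} (hτ : τ ∈ filtration F G m p) :
    (F.prod G).d m τ ∈ filtration F G (m + 1) p := by
  intro a b hab ha x y u v
  by_cases hb : b = 0
  -- Without vectors of the second factor, `m + 1 = a < p`, and a form of degree `m` in that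
  -- filtration step is zero.
  · subst hb
    have h0 : τ = 0 := filtration_eq_zero (filtration_mono (by omega) hτ)
    rw [h0, map_zero]
    rfl
  · obtain ⟨b, rfl⟩ := Nat.exists_eq_succ_of_ne_zero hb
    rw [d_mixed_leading hab (by omega) (filtration_mono ha.le hτ),
      slice_eq_zero_of_mem_filtration (by omega) ha hτ, map_zero]
    exact mul_zero _

theorem slice_d (h : p + (q + 1) = m + 1) (hpq : p + q = m) {τ : (F.prod G).Form m}
    (hτ : τ ∈ filtration F G m p) {x : M} (u : Fin p → F.tangent x) :
    slice h ((F.prod G).d m τ) u = (-1 : ℝ) ^ p • G.d q (slice hpq τ u) :=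
  form_ext fun _ => AlternatingMap.ext fun v => d_mixed_leading h hpq hτ u v

/-- Up to an exact form and cross products, a form with closed slices contains more vectors of the
first factor. -/
theorem exists_reduction (R : G.Representatives q) (h : p + q = m) {τ : (F.prod G).Form m}
    (hτ : τ ∈ filtration F G m p)
    (hd : ∀ (x : M) (u : Fin p → F.tangent x), G.d q (slice h τ u) = 0) :
    ∃ (b : Fin R.rank → F.Form p) (ξ : (F.prod G).Form m), ξ ∈ (F.prod G).coboundaries m ∧
      τ - ∑ s, cross h (b s) (R.form s) - ξ ∈ filtration F G m (p + 1) := by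
  let b : Fin R.rank → F.Form p := fun s => ⟨contract h τ (R.coef s), R.contract_mem h τ hd s⟩
  have hb : ∀ s x (u : Fin p → F.tangent x), (b s).1 x u = R.coef s (slice h τ u) :=
    fun _ _ _ => rfl
  set τ' := τ - ∑ s, cross h (b s) (R.form s) with hτ'
  have hf : τ' ∈ filtration F G m p :=
    Submodule.sub_mem _ hτ (Submodule.sum_mem _ fun s _ => cross_mem_filtration h _ _ le_rfl)
  have hs : ∀ (x : M) (u : Fin p → F.tangent x), slice h τ' u ∈ G.coboundaries q := by
    intro x u
    have h1 : slice h τ' u = slice h τ u - ∑ s, R.coef s (slice h τ u) • R.form s := by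
      rw [← sliceMap_apply, hτ', map_sub, map_sum]
      simp only [sliceMap_apply, slice_cross, hb]
    rw [h1]
    exact R.sub_mem _ (hd x u)
  refine ⟨b, ?_⟩
  cases q with
  | zero =>
    -- In degree zero exact means zero, so the slices already vanish.
    refine ⟨0, Submodule.zero_mem _, ?_⟩
    rw [sub_zero]
    exact mem_filtration_succ h hf fun x u => hs x u
  | succ q =>
    obtain _ | m := m
    · omega
    obtain ⟨η, hη, hηs⟩ := exists_slice_primitive R h (by omega) τ' hs
    -- The sign cancels the one which `slice_d` produces.
    refine ⟨(-1 : ℝ) ^ p • (F.prod G).d m η,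
      Submodule.smul_mem _ _ (mem_coboundaries_succ_iff.2 ⟨η, rfl⟩), ?_⟩
    refine mem_filtration_succ h
      (Submodule.sub_mem _ hf (Submodule.smul_mem _ _ (d_mem_filtration hη))) fun x u => ?_
    rw [← sliceMap_apply, map_sub, map_smul, sliceMap_apply, sliceMap_apply,
      slice_d h (by omega) hη, hηs, smul_smul, ← mul_pow]
    simp [τ']

end Foliation

end

/-! ### Reduction to cross products with representatives -/

section

namespace Foliation

variable {E H : Type*} [NormedAddCommGroup E] [NormedSpace ℝ E] [FiniteDimensional ℝ E]
  [TopologicalSpace H] {I : ModelWithCorners ℝ E H} [I.Boundaryless]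
  {M : Type*} [TopologicalSpace M] [ChartedSpace H M] [IsManifold I ∞ M]
  {E' H' : Type*} [NormedAddCommGroup E'] [NormedSpace ℝ E'] [FiniteDimensional ℝ E']
  [TopologicalSpace H'] {J : ModelWithCorners ℝ E' H'} [J.Boundaryless]
  {N : Type*} [TopologicalSpace N] [ChartedSpace H' N] [IsManifold J ∞ N]
  [T2Space M] [T2Space N]
  {F : Foliation I M} {G : Foliation J N} {p q m k : ℕ}

theorem d_eq_zero_of_mem_coboundaries {α : F.Form k} (hα : α ∈ F.coboundaries k) :
    F.d k α = 0 := by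
  cases k with
  | zero =>
    rw [show α = 0 from hα, map_zero]
  | succ k =>
    obtain ⟨β, rfl⟩ := mem_coboundaries_succ_iff.1 hα
    exact d_d β

theorem toCohomology_eq_zero_iff {α : F.cocycles k} :
    F.toCohomology k α = 0 ↔ α.1 ∈ F.coboundaries k :=
  Submodule.Quotient.mk_eq_zero _

theorem toCohomology_surjective : Function.Surjective (F.toCohomology k) :=
  Submodule.mkQ_surjective _

/-- The coordinates of a basis of the cohomology are pulled back to cocycles and extended linearly
to all forms in an arbitrary way. No continuity is needed, since smoothness of coefficients is
proved by lifting Fourier series. -/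
theorem nonempty_representatives [FiniteDimensional ℝ (G.Cohomology q)] :
    Nonempty (G.Representatives q) := by
  let b := Module.finBasis ℝ (G.Cohomology q)
  choose z hz using fun s => toCohomology_surjective (F := G) (b s)
  choose g hg using fun s => LinearMap.exists_extend ((b.coord s).comp (G.toCohomology q))
  have hg' : ∀ s (β : G.cocycles q), g s β.1 = b.coord s (G.toCohomology q β) := fun s β =>
    LinearMap.congr_fun (hg s) β
  refine ⟨⟨_, fun s => (z s).1, g, fun s => mem_cocycles_iff.1 (z s).2, fun s r => ?_,
    fun s β hβ => ?_, fun β hβ => ?_⟩⟩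
  · rw [hg', hz, b.coord_apply, b.repr_self, Finsupp.single_apply]
    simp only [eq_comm]
  · have h1 := hg' s ⟨β, mem_cocycles_iff.2 (d_eq_zero_of_mem_coboundaries hβ)⟩
    rw [toCohomology_eq_zero_iff.2 hβ, map_zero] at h1
    exact h1
  · let β' : G.cocycles q := ⟨β, mem_cocycles_iff.2 hβ⟩
    have h1 : G.toCohomology q (β' - ∑ s, g s β • z s) = 0 := by
      rw [map_sub, map_sum, sub_eq_zero]
      refine (b.sum_repr _).symm.trans (Finset.sum_congr rfl fun s _ => ?_)
      rw [map_smul, hz, ← b.coord_apply, ← hg']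
    have h2 := toCohomology_eq_zero_iff.1 h1
    simpa using h2

theorem slice_cross_of_ne {i j : ℕ} (h : p + q = m) (h' : i + j = m) (hne : p ≠ i) (α : F.Form i)
    (β : G.Form j) {x : M} (u : Fin p → F.tangent x) : slice h (cross h' α β) u = 0 :=
  form_ext fun _ => AlternatingMap.ext fun v => cross_mixed_of_ne h' h hne α β _ _ u v

/-- The span of the cross products with the representatives of the cohomology. -/
def crossSpan (F : Foliation I M) (R : ∀ j ≤ k, G.Representatives j) (m : ℕ) :
    Submodule ℝ ((F.prod G).Form m) :=
  Submodule.span ℝ {τ | ∃ (i j : ℕ) (h : i + j = m) (hj : j ≤ k) (α : F.Form i)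
    (s : Fin (R j hj).rank), τ = cross h α ((R j hj).form s)}

theorem cross_mem_crossSpan (R : ∀ j ≤ k, G.Representatives j) {i j : ℕ} (h : i + j = m)
    (hj : j ≤ k) (α : F.Form i) (s : Fin (R j hj).rank) :
    cross h α ((R j hj).form s) ∈ crossSpan F R m :=
  Submodule.subset_span ⟨i, j, h, hj, α, s, rfl⟩

/-- Slices of combinations of cross products with representatives are exact only if they vanish. -/
theorem slice_eq_zero_of_mem_crossSpan (R : ∀ j ≤ k, G.Representatives j)
    {ζ : (F.prod G).Form m} (hζ : ζ ∈ crossSpan F R m) (h : p + q = m) {x : M}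
    (u : Fin p → F.tangent x) (hu : slice h ζ u ∈ G.coboundaries q) : slice h ζ u = 0 := by
  by_cases hq : q ≤ k
  -- The slice is a combination of representatives, whose coefficients are detected by functionals
  -- killing exact forms.
  · have h1 : crossSpan F R m ≤
        (Submodule.span ℝ (range (R q hq).form)).comap (sliceMap h u) := by
      refine Submodule.span_le.2 ?_
      rintro _ ⟨i, j, h', hj, α, s, rfl⟩
      rw [SetLike.mem_coe, Submodule.mem_comap, sliceMap_apply]
      by_cases hi : p = i
      · subst hi
        obtain rfl : j = q := by omega
        rw [slice_cross]
        exact Submodule.smul_mem _ _ (Submodule.subset_span ⟨s, rfl⟩)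
      · rw [slice_cross_of_ne h h' hi]
        exact Submodule.zero_mem _
    obtain ⟨a, ha⟩ := (Submodule.mem_span_range_iff_exists_fun ℝ).1 (h1 hζ)
    rw [sliceMap_apply] at ha
    have h2 : ∀ s, a s = 0 := fun s => by
      rw [← (R q hq).coef_sum s a, ha]
      exact (R q hq).coef_coboundary s _ hu
    rw [← ha]
    simp [h2]
  -- Representatives have degree at most `k`, so slices of higher degree are zero.
  · have h1 : crossSpan F R m ≤ LinearMap.ker (sliceMap h u) := by
      refine Submodule.span_le.2 ?_
      rintro _ ⟨i, j, h', hj, α, s, rfl⟩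
      exact slice_cross_of_ne h h' (by omega) _ _ u
    exact h1 hζ

variable [SecondCountableTopology M] [SecondCountableTopology N]

/-- A form whose derivative is a combination of cross products with representatives is itself such
a combination, up to an exact form. -/
theorem mem_coboundaries_sup_crossSpan (R : ∀ j ≤ k, G.Representatives j) (hm : m ≤ k)
    {τ : (F.prod G).Form m} (hd : (F.prod G).d m τ ∈ crossSpan F R (m + 1)) :
    τ ∈ (F.prod G).coboundaries m ⊔ crossSpan F R m := by
  -- The induction is on the number `r` of filtration steps left; step `m + 1` contains only zero.
  have key : ∀ (r p : ℕ), p + r = m + 1 → ∀ τ ∈ filtration F G m p,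
      (F.prod G).d m τ ∈ crossSpan F R (m + 1) →
      τ ∈ (F.prod G).coboundaries m ⊔ crossSpan F R m := by
    intro r
    induction r with
    | zero =>
      rintro p rfl τ hτ -
      rw [filtration_eq_zero hτ]
      exact Submodule.zero_mem _
    | succ r ih =>
      intro p hp τ hτ hd
      obtain ⟨q, h⟩ : ∃ q, p + q = m := ⟨m - p, by omega⟩
      -- The slice of `dτ` is exact, being `d_G` of a slice of `τ` up to sign, and it is a slice of
      -- a form in `crossSpan`; so it vanishes.
      have hcl : ∀ (x : M) (u : Fin p → F.tangent x), G.d q (slice h τ u) = 0 := by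
        intro x u
        have h1 := slice_d (p := p) (q := q) (by omega) h hτ u
        have h2 := slice_eq_zero_of_mem_crossSpan R hd (p := p) (q := q + 1) (by omega) u (by
          rw [h1]
          exact Submodule.smul_mem _ _ (mem_coboundaries_succ_iff.2 ⟨_, rfl⟩))
        rw [h1] at h2
        exact (smul_eq_zero.1 h2).resolve_left (pow_ne_zero _ (by norm_num))
      have hq : q ≤ k := by omega
      obtain ⟨b, ξ, hξ, hσ⟩ := exists_reduction (R q hq) h hτ hcl
      have hmem : ∑ s, cross h (b s) ((R q hq).form s) ∈ crossSpan F R m :=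
        Submodule.sum_mem _ fun s _ => cross_mem_crossSpan R h hq _ s
      -- Subtracting cross products changes `dτ`, but only within `crossSpan`, because the
      -- representatives are closed.
      have h3 := ih (p + 1) (by omega) _ hσ (by
        rw [map_sub, map_sub, d_eq_zero_of_mem_coboundaries hξ, sub_zero, map_sum]
        refine Submodule.sub_mem _ hd (Submodule.sum_mem _ fun s _ => ?_)
        rw [d_cross h (by omega) _ ((R q hq).d_form s)]
        exact cross_mem_crossSpan R _ hq _ s)
      have h4 := Submodule.add_mem _ (Submodule.add_mem _ h3 (Submodule.mem_sup_left hξ))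
        (Submodule.mem_sup_right hmem)
      simpa using h4
  exact key (m + 1) 0 (by omega) τ (fun a b hab ha => absurd ha (Nat.not_lt_zero a)) hd

/-- The coefficients of the derivative of a combination of cross products with representatives are
exact. -/
theorem exists_coboundary_coef_d (R : ∀ j ≤ k, G.Representatives j) {τ : (F.prod G).Form m}
    (hτ : τ ∈ crossSpan F R m) {i j : ℕ} (h : i + j = m + 1) (hj : j ≤ k)
    (s : Fin (R j hj).rank) :
    ∃ β ∈ F.coboundaries i, ∀ (x : M) (u : Fin i → F.tangent x),
      (R j hj).coef s (slice h ((F.prod G).d m τ) u) = β.1 x u := by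
  induction hτ using Submodule.span_induction with
  | mem τ hτ =>
    obtain ⟨i', j', h', hj', α, r, rfl⟩ := hτ
    rw [d_cross h' (by omega) α ((R j' hj').d_form r)]
    by_cases hi : i = i' + 1
    · subst hi
      obtain rfl : j = j' := by omega
      refine ⟨(if s = r then (1 : ℝ) else 0) • F.d i' α,
        Submodule.smul_mem _ _ (mem_coboundaries_succ_iff.2 ⟨α, rfl⟩), fun x u => ?_⟩
      rw [slice_cross, map_smul, (R j hj).coef_form]
      exact mul_comm _ _
    · refine ⟨0, Submodule.zero_mem _, fun x u => ?_⟩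
      rw [slice_cross_of_ne h _ hi, map_zero]
      rfl
  | zero =>
    refine ⟨0, Submodule.zero_mem _, fun x u => ?_⟩
    rw [← sliceMap_apply, map_zero, map_zero, map_zero]
    rfl
  | add τ τ' _ _ h1 h2 =>
    obtain ⟨β, hβ, hβ'⟩ := h1
    obtain ⟨γ, hγ, hγ'⟩ := h2
    refine ⟨β + γ, Submodule.add_mem _ hβ hγ, fun x u => ?_⟩
    rw [← sliceMap_apply, map_add, map_add, map_add, sliceMap_apply, sliceMap_apply, hβ', hγ']
    rfl
  | smul r τ _ h1 =>
    obtain ⟨β, hβ, hβ'⟩ := h1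
    refine ⟨r • β, Submodule.smul_mem _ _ hβ, fun x u => ?_⟩
    rw [← sliceMap_apply, map_smul, map_smul, map_smul, sliceMap_apply, hβ']
    rfl

/-- Distinct summands have distinct degrees along the first factor, so slicing isolates one of them.
-/
theorem slice_sum_cross {ι : Type*} [Fintype ι] {i j : ι → ℕ} (h : ∀ P, i P + j P = m)
    (hi : Function.Injective i) {n : ι → ℕ} (A : ∀ P, Fin (n P) → F.Form (i P))
    (B : ∀ P, Fin (n P) → G.Form (j P)) (P : ι) {x : M} (u : Fin (i P) → F.tangent x) :
    slice (h P) (∑ P, ∑ s, cross (h P) (A P s) (B P s)) u = ∑ s, (A P s).1 x u • B P s := by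
  rw [← sliceMap_apply, map_sum, Finset.sum_eq_single P]
  · rw [map_sum]
    exact Finset.sum_congr rfl fun s _ => slice_cross _ _ _ u
  · intro Q _ hQ
    rw [map_sum]
    exact Finset.sum_eq_zero fun s _ =>
      slice_cross_of_ne _ _ (fun h' => hQ (hi h').symm) _ _ u
  · exact fun hP => absurd (Finset.mem_univ P) hP

end Foliation

end

/-! ### The cross product on cohomology and its bijectivity -/

section

namespace Foliation

variable {E H : Type*} [NormedAddCommGroup E] [NormedSpace ℝ E] [FiniteDimensional ℝ E]
  [TopologicalSpace H] {I : ModelWithCorners ℝ E H} [I.Boundaryless]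
  {M : Type*} [TopologicalSpace M] [ChartedSpace H M] [IsManifold I ∞ M]
  {E' H' : Type*} [NormedAddCommGroup E'] [NormedSpace ℝ E'] [FiniteDimensional ℝ E']
  [TopologicalSpace H'] {J : ModelWithCorners ℝ E' H'} [J.Boundaryless]
  {N : Type*} [TopologicalSpace N] [ChartedSpace H' N] [IsManifold J ∞ N]
  [T2Space M] [T2Space N]
  {F : Foliation I M} {G : Foliation J N} {i j k : ℕ}

/-- The cross product of cocycles. -/
def crossCocycle (h : i + j = k) :
    F.cocycles i →ₗ[ℝ] G.cocycles j →ₗ[ℝ] (F.prod G).cocycles k :=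
  LinearMap.mk₂ ℝ
    (fun α β => ⟨cross h α.1 β.1, mem_cocycles_iff.2 (by
      rw [d_cross h (by omega) _ (mem_cocycles_iff.1 β.2), mem_cocycles_iff.1 α.2, map_zero]
      rfl)⟩)
    (fun α α' β => Subtype.ext (by simp)) (fun r α β => Subtype.ext (by simp))
    (fun α β β' => Subtype.ext (by simp)) (fun r α β => Subtype.ext (by simp))

theorem coe_crossCocycle (h : i + j = k) (α : F.cocycles i) (β : G.cocycles j) :
    (crossCocycle h α β).1 = cross h α.1 β.1 := rfl

theorem cross_mem_coboundaries_of_left (h : i + j = k) {α : F.Form i} {β : G.Form j}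
    (hα : α ∈ F.coboundaries i) (hβ : G.d j β = 0) :
    cross h α β ∈ (F.prod G).coboundaries k := by
  cases i with
  | zero =>
    rw [show α = 0 from hα, map_zero]
    exact Submodule.zero_mem _
  | succ i =>
    obtain ⟨γ, rfl⟩ := mem_coboundaries_succ_iff.1 hα
    obtain _ | k := k
    · omega
    exact mem_coboundaries_succ_iff.2 ⟨cross (by omega) γ β, d_cross (by omega) h γ hβ⟩

theorem cross_mem_coboundaries_of_right (h : i + j = k) {α : F.Form i} {β : G.Form j}
    (hα : F.d i α = 0) (hβ : β ∈ G.coboundaries j) :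
    cross h α β ∈ (F.prod G).coboundaries k := by
  cases j with
  | zero =>
    rw [show β = 0 from hβ, map_zero]
    exact Submodule.zero_mem _
  | succ j =>
    obtain ⟨γ, rfl⟩ := mem_coboundaries_succ_iff.1 hβ
    obtain _ | k := k
    · omega
    refine mem_coboundaries_succ_iff.2 ⟨(-1 : ℝ) ^ i • cross (by omega) α γ, ?_⟩
    rw [map_smul, d_cross_eq_add (k := k) (by omega) (by omega) h, hα, map_zero,
      LinearMap.zero_apply, zero_add, smul_smul, ← mul_pow]
    simp

/-- The cross product of a cocycle and a cohomology class. -/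
def crossCocycleCohomology (h : i + j = k) :
    F.cocycles i →ₗ[ℝ] G.Cohomology j →ₗ[ℝ] (F.prod G).Cohomology k where
  toFun α := Submodule.liftQ _ (((F.prod G).toCohomology k).comp (crossCocycle h α)) fun β hβ =>
    toCohomology_eq_zero_iff.2 (cross_mem_coboundaries_of_right h (mem_cocycles_iff.1 α.2) hβ)
  map_add' α α' := Submodule.linearMap_qext _ (LinearMap.ext fun β => by
    change (F.prod G).toCohomology k (crossCocycle h (α + α') β) =
      (F.prod G).toCohomology k (crossCocycle h α β) +
        (F.prod G).toCohomology k (crossCocycle h α' β)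
    rw [map_add, LinearMap.add_apply, map_add])
  map_smul' r α := Submodule.linearMap_qext _ (LinearMap.ext fun β => by
    change (F.prod G).toCohomology k (crossCocycle h (r • α) β) =
      r • (F.prod G).toCohomology k (crossCocycle h α β)
    rw [map_smul, LinearMap.smul_apply, map_smul])

/-- The cross product of cohomology classes. -/
def crossCohomology (h : i + j = k) :
    F.Cohomology i →ₗ[ℝ] G.Cohomology j →ₗ[ℝ] (F.prod G).Cohomology k :=
  Submodule.liftQ _ (crossCocycleCohomology h) fun _ hα =>
    Submodule.linearMap_qext _ (LinearMap.ext fun β =>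
      toCohomology_eq_zero_iff.2 (cross_mem_coboundaries_of_left h hα (mem_cocycles_iff.1 β.2)))

theorem crossCohomology_toCohomology (h : i + j = k) (α : F.cocycles i) (β : G.cocycles j) :
    crossCohomology h (F.toCohomology i α) (G.toCohomology j β) =
      (F.prod G).toCohomology k (crossCocycle h α β) := rfl

/-- The cross product, on the sum of the tensor products of cohomology spaces. -/
def crossMap (F : Foliation I M) (G : Foliation J N) (k : ℕ) :
    (⨁ p : {p : ℕ × ℕ // p.1 + p.2 = k}, F.Cohomology p.1.1 ⊗[ℝ] G.Cohomology p.1.2) →ₗ[ℝ]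
      (F.prod G).Cohomology k :=
  DirectSum.toModule ℝ {p : ℕ × ℕ // p.1 + p.2 = k} _
    fun p => TensorProduct.lift (crossCohomology p.2)

theorem crossMap_lof (p : {p : ℕ × ℕ // p.1 + p.2 = k}) (α : F.cocycles p.1.1)
    (β : G.cocycles p.1.2) :
    crossMap F G k (DirectSum.lof ℝ {p : ℕ × ℕ // p.1 + p.2 = k}
      (fun p => F.Cohomology p.1.1 ⊗[ℝ] G.Cohomology p.1.2) p
      (F.toCohomology p.1.1 α ⊗ₜ[ℝ] G.toCohomology p.1.2 β)) =
      (F.prod G).toCohomology k (crossCocycle p.2 α β) := by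
  rw [crossMap, DirectSum.toModule_lof, TensorProduct.lift.tmul, crossCohomology_toCohomology]

/-- The representatives, as cocycles. -/
def Representatives.cocycle {q : ℕ} (R : G.Representatives q) (s : Fin R.rank) : G.cocycles q :=
  ⟨R.form s, mem_cocycles_iff.2 (R.d_form s)⟩

/-- This normal form lets an element of the direct sum be tested through the functionals `R.coef`.
-/
theorem Representatives.exists_tmul_eq_sum {q : ℕ} (R : G.Representatives q)
    (z : F.Cohomology i ⊗[ℝ] G.Cohomology q) :
    ∃ a : Fin R.rank → F.cocycles i,
      z = ∑ s, F.toCohomology i (a s) ⊗ₜ[ℝ] G.toCohomology q (R.cocycle s) := by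
  induction z using TensorProduct.induction_on with
  | zero => exact ⟨0, by simp⟩
  | tmul x y =>
    obtain ⟨α, rfl⟩ := toCohomology_surjective x
    obtain ⟨β, rfl⟩ := toCohomology_surjective y
    refine ⟨fun s => R.coef s β.1 • α, ?_⟩
    have h1 : G.toCohomology q (β - ∑ s, R.coef s β.1 • R.cocycle s) = 0 := by
      rw [toCohomology_eq_zero_iff]
      have h2 := R.sub_mem β.1 (mem_cocycles_iff.1 β.2)
      simpa [Representatives.cocycle] using h2
    rw [map_sub, sub_eq_zero] at h1
    rw [h1, map_sum, TensorProduct.tmul_sum]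
    simp only [map_smul, TensorProduct.tmul_smul, TensorProduct.smul_tmul']
  | add x y hx hy =>
    obtain ⟨a, rfl⟩ := hx
    obtain ⟨b, rfl⟩ := hy
    refine ⟨a + b, ?_⟩
    rw [← Finset.sum_add_distrib]
    simp only [Pi.add_apply, map_add, TensorProduct.add_tmul]

instance fintypeDegrees (k : ℕ) : Fintype {p : ℕ × ℕ // p.1 + p.2 = k} :=
  Fintype.subtype (Finset.HasAntidiagonal.antidiagonal k) fun p => by simp

theorem degrees_fst_injective :
    Function.Injective fun p : {p : ℕ × ℕ // p.1 + p.2 = k} => p.1.1 := by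
  rintro ⟨⟨a, b⟩, h⟩ ⟨⟨c, d⟩, h'⟩ (rfl : a = c)
  simp only [Subtype.mk.injEq, Prod.mk.injEq, true_and]
  simp only at h h'
  omega

theorem degrees_snd_le (p : {p : ℕ × ℕ // p.1 + p.2 = k}) : p.1.2 ≤ k := by
  have := p.2
  omega

theorem exists_eq_sum_lof (R : ∀ j ≤ k, G.Representatives j)
    (z : ⨁ p : {p : ℕ × ℕ // p.1 + p.2 = k}, F.Cohomology p.1.1 ⊗[ℝ] G.Cohomology p.1.2) :
    ∃ a : ∀ p : {p : ℕ × ℕ // p.1 + p.2 = k},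
        Fin (R p.1.2 (degrees_snd_le p)).rank → F.cocycles p.1.1,
      z = ∑ p, ∑ s, DirectSum.lof ℝ {p : ℕ × ℕ // p.1 + p.2 = k}
        (fun p => F.Cohomology p.1.1 ⊗[ℝ] G.Cohomology p.1.2) p
        (F.toCohomology p.1.1 (a p s) ⊗ₜ[ℝ]
          G.toCohomology p.1.2 ((R p.1.2 (degrees_snd_le p)).cocycle s)) := by
  choose a ha using fun p => (R p.1.2 (degrees_snd_le p)).exists_tmul_eq_sum (z p)
  refine ⟨a, ?_⟩
  simp only [← map_sum, ← ha]
  exact (DirectSum.sum_univ_of z).symm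

theorem crossMap_sum_lof (R : ∀ j ≤ k, G.Representatives j)
    (a : ∀ p : {p : ℕ × ℕ // p.1 + p.2 = k},
      Fin (R p.1.2 (degrees_snd_le p)).rank → F.cocycles p.1.1) :
    ∃ γ : (F.prod G).cocycles k,
      γ.1 = ∑ p : {p : ℕ × ℕ // p.1 + p.2 = k}, ∑ s, cross p.2 (a p s).1
        ((R p.1.2 (degrees_snd_le p)).form s) ∧
      crossMap F G k (∑ p, ∑ s, DirectSum.lof ℝ {p : ℕ × ℕ // p.1 + p.2 = k}
        (fun p => F.Cohomology p.1.1 ⊗[ℝ] G.Cohomology p.1.2) p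
        (F.toCohomology p.1.1 (a p s) ⊗ₜ[ℝ]
          G.toCohomology p.1.2 ((R p.1.2 (degrees_snd_le p)).cocycle s))) =
      (F.prod G).toCohomology k γ := by
  refine ⟨∑ p : {p : ℕ × ℕ // p.1 + p.2 = k}, ∑ s, crossCocycle p.2 (a p s)
        ((R p.1.2 (degrees_snd_le p)).cocycle s), ?_, ?_⟩
  · simp only [AddSubmonoidClass.coe_finsetSum, coe_crossCocycle]
    rfl
  · simp only [map_sum, crossMap_lof]

theorem exists_eq_sum_cross (R : ∀ j ≤ k, G.Representatives j) {τ : (F.prod G).Form k}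
    (hτ : τ ∈ crossSpan F R k) :
    ∃ a : ∀ p : {p : ℕ × ℕ // p.1 + p.2 = k},
        Fin (R p.1.2 (degrees_snd_le p)).rank → F.Form p.1.1,
      τ = ∑ p : {p : ℕ × ℕ // p.1 + p.2 = k}, ∑ s, cross p.2 (a p s)
        ((R p.1.2 (degrees_snd_le p)).form s) := by
  classical
  induction hτ using Submodule.span_induction with
  | mem τ hτ =>
    obtain ⟨i, j, h, hj, α, r, rfl⟩ := hτ
    refine ⟨Pi.single ⟨(i, j), h⟩ (Pi.single r α), ?_⟩
    rw [Finset.sum_eq_single ⟨(i, j), h⟩, Finset.sum_eq_single r]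
    · rw [Pi.single_eq_same, Pi.single_eq_same]
    · intro s _ hs
      rw [Pi.single_eq_same, Pi.single_eq_of_ne hs, map_zero]
      rfl
    · simp
    · intro p _ hp
      rw [Pi.single_eq_of_ne hp]
      simp
    · simp
  | zero => exact ⟨0, by simp⟩
  | add τ τ' _ _ h1 h2 =>
    obtain ⟨a, rfl⟩ := h1
    obtain ⟨b, rfl⟩ := h2
    exact ⟨a + b, by simp [Finset.sum_add_distrib]⟩
  | smul r τ _ h1 =>
    obtain ⟨a, rfl⟩ := h1
    exact ⟨r • a, by simp [Finset.smul_sum]⟩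

variable [SecondCountableTopology M] [SecondCountableTopology N]

/-- With `z` in normal form, the functionals recover its coefficients from the slices of `γ`. If `γ
= dτ`, then `τ` may be replaced, modulo exact forms, by a combination `σ` of cross products, and the
coefficients of `dσ` are derivatives of those of `σ`. So the coefficients of `z` are exact. -/
theorem eq_zero_of_crossMap_eq_zero (R : ∀ j ≤ k, G.Representatives j)
    {z : ⨁ p : {p : ℕ × ℕ // p.1 + p.2 = k}, F.Cohomology p.1.1 ⊗[ℝ] G.Cohomology p.1.2}
    (hz : crossMap F G k z = 0) : z = 0 := by
  obtain ⟨a, rfl⟩ := exists_eq_sum_lof R z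
  obtain ⟨γ, hγ, hγz⟩ := crossMap_sum_lof R a
  rw [hγz, toCohomology_eq_zero_iff] at hz
  have hcoef : ∀ (p : {p : ℕ × ℕ // p.1 + p.2 = k}) s x (u : Fin p.1.1 → F.tangent x),
      (R p.1.2 (degrees_snd_le p)).coef s (slice p.2 γ.1 u) = (a p s).1.1 x u := by
    intro p s x u
    have h1 := slice_sum_cross (fun p : {p : ℕ × ℕ // p.1 + p.2 = k} => p.2)
      degrees_fst_injective (fun p s => (a p s).1)
      (fun p => (R p.1.2 (degrees_snd_le p)).form) p u
    rw [hγ]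
    refine (congrArg _ h1).trans ?_
    exact (R p.1.2 (degrees_snd_le p)).coef_sum s _
  have hexact : ∀ p s, (a p s).1 ∈ F.coboundaries p.1.1 := by
    intro p s
    cases k with
    | zero =>
      have h0 : (a p s).1 = 0 := by
        refine form_ext fun x => AlternatingMap.ext fun u => ?_
        rw [← hcoef p s x u, show γ.1 = 0 from hz, ← sliceMap_apply, map_zero, map_zero]
        rfl
      rw [h0]
      exact Submodule.zero_mem _
    | succ m =>
      obtain ⟨τ, hτ⟩ := mem_coboundaries_succ_iff.1 hz
      have hmem : γ.1 ∈ crossSpan F R (m + 1) := by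
        rw [hγ]
        exact Submodule.sum_mem _ fun p _ => Submodule.sum_mem _ fun s _ =>
          cross_mem_crossSpan R p.2 (degrees_snd_le p) _ s
      obtain ⟨ξ, hξ, σ, hσ, rfl⟩ := Submodule.mem_sup.1
        (mem_coboundaries_sup_crossSpan R (Nat.le_succ m) (by rw [hτ]; exact hmem))
      rw [map_add, d_eq_zero_of_mem_coboundaries hξ, zero_add] at hτ
      obtain ⟨β, hβ, hβ'⟩ := exists_coboundary_coef_d R hσ p.2 (degrees_snd_le p) s
      have h0 : (a p s).1 = β := by
        refine form_ext fun x => AlternatingMap.ext fun u => ?_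
        rw [← hcoef p s x u, ← hβ' x u, hτ]
      rw [h0]
      exact hβ
  refine Finset.sum_eq_zero fun p _ => Finset.sum_eq_zero fun s _ => ?_
  rw [toCohomology_eq_zero_iff.2 (hexact p s), TensorProduct.zero_tmul, map_zero]

theorem crossMap_injective (R : ∀ j ≤ k, G.Representatives j) :
    Function.Injective (crossMap F G k) := by
  intro z w hzw
  have h1 : z + (-1 : ℝ) • w = 0 := eq_zero_of_crossMap_eq_zero R (by
    rw [map_add, map_smul, hzw, neg_one_smul, add_neg_cancel])
  have h2 : (-1 : ℝ) • w + w = 0 := by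
    conv_lhs => rw [← one_smul ℝ w, smul_smul, ← add_smul]
    simp
  rw [← add_zero z, ← h2, ← add_assoc, h1, zero_add]

/-- A closed form equals, modulo exact forms, a closed combination `σ` of cross products. It remains
to see that the coefficients of `σ` are closed. -/
theorem crossMap_surjective (R : ∀ j ≤ k, G.Representatives j) :
    Function.Surjective (crossMap F G k) := by
  intro y
  obtain ⟨τ, rfl⟩ := toCohomology_surjective y
  have hd := mem_cocycles_iff.1 τ.2
  obtain ⟨ξ, hξ, σ, hσ, hτ⟩ := Submodule.mem_sup.1
    (mem_coboundaries_sup_crossSpan R le_rfl (τ := τ.1) (by rw [hd]; exact Submodule.zero_mem _))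
  have hdσ : (F.prod G).d k σ = 0 := by
    rwa [← hτ, map_add, d_eq_zero_of_mem_coboundaries hξ, zero_add] at hd
  obtain ⟨a, ha⟩ := exists_eq_sum_cross R hσ
  -- `dσ = 0` is a relation among cross products of the `F.d p.1.1 (a p s)` with representatives;
  -- slicing and applying the functionals isolates each of them.
  have hda : ∀ p s, F.d p.1.1 (a p s) = 0 := by
    intro p s
    have hh : ∀ p : {p : ℕ × ℕ // p.1 + p.2 = k}, p.1.1 + 1 + p.1.2 = k + 1 := fun p => by
      have := p.2
      omega
    have h1 : ∑ p, ∑ s, cross (hh p) (F.d p.1.1 (a p s))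
        ((R p.1.2 (degrees_snd_le p)).form s) = 0 := by
      rw [← hdσ, ha]
      simp only [map_sum]
      refine Finset.sum_congr rfl fun p _ => Finset.sum_congr rfl fun s _ => ?_
      exact (d_cross _ _ _ ((R p.1.2 (degrees_snd_le p)).d_form s)).symm
    refine form_ext fun x => AlternatingMap.ext fun u => ?_
    have h2 := slice_sum_cross hh
      (fun p q hpq => degrees_fst_injective (Nat.succ_injective hpq))
      (fun p s => F.d p.1.1 (a p s)) (fun p => (R p.1.2 (degrees_snd_le p)).form) p u
    have h3 := congrArg ((R p.1.2 (degrees_snd_le p)).coef s) h2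
    rw [(R p.1.2 (degrees_snd_le p)).coef_sum s, h1, ← sliceMap_apply, map_zero, map_zero] at h3
    exact h3.symm
  obtain ⟨γ, hγ, hγz⟩ := crossMap_sum_lof R fun p s => ⟨a p s, mem_cocycles_iff.2 (hda p s)⟩
  refine ⟨_, hγz.trans ?_⟩
  rw [← sub_eq_zero, ← map_sub, toCohomology_eq_zero_iff]
  have h1 : (γ - τ).1 = -ξ := by
    rw [Submodule.coe_sub, hγ, ← ha, ← hτ]
    abel
  rw [h1]
  exact Submodule.neg_mem _ hξ

end Foliation

end

end

theorem mainTheorem2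
    {E H : Type*} [NormedAddCommGroup E] [NormedSpace ℝ E] [FiniteDimensional ℝ E]
    [TopologicalSpace H] {I : ModelWithCorners ℝ E H} [I.Boundaryless]
    {M : Type*} [TopologicalSpace M] [ChartedSpace H M] [IsManifold I ∞ M]
    [T2Space M] [SecondCountableTopology M]
    {E' H' : Type*} [NormedAddCommGroup E'] [NormedSpace ℝ E'] [FiniteDimensional ℝ E']
    [TopologicalSpace H'] {J : ModelWithCorners ℝ E' H'} [J.Boundaryless]
    {N : Type*} [TopologicalSpace N] [ChartedSpace H' N] [IsManifold J ∞ N]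
    [T2Space N] [SecondCountableTopology N]
    (F : Foliation I M) (G : Foliation J N) (k : ℕ)
    (hG : ∀ j ≤ k, FiniteDimensional ℝ (G.Cohomology j)) :
    ∃ e : (⨁ p : {p : ℕ × ℕ // p.1 + p.2 = k}, F.Cohomology p.1.1 ⊗[ℝ] G.Cohomology p.1.2) ≃ₗ[ℝ]
        (F.prod G).Cohomology k,
      ∀ (p : {p : ℕ × ℕ // p.1 + p.2 = k}) (α : F.cocycles p.1.1) (β : G.cocycles p.1.2),
        ∃ γ : (F.prod G).cocycles k,
          (∀ (x : M) (y : N), γ.1.1 (x, y) = Foliation.crossAt (F.tangent x) (G.tangent y)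
            p.2 (α.1.1 x) (β.1.1 y)) ∧
          e (DirectSum.lof ℝ {p : ℕ × ℕ // p.1 + p.2 = k}
              (fun p => F.Cohomology p.1.1 ⊗[ℝ] G.Cohomology p.1.2) p
              (F.toCohomology p.1.1 α ⊗ₜ[ℝ] G.toCohomology p.1.2 β)) =
            (F.prod G).toCohomology k γ := by
  have hne : ∀ j ≤ k, Nonempty (G.Representatives j) := fun j hj => by
    have := hG j hj
    exact Foliation.nonempty_representatives
  let R : ∀ j ≤ k, G.Representatives j := fun j hj => (hne j hj).some
  refine ⟨LinearEquiv.ofBijective (Foliation.crossMap F G k)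
    ⟨Foliation.crossMap_injective R, Foliation.crossMap_surjective R⟩, fun p α β => ?_⟩
  exact ⟨Foliation.crossCocycle p.2 α β, fun x y => rfl, Foliation.crossMap_lof p α β⟩
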